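/- Let $M$ be a smooth $8$-manifold with a $Spin(7)$-structure, i.e. a smooth $4$-form $\Phi$ and a smooth Riemannian metric $g$ (determined by $\Phi$) such that at every point of $M$ there is a $g$-orthonormal basis $e_0,\dots,e_7$ of (co)vectors in which $$\Phi=-e_{0127}+e_{0236}-e_{0347}-e_{0567}+e_{0146}+e_{0245}-e_{0135}-e_{3456}-e_{1457}-e_{1256}-e_{1234}-e_{2357}-e_{1367}+e_{2467},$$ where $e_{ijkl}=e_i\wedge e_j\wedge e_k\wedge e_l$. Let $\nabla^g$ be the Levi-Civita connection and let $\delta\Phi$ be the codifferential, $(\delta\Phi)_{klm}=-\nabla^g_j\Phi_{jklm}$ (components in an orthonormal frame, repeated indices summed). The Lee form is $\theta_a=\frac1{42}(\delta\Phi)_{ijk}\Phi_{ijka}$, and the torsion $3$-form is $T=\delta\Phi+\frac76\,\theta\lrcorner\Phi$, with $(\theta\lrcorner\Phi)_{jkl}=\theta_s\Phi_{sjkl}$. The $Spin(7)$-torsion connection $\nabla$ is given by $g(\nabla_XY,Z)=g(\nabla^g_XY,Z)+\frac12T(X,Y,Z)$; it is the unique linear connection with totally skew-symmetric torsion satisfying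 $\nabla g=\nabla\Phi=0$, and its torsion is $T$. Let $Scal^g$ and $Scal$ be the scalar curvatures (the $g$-traces of the Ricci tensors) of $\nabla^g$ and $\nabla$. Suppose that the structure is balanced, i.e. $\theta=0$ on $M$. 1. If $Scal^g=0$ on $M$ or $Scal=0$ on $M$, then the structure is parallel: $\nabla^g\Phi=0$. 2. In particular, if the torsion $3$-form is closed, $dT=0$, then $\nabla^g\Phi=0$. -/

import Mathlib

open scoped Manifold ContDiff

noncomputable section

namespace Spin7

/-- The Euclidean space `ℝ⁸`, with coordinates indexed by `0, …, 7`. -/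
abbrev R8 : Type := EuclideanSpace ℝ (Fin 8)

/-- The decomposable 4-form `e_a ∧ e_b ∧ e_c ∧ e_d` on `ℝ⁸`
(its value on `v₀, …, v₃` is the determinant of the matrix `(v_r)_{a,b,c,d}`). -/
def wedge4 (a b c d : Fin 8) : R8 [⋀^Fin 4]→ₗ[ℝ] ℝ :=
  (Matrix.detRowAlternating (R := ℝ) (n := Fin 4)).compLinearMap
    (LinearMap.pi fun s => (EuclideanSpace.proj (𝕜 := ℝ) (![a, b, c, d] s)).toLinearMap)

/-- The model 4-form on `ℝ⁸` whose stabilizer in `GL(8, ℝ)` is `Spin(7)`. -/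
def modelForm : R8 [⋀^Fin 4]→ₗ[ℝ] ℝ :=
  - wedge4 0 1 2 7 + wedge4 0 2 3 6 - wedge4 0 3 4 7 - wedge4 0 5 6 7
  + wedge4 0 1 4 6 + wedge4 0 2 4 5 - wedge4 0 1 3 5
  - wedge4 3 4 5 6 - wedge4 1 4 5 7 - wedge4 1 2 5 6 - wedge4 1 2 3 4
  - wedge4 2 3 5 7 - wedge4 1 3 6 7 + wedge4 2 4 6 7

/-! ### Tensor calculus in coordinates on `ℝ⁸`

The components of a metric and of a 4-form in a coordinate system are functions
`g i j : ℝ⁸ → ℝ` and `φ i j k l : ℝ⁸ → ℝ`. -/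

/-- Components of a covariant 2-tensor field in coordinates. -/
abbrev Comp2 : Type := Fin 8 → Fin 8 → R8 → ℝ
/-- Components of a covariant 3-tensor field, or connection coefficients, in coordinates. -/
abbrev Comp3 : Type := Fin 8 → Fin 8 → Fin 8 → R8 → ℝ
/-- Components of a covariant 4-tensor field in coordinates. -/
abbrev Comp4 : Type := Fin 8 → Fin 8 → Fin 8 → Fin 8 → R8 → ℝ

/-- The partial derivative `∂_i f`. -/
def pd (i : Fin 8) (f : R8 → ℝ) (u : R8) : ℝ :=
  fderiv ℝ f u (EuclideanSpace.single i 1)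

/-- The inverse metric `g^{ij}`. -/
def invMetric (g : Comp2) : Comp2 := fun i j u =>
  (Matrix.of fun a b => g a b u)⁻¹ i j

/-- The Christoffel symbols `Γ^k_{ij}` of the Levi-Civita connection, written
`christoffel g k i j`, so that `∇^g_{∂_i} ∂_j = Γ^k_{ij} ∂_k`. -/
def christoffel (g : Comp2) : Comp3 := fun k i j u =>
  (1 / 2) * ∑ l, invMetric g k l u * (pd i (g j l) u + pd j (g i l) u - pd l (g i j) u)

/-- The components `(∇^g_p φ)_{ijkl}` of the Levi-Civita covariant derivative of a 4-form. -/
def nablaForm (g : Comp2) (φ : Comp4) (p i j k l : Fin 8) (u : R8) : ℝ :=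
  pd p (φ i j k l) u
    - ∑ s, (christoffel g s p i u * φ s j k l u + christoffel g s p j u * φ i s k l u
        + christoffel g s p k u * φ i j s l u + christoffel g s p l u * φ i j k s u)

/-- The codifferential of a 4-form: `(δφ)_{klm} = - g^{pq} (∇^g_p φ)_{qklm}`. -/
def codiff (g : Comp2) (φ : Comp4) : Comp3 := fun k l m u =>
  - ∑ p, ∑ q, invMetric g p q u * nablaForm g φ p q k l m u

/-- The Lee form `θ = (1/7) (δφ) ⌟ φ`, that is `θ_a = (1/42) (δφ)^{ijk} φ_{ijka}`. -/
def lee (g : Comp2) (φ : Comp4) (a : Fin 8) (u : R8) : ℝ :=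
  (1 / 42) * ∑ i, ∑ j, ∑ k, ∑ i', ∑ j', ∑ k',
    invMetric g i i' u * invMetric g j j' u * invMetric g k k' u
      * codiff g φ i j k u * φ i' j' k' a u

/-- The torsion 3-form `T = δφ + (7/6) θ ⌟ φ`. -/
def torsion (g : Comp2) (φ : Comp4) : Comp3 := fun i j k u =>
  codiff g φ i j k u + (7 / 6) * ∑ s, ∑ t, invMetric g s t u * lee g φ s u * φ t i j k u

/-- The exterior derivative of a 3-form. -/
def extDeriv3 (T : Comp3) : Comp4 := fun i j k l u =>
  pd i (T j k l) u - pd j (T i k l) u + pd k (T i j l) u - pd l (T i j k) u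

/-- The coefficients of the torsion connection `∇ = ∇^g + T/2`, that is
`∇_{∂_i} ∂_j = (Γ^k_{ij} + (1/2) g^{kl} T_{ijl}) ∂_k`. -/
def torsionConn (g : Comp2) (φ : Comp4) : Comp3 := fun k i j u =>
  christoffel g k i j u + (1 / 2) * ∑ l, invMetric g k l u * torsion g φ i j l u

/-- The curvature of the linear connection `∇_{∂_i} ∂_j = A^k_{ij} ∂_k`, with
`R(X, Y) = [∇_X, ∇_Y] - ∇_{[X, Y]}`:
`R(∂_i, ∂_j) ∂_k = (curvature A l i j k) ∂_l`, summed over `l`. -/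
def curvature (A : Comp3) : Comp4 := fun l i j k u =>
  pd i (A l j k) u - pd j (A l i k) u
    + ∑ m, (A m j k u * A l i m u - A m i k u * A l j m u)

/-- The Ricci tensor `Ric(∂_j, ∂_k)`, the trace of `X ↦ R(X, ∂_j) ∂_k`. -/
def ricci (A : Comp3) : Comp2 := fun j k u => ∑ i, curvature A i i j k u

/-- The scalar curvature of a linear connection with respect to a metric: `g^{jk} Ric_{jk}`. -/
def scal (g : Comp2) (A : Comp3) (u : R8) : ℝ :=
  ∑ j, ∑ k, invMetric g j k u * ricci A j k u

/-! ### `Spin(7)`-structures on manifolds -/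

section Manifold

variable {M : Type*} [TopologicalSpace M] [ChartedSpace R8 M]

/-- The coordinate vector `∂_i` of the chart `e`, at the point of `M` with coordinates `u`. -/
def coordVec (e : OpenPartialHomeomorph M R8) (i : Fin 8) (u : R8) :
    TangentSpace 𝓘(ℝ, R8) (e.symm u) :=
  mfderiv 𝓘(ℝ, R8) 𝓘(ℝ, R8) e.symm u (EuclideanSpace.single i 1 : R8)

/-- The components `Φ(∂_i, ∂_j, ∂_k, ∂_l)` of a 4-form in the chart `e`. -/
def formComp (Φ : ∀ x : M, (TangentSpace 𝓘(ℝ, R8) x) [⋀^Fin 4]→ₗ[ℝ] ℝ)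
    (e : OpenPartialHomeomorph M R8) : Comp4 := fun i j k l u =>
  Φ (e.symm u) ![coordVec e i u, coordVec e j u, coordVec e k u, coordVec e l u]

variable [IsManifold 𝓘(ℝ, R8) ∞ M]

variable (M) in
/-- A (smooth) `Spin(7)`-structure on a smooth 8-manifold: a smooth 4-form `Φ` and a smooth
Riemannian metric `g` such that every tangent space has a `g`-orthonormal frame in which `Φ` is
the model 4-form. (The metric is determined by `Φ`.) -/
structure Spin7Structure where
  /-- The Riemannian metric induced by the structure. -/
  metric : Bundle.ContMDiffRiemannianMetric 𝓘(ℝ, R8) ∞ R8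
    (fun x : M => TangentSpace 𝓘(ℝ, R8) x)
  /-- The fundamental 4-form. -/
  form : ∀ x : M, (TangentSpace 𝓘(ℝ, R8) x) [⋀^Fin 4]→ₗ[ℝ] ℝ
  form_smooth : ∀ e ∈ atlas R8 M, ∀ i j k l : Fin 8,
    ContDiffOn ℝ ∞ (formComp form e i j k l) e.target
  adapted : ∀ x : M, ∃ f : R8 ≃ₗ[ℝ] TangentSpace 𝓘(ℝ, R8) x,
    (∀ v w : R8, metric.inner x (f v) (f w) = inner ℝ v w) ∧
    ∀ v : Fin 4 → R8, form x (fun r => f (v r)) = modelForm v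

namespace Spin7Structure

variable (S : Spin7Structure M)

/-- The components `g(∂_i, ∂_j)` of the metric in the chart `e`. -/
def gComp (e : OpenPartialHomeomorph M R8) : Comp2 := fun i j u =>
  S.metric.inner (e.symm u) (coordVec e i u) (coordVec e j u)

/-- The components of the fundamental 4-form in the chart `e`. -/
def ΦComp (e : OpenPartialHomeomorph M R8) : Comp4 := formComp S.form e

/-- The Lee form vanishes identically, `θ = 0`. -/
def IsBalanced : Prop :=
  ∀ e ∈ atlas R8 M, ∀ u ∈ e.target, ∀ a : Fin 8, lee (S.gComp e) (S.ΦComp e) a u = 0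

/-- The fundamental form is parallel for the Levi-Civita connection, `∇^g Φ = 0`. -/
def IsParallel : Prop :=
  ∀ e ∈ atlas R8 M, ∀ u ∈ e.target, ∀ p i j k l : Fin 8,
    nablaForm (S.gComp e) (S.ΦComp e) p i j k l u = 0

/-- The Riemannian scalar curvature vanishes identically, `Scal^g = 0`. -/
def RiemannianScalarFlat : Prop :=
  ∀ e ∈ atlas R8 M, ∀ u ∈ e.target, scal (S.gComp e) (christoffel (S.gComp e)) u = 0

/-- The scalar curvature of the torsion connection vanishes identically, `Scal = 0`. -/
def TorsionScalarFlat : Prop :=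
  ∀ e ∈ atlas R8 M, ∀ u ∈ e.target,
    scal (S.gComp e) (torsionConn (S.gComp e) (S.ΦComp e)) u = 0

/-- The torsion 3-form is closed, `dT = 0`. -/
def HasClosedTorsion : Prop :=
  ∀ e ∈ atlas R8 M, ∀ u ∈ e.target, ∀ i j k l : Fin 8,
    extDeriv3 (torsion (S.gComp e) (S.ΦComp e)) i j k l u = 0

end Spin7Structure

end Manifold

end Spin7

end

/-!
The components of `Φ` in an adapted frame are built from the octonions and satisfy quadratic
identities whose coefficients are the metric. Differentiating these identities shows that every
`∇_p Φ` lies in `Λ⁴₇`, so that `∇_p Φ = ∑ₘ (vₘ)_p λₘ`, where the basis elements `λₘ` correspond to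
seven anticommuting complex structures `Jₘ` of `ℝ⁸`. The balanced condition becomes
`∑ₘ Jₘ vₘ = 0`, and the Clifford relations then yield `|δΦ|² = 12 ∑ₘ |vₘ|²` and
`∇_p Φ_{aijk} ∇_a Φ_{pijk} = 36 ∑ₘ |vₘ|²`. In particular `δΦ = 0` implies `∇Φ = 0`.

As `θ = 0`, the tensor `Φ_{pijk} ∇_b Φ_{aijk}`, which is skew in `p` and `a`, has no traces.
Commuting the two derivatives in `∇_p ∇_a Φ`, contracted with `Φ`, and evaluating the curvature
term with the first Bianchi identity therefore gives `24 Scal^g = |δΦ|² - 3 |δΦ|²`. As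
`Scal = Scal^g - |δΦ|² / 4`, the vanishing of either scalar curvature implies `δΦ = 0`.

If `T = δΦ` is closed, take the divergence of `Φ_{aijk} (δΦ)_{ijk} = 0`: the term
`Φ_{aijk} ∇_a (δΦ)_{ijk}` is a contraction of `d(δΦ) = 0`, and what remains is `-|δΦ|²`.
-/

noncomputable section

namespace Spin7

open scoped Kronecker Matrix

section AlternatingArrays

variable {ι R : Type*} [AddCommGroup R]

/-- A three-index array which changes sign under transpositions of adjacent indices. -/
structure Alt₃ (T : ι → ι → ι → R) : Prop where
  swap₁₂ : ∀ i j k, T i j k = -T j i k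
  swap₂₃ : ∀ i j k, T i j k = -T i k j

/-- A four-index array which changes sign under transpositions of adjacent indices. -/
structure Alt₄ (T : ι → ι → ι → ι → R) : Prop where
  swap₁₂ : ∀ i j k l, T i j k l = -T j i k l
  swap₂₃ : ∀ i j k l, T i j k l = -T i k j l
  swap₃₄ : ∀ i j k l, T i j k l = -T i j l k

namespace Alt₃

variable {S T : ι → ι → ι → R}

theorem swap₁₃ (h : Alt₃ T) (i j k : ι) : T i j k = -T k j i := by
  rw [h.swap₁₂, h.swap₂₃, h.swap₁₂, neg_neg]

theorem rotate (h : Alt₃ T) (i j k : ι) : T i j k = T j k i := by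
  rw [h.swap₁₂, h.swap₂₃, neg_neg]

theorem ext_of_lt [LinearOrder ι] [IsAddTorsionFree R] (hS : Alt₃ S) (hT : Alt₃ T)
    (h : ∀ i j k, i < j → j < k → S i j k = T i j k) (i j k : ι) : S i j k = T i j k := by
  have eq_zero₁₂ : ∀ i k, S i i k = 0 ∧ T i i k = 0 := fun i k =>
    ⟨self_eq_neg.1 (hS.swap₁₂ i i k), self_eq_neg.1 (hT.swap₁₂ i i k)⟩
  have eq_zero₂₃ : ∀ i j, S i j j = 0 ∧ T i j j = 0 := fun i j =>
    ⟨self_eq_neg.1 (hS.swap₂₃ i j j), self_eq_neg.1 (hT.swap₂₃ i j j)⟩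
  have swap₁₂ := fun i j k => And.intro (hS.swap₁₂ i j k) (hT.swap₁₂ i j k)
  have swap₂₃ := fun i j k => And.intro (hS.swap₂₃ i j k) (hT.swap₂₃ i j k)
  rcases lt_trichotomy i j with hij | hij | hij <;>
    rcases lt_trichotomy j k with hjk | hjk | hjk <;>
    rcases lt_trichotomy i k with hik | hik | hik <;> grind

end Alt₃

namespace Alt₄

variable {S T : ι → ι → ι → ι → R}

theorem alt₃ (h : Alt₄ T) (i : ι) : Alt₃ (T i) := ⟨h.swap₂₃ i, h.swap₃₄ i⟩

theorem alt₃' (h : Alt₄ T) (l : ι) : Alt₃ fun i j k => T i j k l :=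
  ⟨fun i j k => h.swap₁₂ i j k l, fun i j k => h.swap₂₃ i j k l⟩

theorem swap₁₄ (h : Alt₄ T) (i j k l : ι) : T i j k l = -T l j k i := by
  rw [h.swap₁₂, (h.alt₃ j).swap₁₃, h.swap₁₂, neg_neg]

theorem swap_pairs (h : Alt₄ T) (i j k l : ι) : T i j k l = T k l i j := by
  rw [h.swap₂₃, h.swap₁₂, h.swap₃₄, h.swap₂₃, neg_neg, neg_neg]

theorem ext_of_lt [LinearOrder ι] [IsAddTorsionFree R] (hS : Alt₄ S) (hT : Alt₄ T)
    (h : ∀ i j k l, i < j → j < k → k < l → S i j k l = T i j k l) (i j k l : ι) :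
    S i j k l = T i j k l := by
  refine (hS.alt₃ i).ext_of_lt (hT.alt₃ i) (fun j k l hjk hkl => ?_) j k l
  have eq_zero : ∀ i k l, S i i k l = 0 ∧ T i i k l = 0 := fun i k l =>
    ⟨self_eq_neg.1 (hS.swap₁₂ i i k l), self_eq_neg.1 (hT.swap₁₂ i i k l)⟩
  have swap₁₂ := fun i j k l => And.intro (hS.swap₁₂ i j k l) (hT.swap₁₂ i j k l)
  have swap₂₃ := fun i j k l => And.intro (hS.swap₂₃ i j k l) (hT.swap₂₃ i j k l)
  have swap₃₄ := fun i j k l => And.intro (hS.swap₃₄ i j k l) (hT.swap₃₄ i j k l)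
  rcases lt_trichotomy i j with hij | rfl | hij
  · exact h i j k l hij hjk hkl
  · grind
  rcases lt_trichotomy i k with hik | rfl | hik
  · grind
  · grind
  rcases lt_trichotomy i l with hil | rfl | hil <;> grind

end Alt₄

theorem alt₃_cyclic {K : ι → ι → ι → R} (h : ∀ i j k, K i j k = -K i k j) :
    Alt₃ fun i j k => K i j k + K j k i + K k i j where
  swap₁₂ i j k := by rw [h i j k, h j k i, h k i j]; abel
  swap₂₃ i j k := by rw [h i j k, h j k i, h k i j]; abel

theorem alt₄_alternatingMap {𝕜 V W : Type*} [Semiring 𝕜] [AddCommMonoid V] [Module 𝕜 V]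
    [AddCommGroup W] [Module 𝕜 W] (f : V [⋀^Fin 4]→ₗ[𝕜] W) (v : ι → V) :
    Alt₄ fun i j k l => f ![v i, v j, v k, v l] where
  swap₁₂ i j k l := by
    rw [← f.map_swap _ (show (0 : Fin 4) ≠ 1 by decide)]
    congr 1; ext r; fin_cases r <;> rfl
  swap₂₃ i j k l := by
    rw [← f.map_swap _ (show (1 : Fin 4) ≠ 2 by decide)]
    congr 1; ext r; fin_cases r <;> rfl
  swap₃₄ i j k l := by
    rw [← f.map_swap _ (show (2 : Fin 4) ≠ 3 by decide)]
    congr 1; ext r; fin_cases r <;> rfl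

end AlternatingArrays

/-! ### Octonionic description of the model form -/

/-- The element of `𝔽₂³`, encoded in binary, that labels the octonion unit `e_i`. -/
def octonionLabel : Fin 8 → ℕ := ![0, 1, 3, 6, 4, 7, 5, 2]

/-- The Albuquerque–Majid cochain, which presents the octonions as the twisted group algebra of
`𝔽₂³`: the units multiply by `e_x * e_y = (-1) ^ octonionCochain x y • e_(x + y)`. -/
def octonionCochain (x y : ℕ) : ℕ :=
  let x₁ := x % 2; let x₂ := x / 2 % 2; let x₃ := x / 4
  let y₁ := y % 2; let y₂ := y / 2 % 2; let y₃ := y / 4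
  x₁ * (y₁ + y₂ + y₃) + x₂ * (y₂ + y₃) + x₃ * y₃ + y₁ * x₂ * x₃ + x₁ * y₂ * x₃ + x₁ * x₂ * y₃

/-- The sign `(-1) ^ n`, in a form which evaluates quickly. -/
def paritySign (n : ℕ) : ℤ := if n % 2 = 0 then 1 else -1

/-- The sign of `e_x * conj e_y`, as an exponent of `-1`. -/
def conjCochain (x y : ℕ) : ℕ := octonionCochain x y + octonionCochain y y

/-- The coefficient of the imaginary octonion unit labelled `m + 1` in `e_i * conj e_j`. For fixed
`m` this is a complex structure on `ℝ⁸`, and the seven of them span `Λ²₇`. -/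
def clifford (m : Fin 7) (i j : Fin 8) : ℤ :=
  if octonionLabel i ^^^ octonionLabel j = m + 1 then
    paritySign (conjCochain (octonionLabel i) (octonionLabel j)) else 0

/-- The label of the product of four octonion units. -/
def crossLabel (i j k l : Fin 8) : ℕ :=
  octonionLabel i ^^^ octonionLabel j ^^^ octonionLabel k ^^^ octonionLabel l

/-- The sign of `((e_i * conj e_j) * e_k) * conj e_l`. -/
def crossSign (i j k l : Fin 8) : ℤ :=
  paritySign (conjCochain (octonionLabel i) (octonionLabel j) +
    octonionCochain (octonionLabel i ^^^ octonionLabel j) (octonionLabel k) +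
    conjCochain (octonionLabel i ^^^ octonionLabel j ^^^ octonionLabel k) (octonionLabel l))

/-- The fourfold cross product on the octonions: the coefficient of the unit labelled `m` in
`((e_i * conj e_j) * e_k) * conj e_l`, for distinct `i`, `j`, `k`, `l`. The component `m = 0` is the
model form, and the components `m ≠ 0` span `Λ⁴₇`. -/
def cross (m i j k l : Fin 8) : ℤ :=
  if crossLabel i j k l = m ∧ [i, j, k, l].Nodup then crossSign i j k l else 0

theorem crossSign_swap : ∀ i j k l, [i, j, k, l].Nodup → crossSign i j k l = -crossSign j i k l ∧
    crossSign i j k l = -crossSign i k j l ∧ crossSign i j k l = -crossSign i j l k := by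
  decide +kernel

theorem cross_eq_neg {m i j k l i' j' k' l' : Fin 8}
    (hlabel : crossLabel i j k l = crossLabel i' j' k' l')
    (hperm : [i, j, k, l].Perm [i', j', k', l'])
    (hsign : [i, j, k, l].Nodup → crossSign i j k l = -crossSign i' j' k' l') :
    cross m i j k l = -cross m i' j' k' l' := by
  unfold cross
  simp only [← hperm.nodup_iff, ← hlabel]
  split_ifs with h
  · exact hsign h.2
  · rfl

theorem alt₄_cross (m : Fin 8) : Alt₄ (cross m) where
  swap₁₂ i j k l := cross_eq_neg (by unfold crossLabel; ac_rfl)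
    (.swap ..) fun h => (crossSign_swap i j k l h).1
  swap₂₃ i j k l := cross_eq_neg (by unfold crossLabel; ac_rfl)
    ((List.Perm.swap ..).cons _) fun h => (crossSign_swap i j k l h).2.1
  swap₃₄ i j k l := cross_eq_neg (by unfold crossLabel; ac_rfl)
    (((List.Perm.swap ..).cons _).cons _) fun h => (crossSign_swap i j k l h).2.2

theorem clifford_swap : ∀ m i j, clifford m i j = -clifford m j i := by decide +kernel

theorem clifford_anticomm : ∀ m n i j, ∑ k, (clifford m i k * clifford n k j +
    clifford n i k * clifford m k j) = if m = n ∧ i = j then -2 else 0 := by decide +kernel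

/-! ### Quadratic identities of the model form -/

theorem sum_cross_mul_of_lt : ∀ i j k, i < j → j < k → ∀ l m n, l < m → m < n →
    ∑ x, cross 0 x i j k * cross 0 x l m n = (if i = l ∧ j = m ∧ k = n then 1 else 0)
      - ((if i = l then cross 0 j k m n else 0) + (if i = m then cross 0 j k n l else 0)
        + (if i = n then cross 0 j k l m else 0) + (if j = l then cross 0 k i m n else 0)
        + (if j = m then cross 0 k i n l else 0) + (if j = n then cross 0 k i l m else 0)
        + (if k = l then cross 0 i j m n else 0) + (if k = m then cross 0 i j n l else 0)
        + (if k = n then cross 0 i j l m else 0)) := by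
  decide +kernel

theorem sum_clifford_mul_cross : ∀ i j, i < j → ∀ k, j < k → ∀ l, k < l → ∀ a b,
    ∑ m : Fin 7, clifford m a b * cross m.succ i j k l =
      (if b = i then cross 0 a j k l else 0) + (if b = j then cross 0 i a k l else 0)
      + (if b = k then cross 0 i j a l else 0) + (if b = l then cross 0 i j k a else 0)
      - (if a = i then cross 0 b j k l else 0) - (if a = j then cross 0 i b k l else 0)
      - (if a = k then cross 0 i j b l else 0) - (if a = l then cross 0 i j k b else 0) := by
  decide +kernel

theorem cross_succ_of_lt : ∀ j k, j < k → ∀ l, k < l → ∀ m i, cross m.succ i j k l =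
    (if i = j then clifford m k l else 0) + (if i = k then clifford m l j else 0)
      + (if i = l then clifford m j k else 0) - ∑ s, clifford m i s * cross 0 s j k l := by
  decide +kernel

theorem sum_clifford_eigen : ∀ m i j,
    ∑ k, ∑ l, clifford m k l * cross 0 i j k l = -6 * clifford m i j := by
  decide +kernel

/-! ### Arrays as matrices -/

section Arrays

variable {ι κ : Type*}

/-- An array with four indices as a matrix whose rows are indexed by the first index. -/
def toMat (T : ι → ι → ι → ι → ℝ) : Matrix ι (ι × ι × ι) ℝ :=
  .of fun i J => T i J.1 J.2.1 J.2.2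

/-- An array with four indices as a matrix whose rows are indexed by the first two indices. -/
def toMat₂ (T : ι → ι → ι → ι → ℝ) : Matrix (ι × ι) (ι × ι) ℝ :=
  .of fun I J => T I.1 I.2 J.1 J.2

/-- The third tensor power of a matrix. -/
def cube (P : Matrix ι κ ℝ) : Matrix (ι × ι × ι) (κ × κ × κ) ℝ := P ⊗ₖ (P ⊗ₖ P)

@[simp] theorem toMat_apply (T : ι → ι → ι → ι → ℝ) (i : ι) (J : ι × ι × ι) :
    toMat T i J = T i J.1 J.2.1 J.2.2 := rfl

@[simp] theorem toMat₂_apply (T : ι → ι → ι → ι → ℝ) (I J : ι × ι) :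
    toMat₂ T I J = T I.1 I.2 J.1 J.2 := rfl

@[simp] theorem cube_apply (P : Matrix ι κ ℝ) (I : ι × ι × ι) (J : κ × κ × κ) :
    cube P I J = P I.1 J.1 * (P I.2.1 J.2.1 * P I.2.2 J.2.2) := rfl

theorem cube_transpose (P : Matrix ι κ ℝ) : (cube P)ᵀ = cube Pᵀ := rfl

theorem cube_mul {μ : Type*} [Fintype κ] (P : Matrix ι κ ℝ) (Q : Matrix κ μ ℝ) :
    cube (P * Q) = cube P * cube Q := by
  simp only [cube, Matrix.mul_kronecker_mul]

theorem sum_mul_eq_sum_gram [Fintype ι] {S T : ι → ι → ι → ι → ℝ} (hS : Alt₄ S) (hT : Alt₄ T)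
    (i j k l : ι) : ∑ x, ∑ y, S i j x y * T k l x y =
      ∑ y, ((toMat S)ᵀ * toMat T) (i, j, y) (k, l, y) := by
  have hrot : ∀ {T : ι → ι → ι → ι → ℝ}, Alt₄ T → ∀ i j x y, T i j x y = T x i j y :=
    fun h i j x y => by rw [h.swap₂₃, h.swap₁₂, neg_neg]
  rw [Finset.sum_comm]
  refine Finset.sum_congr rfl fun y _ => Finset.sum_congr rfl fun x _ => ?_
  rw [hrot hS i j, hrot hT k l]
  rfl

variable [DecidableEq ι]

theorem cube_one : cube (1 : Matrix ι ι ℝ) = 1 := by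
  simp only [cube, Matrix.one_kronecker_one]

variable (ι) in
/-- The cyclic permutation of the three indices, as a matrix. -/
def rotation : Matrix (ι × ι × ι) (ι × ι × ι) ℝ :=
  .of fun I J => if (I.2.1, I.2.2, I.1) = J then 1 else 0

variable (ι) in
/-- The transposition of the last two of three indices, as a matrix. -/
def transposition : Matrix (ι × ι × ι) (ι × ι × ι) ℝ :=
  .of fun I J => if (I.1, I.2.2, I.2.1) = J then 1 else 0

variable [Fintype ι]

variable (ι) in
/-- The sum of the three cyclic permutations of three indices, as a matrix. -/
def cyclicSum : Matrix (ι × ι × ι) (ι × ι × ι) ℝ := 1 + rotation ι + rotation ι * rotation ι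

variable (ι) in
/-- The signed sum of the six permutations of three indices, as a matrix. -/
def antisymmetrizer : Matrix (ι × ι × ι) (ι × ι × ι) ℝ := cyclicSum ι * (1 - transposition ι)

variable {n : Type*}

@[simp] theorem rotation_mul_apply (X : Matrix (ι × ι × ι) n ℝ) (i j k : ι) (J : n) :
    (rotation ι * X) (i, j, k) J = X (j, k, i) J := by
  simp [rotation, Matrix.mul_apply]

@[simp] theorem mul_rotation_apply (X : Matrix n (ι × ι × ι) ℝ) (I : n) (i j k : ι) :
    (X * rotation ι) I (i, j, k) = X I (k, i, j) := by
  have h : ∀ J : ι × ι × ι, (J.2.1, J.2.2, J.1) = (i, j, k) ↔ J = (k, i, j) := by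
    rintro ⟨a, b, c⟩; simp only [Prod.mk.injEq]; tauto
  simp [rotation, Matrix.mul_apply, h]

@[simp] theorem transposition_mul_apply (X : Matrix (ι × ι × ι) n ℝ) (i j k : ι) (J : n) :
    (transposition ι * X) (i, j, k) J = X (i, k, j) J := by
  simp [transposition, Matrix.mul_apply]

@[simp] theorem mul_transposition_apply (X : Matrix n (ι × ι × ι) ℝ) (I : n) (i j k : ι) :
    (X * transposition ι) I (i, j, k) = X I (i, k, j) := by
  have h : ∀ J : ι × ι × ι, (J.1, J.2.2, J.2.1) = (i, j, k) ↔ J = (i, k, j) := by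
    rintro ⟨a, b, c⟩; simp only [Prod.mk.injEq]; tauto
  simp [transposition, Matrix.mul_apply, h]

theorem cyclicSum_mul_apply (X : Matrix (ι × ι × ι) n ℝ) (i j k : ι) (J : n) :
    (cyclicSum ι * X) (i, j, k) J =
      X (i, j, k) J + X (j, k, i) J + X (k, i, j) J := by
  simp [cyclicSum, Matrix.add_mul, Matrix.mul_assoc]

theorem mul_cyclicSum_apply (X : Matrix n (ι × ι × ι) ℝ) (I : n) (i j k : ι) :
    (X * cyclicSum ι) I (i, j, k) =
      X I (i, j, k) + X I (j, k, i) + X I (k, i, j) := by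
  simp only [cyclicSum, Matrix.mul_add, Matrix.mul_one, ← Matrix.mul_assoc, Matrix.add_apply,
    mul_rotation_apply]
  ring

theorem antisymmetrizer_mul_apply (X : Matrix (ι × ι × ι) n ℝ) (i j k : ι) (J : n) :
    (antisymmetrizer ι * X) (i, j, k) J =
      X (i, j, k) J - X (i, k, j) J + (X (j, k, i) J - X (j, i, k) J)
        + (X (k, i, j) J - X (k, j, i) J) := by
  rw [antisymmetrizer, Matrix.mul_assoc, cyclicSum_mul_apply]
  simp [Matrix.sub_mul]

theorem cyclicSum_commute {X : Matrix (ι × ι × ι) (ι × ι × ι) ℝ}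
    (h : ∀ i j k l m n, X (i, j, k) (l, m, n) = X (j, k, i) (m, n, l)) :
    Commute (cyclicSum ι) X := by
  have hrot : Commute (rotation ι) X := by
    ext ⟨i, j, k⟩ ⟨l, m, n⟩
    rw [rotation_mul_apply, mul_rotation_apply, ← h]
  exact ((Commute.one_left X).add_left hrot).add_left (hrot.mul_left hrot)

theorem antisymmetrizer_commute {X : Matrix (ι × ι × ι) (ι × ι × ι) ℝ}
    (h : ∀ i j k l m n, X (i, j, k) (l, m, n) = X (j, k, i) (m, n, l))
    (h' : ∀ i j k l m n, X (i, j, k) (l, m, n) = X (i, k, j) (l, n, m)) :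
    Commute (antisymmetrizer ι) X := by
  have htrans : Commute (transposition ι) X := by
    ext ⟨i, j, k⟩ ⟨l, m, n⟩
    rw [transposition_mul_apply, mul_transposition_apply, ← h']
  exact (cyclicSum_commute h).mul_left ((Commute.one_left X).sub_left htrans)

theorem cyclicSum_commute_cube (P : Matrix ι ι ℝ) : Commute (cyclicSum ι) (cube P) :=
  cyclicSum_commute fun i j k l m n => by simp only [cube_apply]; ring

theorem antisymmetrizer_commute_cube (P : Matrix ι ι ℝ) : Commute (antisymmetrizer ι) (cube P) :=
  antisymmetrizer_commute (fun i j k l m n => by simp only [cube_apply]; ring)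
    fun i j k l m n => by simp only [cube_apply]; ring

theorem sum_cyclicSum_mul_cyclicSum {T : ι → ι → ι → ι → ℝ} (hT : Alt₄ T) (i j k l : ι) :
    ∑ y, (cyclicSum ι * ((1 : Matrix ι ι ℝ) ⊗ₖ toMat₂ T) * cyclicSum ι : Matrix _ _ ℝ)
      (i, j, y) (k, l, y) = (Fintype.card ι - 4) * T i j k l := by
  have eq_zero₂₄ : ∀ a b c, T a b c b = 0 := fun a b c =>
    self_eq_neg.1 ((hT.alt₃ a).swap₁₃ b c b)
  have eq_zero₁₄ : ∀ a b c, T a b c a = 0 := fun a b c => self_eq_neg.1 (hT.swap₁₄ a b c a)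
  have eq_zero₂₃ : ∀ a b c, T a b b c = 0 := fun a b c => self_eq_neg.1 (hT.swap₂₃ a b b c)
  have eq_zero₁₃ : ∀ a b c, T a b a c = 0 := fun a b c =>
    self_eq_neg.1 ((hT.alt₃' c).swap₁₃ a b a)
  simp only [mul_cyclicSum_apply, cyclicSum_mul_apply, Matrix.kronecker_apply, toMat₂_apply,
    Matrix.one_apply, Finset.sum_add_distrib, ite_mul, one_mul, zero_mul, Finset.sum_ite_eq,
    Finset.sum_ite_eq', Finset.mem_univ, if_true, eq_zero₂₄, eq_zero₁₄, eq_zero₂₃, eq_zero₁₃,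
    Finset.sum_const_zero, Finset.sum_const, Finset.card_univ, nsmul_eq_mul, ite_self]
  linear_combination 2 * hT.swap₁₂ j i k l + 2 * hT.swap₃₄ i j l k

theorem sum_antisymmetrizer (i j k l : ι) : ∑ y, antisymmetrizer ι (i, j, y) (k, l, y) =
    (Fintype.card ι - 2) * ((1 : Matrix ι ι ℝ) i k * (1 : Matrix ι ι ℝ) j l -
      (1 : Matrix ι ι ℝ) i l * (1 : Matrix ι ι ℝ) j k) := by
  have h : ∀ y, antisymmetrizer ι (i, j, y) (k, l, y) = _ := fun y => by
    rw [← Matrix.mul_one (antisymmetrizer ι), antisymmetrizer_mul_apply, ← cube_one]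
  simp only [h, cube_apply, Matrix.one_apply, Finset.sum_add_distrib, Finset.sum_sub_distrib,
    mul_ite, mul_one, mul_zero, Finset.sum_ite_eq, Finset.mem_univ, if_true]
  split_ifs <;> simp only [Finset.sum_const, Finset.card_univ, nsmul_eq_mul] <;> grind

end Arrays

/-! ### The model form in an adapted frame -/

section Model

local notation "δ" => (1 : Matrix (Fin 8) (Fin 8) ℝ)

/-- The components of the model form, the Cayley form of `ℝ⁸`. -/
def cayley (i j k l : Fin 8) : ℝ := cross 0 i j k l

/-- The components of the `m`-th basis element of `Λ⁴₇`. -/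
def lambda (m : Fin 7) (i j k l : Fin 8) : ℝ := cross m.succ i j k l

theorem Alt₄.intCast {ι : Type*} {T : ι → ι → ι → ι → ℤ} (h : Alt₄ T) :
    Alt₄ fun i j k l => (T i j k l : ℝ) where
  swap₁₂ i j k l := by rw [h.swap₁₂, Int.cast_neg]
  swap₂₃ i j k l := by rw [h.swap₂₃, Int.cast_neg]
  swap₃₄ i j k l := by rw [h.swap₃₄, Int.cast_neg]

theorem alt₄_cayley : Alt₄ cayley := (alt₄_cross 0).intCast

theorem alt₄_lambda (m : Fin 7) : Alt₄ (lambda m) := (alt₄_cross m.succ).intCast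

theorem sum_cayley_mul (i j k l m n : Fin 8) : ∑ x, cayley x i j k * cayley x l m n =
    (δ i l * (δ j m * δ k n - δ j n * δ k m)
      - (δ i l * cayley j k m n + δ i m * cayley j k n l + δ i n * cayley j k l m))
    + (δ j l * (δ k m * δ i n - δ k n * δ i m)
      - (δ j l * cayley k i m n + δ j m * cayley k i n l + δ j n * cayley k i l m))
    + (δ k l * (δ i m * δ j n - δ i n * δ j m)
      - (δ k l * cayley i j m n + δ k m * cayley i j n l + δ k n * cayley i j l m)) := by
  have alt₃_left : ∀ T : Fin 8 → ℝ, Alt₃ fun i j k => ∑ x, cayley x i j k * T x := fun T =>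
    ⟨fun i j k => by simp only [alt₄_cayley.swap₂₃ _ i j k, neg_mul, Finset.sum_neg_distrib],
      fun i j k => by simp only [alt₄_cayley.swap₃₄ _ i j k, neg_mul, Finset.sum_neg_distrib]⟩
  refine (alt₃_left fun x => cayley x l m n).ext_of_lt
    (alt₃_cyclic (K := fun i j k => δ i l * (δ j m * δ k n - δ j n * δ k m) -
      (δ i l * cayley j k m n + δ i m * cayley j k n l + δ i n * cayley j k l m))
      fun i j k => ?_) (fun i j k hij hjk => ?_) i j k
  · linear_combination -δ i l * alt₄_cayley.swap₁₂ j k m n - δ i m * alt₄_cayley.swap₁₂ j k n l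
      - δ i n * alt₄_cayley.swap₁₂ j k l m
  have alt₃_right : Alt₃ fun l m n => (∑ x, cayley x i j k * cayley x l m n) := by
    simpa only [mul_comm] using alt₃_left fun x => cayley x i j k
  refine (alt₃_right.ext_of_lt (alt₃_cyclic (K := fun l m n =>
    δ i l * (δ j m * δ k n - δ j n * δ k m) - (δ i l * cayley j k m n +
      δ j l * cayley k i m n + δ k l * cayley i j m n)) fun l m n => ?_)
    (fun l m n hlm hmn => ?_) l m n).trans (by ring)
  · linear_combination -δ i l * alt₄_cayley.swap₃₄ j k m n - δ j l * alt₄_cayley.swap₃₄ k i m n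
      - δ k l * alt₄_cayley.swap₃₄ i j m n
  · have h := congrArg (Int.cast : ℤ → ℝ) (sum_cross_mul_of_lt i j k hij hjk l m n hlm hmn)
    push_cast at h
    simp only [cayley, h, Matrix.one_apply, ite_mul, one_mul, zero_mul]
    have hdet : (if i = l ∧ j = m ∧ k = n then (1 : ℝ) else 0) =
      (if i = l then (if j = m then if k = n then 1 else 0 else 0) -
          if j = n then if k = m then 1 else 0 else 0 else 0) +
        (if i = m then (if j = n then if k = l then 1 else 0 else 0) -
          if j = l then if k = n then 1 else 0 else 0 else 0) +
        (if i = n then (if j = l then if k = m then 1 else 0 else 0) -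
          if j = m then if k = l then 1 else 0 else 0 else 0) := by
      grind
    rw [hdet]; ring

theorem transpose_mul_toMat_cayley : (toMat cayley)ᵀ * toMat cayley =
    antisymmetrizer (Fin 8) - cyclicSum (Fin 8) * (δ ⊗ₖ toMat₂ cayley) * cyclicSum (Fin 8) := by
  ext ⟨i, j, k⟩ ⟨l, m, n⟩
  rw [Matrix.sub_apply, ← Matrix.mul_one (antisymmetrizer (Fin 8)), antisymmetrizer_mul_apply,
    mul_cyclicSum_apply, ← cube_one]
  simp only [cyclicSum_mul_apply, Matrix.kronecker_apply, toMat₂_apply, cube_apply]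
  rw [Matrix.mul_apply]
  refine (sum_cayley_mul i j k l m n).trans ?_
  ring

theorem sum_sum_cayley_mul (i j k l : Fin 8) : ∑ x, ∑ y, cayley i j x y * cayley k l x y =
    6 * (δ i k * δ j l - δ i l * δ j k) - 4 * cayley i j k l := by
  simp only [sum_mul_eq_sum_gram alt₄_cayley alt₄_cayley, transpose_mul_toMat_cayley,
    Matrix.sub_apply, Finset.sum_sub_distrib, sum_antisymmetrizer,
    sum_cyclicSum_mul_cyclicSum alt₄_cayley, Fintype.card_fin]
  norm_num

theorem toMat_cayley_mul_transpose : toMat cayley * (toMat cayley)ᵀ = (42 : ℝ) • δ := by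
  ext i k
  have eq_zero₂₄ : ∀ a b c, cayley a b c b = 0 := fun a b c =>
    self_eq_neg.1 ((alt₄_cayley.alt₃ a).swap₁₃ b c b)
  have h : ∑ j, ∑ x, ∑ y, cayley i j x y * cayley k j x y = 42 * δ i k := by
    simp only [sum_sum_cayley_mul, eq_zero₂₄, Finset.sum_sub_distrib, ← Finset.mul_sum,
      Matrix.one_apply, if_true, mul_one, ite_mul, one_mul, zero_mul, Finset.sum_ite_eq,
      Finset.mem_univ, Finset.sum_const, Finset.card_univ, Fintype.card_fin, nsmul_eq_mul, mul_zero]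
    split_ifs <;> norm_num
  simpa [Matrix.mul_apply, Fintype.sum_prod_type] using h

section Lambda

/-- The seven anticommuting complex structures on `ℝ⁸` given by `clifford`. -/
def cliffordMat (m : Fin 7) : Matrix (Fin 8) (Fin 8) ℝ := .of fun i j => (clifford m i j : ℝ)

theorem cliffordMat_transpose (m : Fin 7) : (cliffordMat m)ᵀ = -cliffordMat m := by
  ext i j
  simp [cliffordMat, clifford_swap m j i]

theorem cliffordMat_anticomm (m n : Fin 7) : cliffordMat m * cliffordMat n +
    cliffordMat n * cliffordMat m = (-2 * (1 : Matrix (Fin 7) (Fin 7) ℝ) m n) • δ := by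
  ext i j
  have h := congrArg (Int.cast : ℤ → ℝ) (clifford_anticomm m n i j)
  push_cast [Finset.sum_add_distrib] at h
  simp only [Matrix.add_apply, Matrix.mul_apply, cliffordMat, Matrix.of_apply, h]
  rcases eq_or_ne m n with rfl | hmn <;> rcases eq_or_ne i j with rfl | hij <;> simp [*]

theorem trace_cliffordMat_mul (m n : Fin 7) :
    (cliffordMat m * cliffordMat n).trace = -8 * (1 : Matrix (Fin 7) (Fin 7) ℝ) m n := by
  have h := congrArg Matrix.trace (cliffordMat_anticomm m n)
  rw [Matrix.trace_add, Matrix.trace_mul_comm (cliffordMat n), Matrix.trace_smul, Matrix.trace_one,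
    Fintype.card_fin] at h
  simp only [smul_eq_mul, Nat.cast_ofNat] at h
  linarith

theorem sum_cliffordMat_mul (m n : Fin 7) : ∑ k, ∑ l, cliffordMat m k l * cliffordMat n k l =
    8 * (1 : Matrix (Fin 7) (Fin 7) ℝ) m n := by
  have h := trace_cliffordMat_mul m n
  rw [← neg_neg (cliffordMat n), ← cliffordMat_transpose, Matrix.mul_neg, Matrix.trace_neg] at h
  simp only [Matrix.trace, Matrix.diag_apply, Matrix.mul_apply, Matrix.transpose_apply] at h
  linarith

variable {ι : Type*} [DecidableEq ι]

/-- The matrix whose `i`-th row is the 3-form `e_i ∧ W`, for a 2-form `W`. -/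
def wedgeMat (W : Matrix ι ι ℝ) : Matrix ι (ι × ι × ι) ℝ :=
  .of fun i J => (1 : Matrix ι ι ℝ) i J.1 * W J.2.1 J.2.2 +
    (1 : Matrix ι ι ℝ) i J.2.1 * W J.2.2 J.1 + (1 : Matrix ι ι ℝ) i J.2.2 * W J.1 J.2.1

theorem alt₃_wedgeMat {W : Matrix ι ι ℝ} (h : Wᵀ = -W) (i : ι) :
    Alt₃ fun j k l => wedgeMat W i (j, k, l) :=
  alt₃_cyclic (K := fun j k l => (1 : Matrix ι ι ℝ) i j * W k l) fun j k l => by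
    have hkl : W k l = -W l k := congrFun (congrFun h l) k
    rw [hkl, mul_neg]

theorem sum_wedgeMat_mul [Fintype ι] (W : Matrix ι ι ℝ) {T : ι → ι → ι → ℝ} (hT : Alt₃ T) (i : ι) :
    ∑ J, wedgeMat W i J * T J.1 J.2.1 J.2.2 = 3 * ∑ k, ∑ l, W k l * T i k l := by
  have h : ∑ k, ∑ l, W k l * T k l i = ∑ k, ∑ l, W k l * T i k l :=
    Finset.sum_congr rfl fun k _ => Finset.sum_congr rfl fun l _ => by rw [hT.rotate i]
  have h' : ∑ l, ∑ k, W k l * T l i k = ∑ k, ∑ l, W k l * T i k l := by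
    rw [Finset.sum_comm]
    exact Finset.sum_congr rfl fun k _ => Finset.sum_congr rfl fun l _ => by rw [hT.rotate l]
  simp only [wedgeMat, Matrix.of_apply, Fintype.sum_prod_type, add_mul, Finset.sum_add_distrib,
    Matrix.one_apply, ite_mul, one_mul, zero_mul, Finset.sum_ite_irrel, Finset.sum_const_zero,
    Finset.sum_ite_eq, Finset.mem_univ, if_true]
  linear_combination h + h'

theorem toMat_lambda (m : Fin 7) :
    toMat (lambda m) = wedgeMat (cliffordMat m) - cliffordMat m * toMat cayley := by
  ext i ⟨j, k, l⟩
  have alt₃_right : Alt₃ fun j k l => (wedgeMat (cliffordMat m) - cliffordMat m * toMat cayley)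
      i (j, k, l) := by
    have h := alt₃_wedgeMat (cliffordMat_transpose m) i
    constructor <;> intro j k l <;> simp only [Matrix.sub_apply, Matrix.mul_apply, toMat_apply]
    · rw [h.swap₁₂]
      simp only [alt₄_cayley.swap₂₃ _ j, mul_neg, Finset.sum_neg_distrib]
      ring
    · rw [h.swap₂₃]
      simp only [alt₄_cayley.swap₃₄ _ j k, mul_neg, Finset.sum_neg_distrib]
      ring
  refine ((alt₄_lambda m).alt₃ i).ext_of_lt alt₃_right (fun j k l hjk hkl => ?_) j k l
  have h := congrArg (Int.cast : ℤ → ℝ) (cross_succ_of_lt j k hjk l hkl m i)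
  push_cast at h
  simpa [wedgeMat, Matrix.one_apply, Matrix.mul_apply, cliffordMat, lambda, cayley] using h

theorem wedgeMat_mul_cayley (m : Fin 7) :
    wedgeMat (cliffordMat m) * (toMat cayley)ᵀ = (18 : ℝ) • cliffordMat m := by
  ext i a
  have h : ∑ k, ∑ l, cliffordMat m k l * cayley a i k l = -6 * cliffordMat m a i := by
    have h := congrArg (Int.cast : ℤ → ℝ) (sum_clifford_eigen m a i)
    push_cast at h
    exact h
  have hswap : cliffordMat m a i = -cliffordMat m i a :=
    congrFun (congrFun (cliffordMat_transpose m) i) a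
  rw [Matrix.mul_apply]
  refine (sum_wedgeMat_mul _ (alt₄_cayley.alt₃ a) i).trans ?_
  rw [Matrix.smul_apply, smul_eq_mul]
  linear_combination 3 * h - 18 * hswap

theorem wedgeMat_mul_wedgeMat (m n : Fin 7) :
    wedgeMat (cliffordMat m) * (wedgeMat (cliffordMat n))ᵀ =
      (24 * (1 : Matrix (Fin 7) (Fin 7) ℝ) m n) • δ
        + (6 : ℝ) • (cliffordMat n * cliffordMat m) := by
  ext i a
  have hskew : ∀ m i j, cliffordMat m i j = -cliffordMat m j i := fun m i j =>
    congrFun (congrFun (cliffordMat_transpose m) j) i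
  have h : ∑ k, ∑ l, cliffordMat m k l * (δ a k * cliffordMat n l i) =
      (cliffordMat n * cliffordMat m) i a := by
    simp only [Matrix.mul_apply, Matrix.one_apply, ite_mul, mul_ite, one_mul, zero_mul, mul_zero,
      Finset.sum_ite_irrel, Finset.sum_const_zero, Finset.sum_ite_eq, Finset.mem_univ, if_true]
    exact Finset.sum_congr rfl fun l _ => by rw [hskew m a l, hskew n l i]; ring
  have h' : ∑ k, ∑ l, cliffordMat m k l * (δ a l * cliffordMat n i k) =
      (cliffordMat n * cliffordMat m) i a := by
    simp only [Matrix.mul_apply, Matrix.one_apply, ite_mul, mul_ite, one_mul, zero_mul, mul_zero,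
      Finset.sum_ite_eq, Finset.mem_univ, if_true]
    exact Finset.sum_congr rfl fun k _ => mul_comm _ _
  have htrace : ∑ k, ∑ l, cliffordMat m k l * (δ a i * cliffordMat n k l) =
      8 * (1 : Matrix (Fin 7) (Fin 7) ℝ) m n * δ a i := by
    rw [← sum_cliffordMat_mul]
    simp only [Finset.sum_mul]
    exact Finset.sum_congr rfl fun k _ => Finset.sum_congr rfl fun l _ => by ring
  rw [Matrix.mul_apply]
  refine (sum_wedgeMat_mul _ (alt₃_wedgeMat (cliffordMat_transpose n) a) i).trans ?_
  have hsymm : δ a i = δ i a := by simp only [Matrix.one_apply, eq_comm]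
  simp only [wedgeMat, Matrix.of_apply, mul_add, Finset.sum_add_distrib, h, h', htrace,
    Matrix.add_apply, Matrix.smul_apply, smul_eq_mul]
  linear_combination 24 * (1 : Matrix (Fin 7) (Fin 7) ℝ) m n * hsymm

theorem lambda_mul_cayley (m : Fin 7) :
    toMat (lambda m) * (toMat cayley)ᵀ = (-24 : ℝ) • cliffordMat m := by
  rw [toMat_lambda, Matrix.sub_mul, wedgeMat_mul_cayley, Matrix.mul_assoc,
    toMat_cayley_mul_transpose, Matrix.mul_smul, Matrix.mul_one]
  module

theorem lambda_mul_lambda (m n : Fin 7) :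
    toMat (lambda m) * (toMat (lambda n))ᵀ =
      (36 * (1 : Matrix (Fin 7) (Fin 7) ℝ) m n) • δ
        + (12 : ℝ) • (cliffordMat n * cliffordMat m) := by
  have hcayley : toMat cayley * (wedgeMat (cliffordMat n))ᵀ =
      (-18 : ℝ) • cliffordMat n := by
    have h := congrArg Matrix.transpose (wedgeMat_mul_cayley n)
    rw [Matrix.transpose_mul, Matrix.transpose_transpose, Matrix.transpose_smul,
      cliffordMat_transpose] at h
    rw [h]
    module
  have hanti := eq_sub_of_add_eq (cliffordMat_anticomm m n)
  calc toMat (lambda m) * (toMat (lambda n))ᵀ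
      = wedgeMat (cliffordMat m) * (wedgeMat (cliffordMat n))ᵀ
        + wedgeMat (cliffordMat m) * (toMat cayley)ᵀ * cliffordMat n
        - cliffordMat m * (toMat cayley * (wedgeMat (cliffordMat n))ᵀ)
        - cliffordMat m * (toMat cayley * (toMat cayley)ᵀ) * cliffordMat n := by
        simp only [toMat_lambda, Matrix.transpose_sub, Matrix.transpose_mul,
          cliffordMat_transpose, Matrix.sub_mul, Matrix.mul_sub, Matrix.mul_neg, Matrix.mul_assoc]
        abel
    _ = _ := by
        rw [wedgeMat_mul_wedgeMat, wedgeMat_mul_cayley, hcayley, toMat_cayley_mul_transpose]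
        simp only [Matrix.mul_smul, Matrix.smul_mul, Matrix.mul_one, hanti]
        module

end Lambda

theorem sum_mul_lambda_of_lt {β : Matrix (Fin 8) (Fin 8) ℝ} (hβ : ∀ a b, β a b = -β b a)
    {i j k l : Fin 8} (hij : i < j) (hjk : j < k) (hkl : k < l) :
    ∑ m, (∑ a, ∑ b, β a b * cliffordMat m a b) * lambda m i j k l =
      -2 * (∑ s, β i s * cayley s j k l - ∑ s, β j s * cayley s i k l
        + ∑ s, β k s * cayley s i j l - ∑ s, β l s * cayley s i j k) := by
  have hsum : ∑ m, (∑ a, ∑ b, β a b * cliffordMat m a b) * lambda m i j k l =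
      ∑ a, ∑ b, β a b * ∑ m, cliffordMat m a b * lambda m i j k l := by
    simp only [Finset.mul_sum, Finset.sum_mul]
    rw [Finset.sum_comm]
    refine Finset.sum_congr rfl fun a _ => ?_
    rw [Finset.sum_comm]
    exact Finset.sum_congr rfl fun b _ => Finset.sum_congr rfl fun m _ => mul_assoc _ _ _
  have hcross : ∀ a b, ∑ m, cliffordMat m a b * lambda m i j k l =
      (if b = i then cayley a j k l else 0) + (if b = j then cayley i a k l else 0)
      + (if b = k then cayley i j a l else 0) + (if b = l then cayley i j k a else 0)
      - (if a = i then cayley b j k l else 0) - (if a = j then cayley i b k l else 0)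
      - (if a = k then cayley i j b l else 0) - (if a = l then cayley i j k b else 0) :=
    fun a b => by
      have h := congrArg (Int.cast : ℤ → ℝ) (sum_clifford_mul_cross i j hij k hjk l hkl a b)
      push_cast at h
      exact h
  have hj : ∀ s, cayley i s k l = -cayley s i k l := fun s => alt₄_cayley.swap₁₂ i s k l
  have hk : ∀ s, cayley i j s l = cayley s i j l := fun s =>
    ((alt₄_cayley.alt₃' l).rotate s i j).symm
  have hl : ∀ s, cayley i j k s = -cayley s i j k := fun s => by
    rw [alt₄_cayley.swap₁₂ s, (alt₄_cayley.alt₃ i).rotate s, neg_neg]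
  rw [hsum]
  simp only [hcross, hj, hk, hl, mul_add, mul_sub, mul_ite, mul_zero, mul_neg,
    Finset.sum_add_distrib, Finset.sum_sub_distrib, Finset.sum_neg_distrib, Finset.sum_ite_eq',
    Finset.sum_ite_irrel, Finset.sum_const_zero, Finset.mem_univ, if_true, hβ _ i, hβ _ j, hβ _ k,
    hβ _ l, neg_mul]
  ring

/-- A 4-form which satisfies the linearisation at the model form of the quadratic identity
`transpose_mul_toMat_cayley`, as do the components of `∇Φ` in an adapted frame. -/
structure IsFirstVariation (D : Fin 8 → Fin 8 → Fin 8 → Fin 8 → ℝ) : Prop where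
  alt₄ : Alt₄ D
  gram : (toMat D)ᵀ * toMat cayley + (toMat cayley)ᵀ * toMat D =
    -(cyclicSum (Fin 8) * (δ ⊗ₖ toMat₂ D) * cyclicSum (Fin 8))

theorem toMat_cayley_mul_cyclicSum :
    toMat cayley * cyclicSum (Fin 8) = (3 : ℝ) • toMat cayley := by
  ext i ⟨j, k, l⟩
  simp only [mul_cyclicSum_apply, toMat_apply, Matrix.smul_apply, smul_eq_mul,
    ← (alt₄_cayley.alt₃ i).rotate]
  rw [← (alt₄_cayley.alt₃ i).rotate, ← (alt₄_cayley.alt₃ i).rotate]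
  ring

namespace IsFirstVariation

variable {D : Fin 8 → Fin 8 → Fin 8 → Fin 8 → ℝ}

theorem sum_sum_mul_cayley_add (h : IsFirstVariation D) (i j k l : Fin 8) :
    ∑ x, ∑ y, D i j x y * cayley k l x y + ∑ x, ∑ y, D k l x y * cayley i j x y =
      -4 * D i j k l := by
  have hgram := fun y => congrFun₂ h.gram (i, j, y) (k, l, y)
  simp only [mul_comm (D k l _ _), sum_mul_eq_sum_gram h.alt₄ alt₄_cayley,
    sum_mul_eq_sum_gram alt₄_cayley h.alt₄, ← Finset.sum_add_distrib, ← Matrix.add_apply, hgram,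
    Matrix.neg_apply, Finset.sum_neg_distrib, sum_cyclicSum_mul_cyclicSum h.alt₄, Fintype.card_fin]
  norm_num

theorem mul_cayley_skew (h : IsFirstVariation D) :
    toMat cayley * (toMat D)ᵀ = -(toMat D * (toMat cayley)ᵀ) := by
  ext i k
  have eq_zero₂₄ : ∀ j, D i j k j = 0 := fun j => self_eq_neg.1 ((h.alt₄.alt₃ i).swap₁₃ j k j)
  have hsum : ∑ j, (∑ x, ∑ y, D i j x y * cayley k j x y + ∑ x, ∑ y, D k j x y * cayley i j x y) =
      0 := by
    simp only [h.sum_sum_mul_cayley_add, eq_zero₂₄, mul_zero, Finset.sum_const_zero]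
  rw [Finset.sum_add_distrib] at hsum
  simp only [Matrix.mul_apply, Matrix.transpose_apply, Matrix.neg_apply, toMat_apply,
    Fintype.sum_prod_type, mul_comm (cayley _ _ _ _)]
  linarith

theorem mul_cayley_mul_cayley (h : IsFirstVariation D) (d i j k : Fin 8) :
    42 * D d i j k - ∑ s, (toMat D * (toMat cayley)ᵀ) d s * cayley s i j k =
      -3 * (∑ x, ∑ y, D j k x y * cayley d i x y + ∑ x, ∑ y, D k i x y * cayley d j x y
        + ∑ x, ∑ y, D i j x y * cayley d k x y) := by
  have hmul : (42 : ℝ) • toMat D - toMat D * (toMat cayley)ᵀ * toMat cayley =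
      (-3 : ℝ) • (toMat cayley * (δ ⊗ₖ toMat₂ D) * cyclicSum (Fin 8)) := by
    have hgram := congrArg (toMat cayley * ·) h.gram
    simp only [Matrix.mul_add, Matrix.mul_neg, ← Matrix.mul_assoc, toMat_cayley_mul_cyclicSum,
      h.mul_cayley_skew, toMat_cayley_mul_transpose, Matrix.neg_mul, Matrix.smul_mul,
      Matrix.one_mul] at hgram
    rw [neg_smul, ← hgram]
    abel
  have hentry : ∀ i j k, (toMat cayley * (δ ⊗ₖ toMat₂ D)) d (i, j, k) =
      ∑ x, ∑ y, D j k x y * cayley d i x y := fun i j k => by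
    simp only [Matrix.mul_apply, Fintype.sum_prod_type, toMat_apply, Matrix.kronecker_apply,
      toMat₂_apply, Matrix.one_apply, ite_mul, mul_ite, mul_one, zero_mul, mul_zero,
      Finset.sum_ite_irrel, Finset.sum_const_zero, Finset.sum_ite_eq', Finset.mem_univ, if_true,
      h.alt₄.swap_pairs j k, mul_comm]
  have h := congrFun (congrFun hmul d) (i, j, k)
  rw [Matrix.smul_apply, mul_cyclicSum_apply, hentry, hentry, hentry] at h
  exact h

theorem mul_eq_sum_mul_cayley (h : IsFirstVariation D) (i j k l : Fin 8) :
    96 * D i j k l =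
      ∑ s, (toMat D * (toMat cayley)ᵀ) i s * cayley s j k l
        - ∑ s, (toMat D * (toMat cayley)ᵀ) j s * cayley s i k l
        + ∑ s, (toMat D * (toMat cayley)ᵀ) k s * cayley s i j l
        - ∑ s, (toMat D * (toMat cayley)ᵀ) l s * cayley s i j k := by
  have hi := h.mul_cayley_mul_cayley i j k l
  have hj := h.mul_cayley_mul_cayley j i k l
  have hk := h.mul_cayley_mul_cayley k i j l
  have hl := h.mul_cayley_mul_cayley l i j k
  have hadd := h.sum_sum_mul_cayley_add
  obtain ⟨E, hE⟩ : ∃ E : Fin 8 → Fin 8 → Fin 8 → Fin 8 → ℝ,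
    ∀ a b c d, ∑ x, ∑ y, D a b x y * cayley c d x y = E a b c d := ⟨_, fun _ _ _ _ => rfl⟩
  have hE₁₂ : ∀ a b c d, E a b c d = -E b a c d := fun a b c d => by
    simp only [← hE, h.alt₄.swap₁₂ a b, neg_mul, Finset.sum_neg_distrib]
  have hE₃₄ : ∀ a b c d, E a b c d = -E a b d c := fun a b c d => by
    simp only [← hE, alt₄_cayley.swap₁₂ c d, mul_neg, Finset.sum_neg_distrib]
  simp only [hE] at hi hj hk hl hadd
  have hDj := h.alt₄.swap₁₂ j i k l
  have hDk := (h.alt₄.alt₃' l).rotate k i j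
  have hDl := (h.alt₄.alt₃ i).rotate l j k
  have hDl' := h.alt₄.swap₁₂ l i j k
  have hDikjl := h.alt₄.swap₂₃ i k j l
  linarith [hadd i j k l, hadd i k j l, hadd i l j k, hE₃₄ k l j i, hE₁₂ l j i k, hE₃₄ j l i k,
    hE₁₂ k i l j, hE₃₄ i k l j, hE₃₄ j k l i, hE₁₂ l i j k, hE₃₄ l i k j, hE₃₄ i j l k]

theorem exists_eq_sum_lambda (h : IsFirstVariation D) :
    ∃ c : Fin 7 → ℝ, toMat D = ∑ m, c m • toMat (lambda m) := by
  set β := toMat D * (toMat cayley)ᵀ with hβ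
  have hskew : ∀ a b, β a b = -β b a := fun a b => by
    have hab := congrFun (congrFun h.mul_cayley_skew b) a
    rw [← Matrix.transpose_transpose (toMat cayley), ← Matrix.transpose_mul, ← hβ] at hab
    exact hab
  let c : Fin 7 → ℝ := fun m => ∑ a, ∑ b, β a b * cliffordMat m a b
  have halt : Alt₄ fun i j k l => -(1 / 192) * ∑ m, c m * lambda m i j k l := by
    constructor <;> intro i j k l <;> simp only [← mul_neg, ← Finset.sum_neg_distrib]
    · simp only [← (alt₄_lambda _).swap₁₂]
    · simp only [← (alt₄_lambda _).swap₂₃]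
    · simp only [← (alt₄_lambda _).swap₃₄]
  refine ⟨fun m => -(1 / 192) * c m, ?_⟩
  ext i ⟨j, k, l⟩
  have hlt : D i j k l = -(1 / 192) * ∑ m, c m * lambda m i j k l :=
    h.alt₄.ext_of_lt halt (fun i j k l hij hjk hkl => by
      linear_combination (1 / 96) * h.mul_eq_sum_mul_cayley i j k l +
        (1 / 192) * sum_mul_lambda_of_lt hskew hij hjk hkl) i j k l
  simpa [Matrix.sum_apply, Finset.mul_sum, mul_assoc] using hlt

end IsFirstVariation

section Balanced

open Matrix

variable {D : Fin 8 → Fin 8 → Fin 8 → Fin 8 → Fin 8 → ℝ} {v : Fin 7 → Fin 8 → ℝ}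

theorem sum_dotProduct_cliffordMat (hv : ∑ m, cliffordMat m *ᵥ v m = 0) :
    ∑ m, ∑ n, v m ⬝ᵥ (cliffordMat m * cliffordMat n) *ᵥ v n = 0 := by
  have h : ∀ m n, v m ⬝ᵥ (cliffordMat m * cliffordMat n) *ᵥ v n =
      -(cliffordMat m *ᵥ v m) ⬝ᵥ (cliffordMat n *ᵥ v n) := fun m n => by
    rw [← mulVec_mulVec, dotProduct_mulVec, ← mulVec_transpose, cliffordMat_transpose, neg_mulVec]
  simp only [h, ← dotProduct_sum, hv, dotProduct_zero, Finset.sum_const_zero]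

theorem sum_cliffordMat_mulVec_eq_zero (hD : ∀ p, toMat (D p) = ∑ m, v m p • toMat (lambda m))
    (hbal : ∀ a, ∑ p, (toMat (D p) * (toMat cayley)ᵀ) p a = 0) :
    ∑ m, cliffordMat m *ᵥ v m = 0 := by
  ext a
  have h := hbal a
  simp only [hD, Matrix.sum_mul, Matrix.smul_mul, lambda_mul_cayley, Matrix.sum_apply,
    Matrix.smul_apply, smul_eq_mul] at h
  rw [Finset.sum_comm] at h
  have hskew : ∀ m p, cliffordMat m p a = -cliffordMat m a p := fun m p =>
    congrFun (congrFun (cliffordMat_transpose m) a) p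
  simp only [hskew, mul_left_comm _ (-24 : ℝ), ← Finset.mul_sum] at h
  simpa [mulVec, dotProduct, mul_comm] using h

theorem sum_smul_mul_transpose_apply {ι n : Type*} [Fintype ι] [Fintype n]
    (A : ι → Matrix (Fin 8) n ℝ) (x y : ι → ℝ) (p a : Fin 8) :
    ((∑ m, x m • A m) * (∑ m, y m • A m)ᵀ) p a =
      ∑ m, ∑ n, x m * y n * (A m * (A n)ᵀ) p a := by
  simp only [transpose_sum, transpose_smul, Matrix.sum_mul, Matrix.mul_sum, Matrix.smul_mul,
    Matrix.mul_smul, Matrix.sum_apply, Matrix.smul_apply, smul_eq_mul, Finset.mul_sum]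
  rw [Finset.sum_comm]
  exact Finset.sum_congr rfl fun m _ => Finset.sum_congr rfl fun n _ => by ring

theorem sum_sum_mul_mul_apply (B : Fin 7 → Fin 7 → Matrix (Fin 8) (Fin 8) ℝ) :
    ∑ p, ∑ a, ∑ m, ∑ n, v m p * v n a * B m n p a = ∑ m, ∑ n, v m ⬝ᵥ B m n *ᵥ v n := by
  simp only [dotProduct, mulVec, Finset.mul_sum]
  rw [Finset.sum_comm_cycle]
  refine Finset.sum_congr rfl fun m _ => ?_
  rw [Finset.sum_comm_cycle]
  exact Finset.sum_congr rfl fun n _ => Finset.sum_congr rfl fun p _ =>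
    Finset.sum_congr rfl fun a _ => by ring

theorem sum_mul_transpose (hD : ∀ p, toMat (D p) = ∑ m, v m p • toMat (lambda m))
    (hv : ∑ m, cliffordMat m *ᵥ v m = 0) :
    ∑ p, ∑ a, (toMat (D p) * (toMat (D a))ᵀ) p a = 12 * ∑ m, v m ⬝ᵥ v m := by
  have h : ∑ p, ∑ a, (toMat (D p) * (toMat (D a))ᵀ) p a =
      ∑ m, ∑ n, v m ⬝ᵥ (toMat (lambda m) * (toMat (lambda n))ᵀ) *ᵥ v n := by
    simp only [hD, sum_smul_mul_transpose_apply, sum_sum_mul_mul_apply]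
  have hanti : ∀ m n, toMat (lambda m) * (toMat (lambda n))ᵀ =
      (12 * (1 : Matrix (Fin 7) (Fin 7) ℝ) m n) • δ
        - (12 : ℝ) • (cliffordMat m * cliffordMat n) := fun m n => by
    rw [lambda_mul_lambda, eq_sub_of_add_eq (cliffordMat_anticomm m n)]
    module
  simp only [h, hanti, sub_mulVec, smul_mulVec, dotProduct_sub, dotProduct_smul,
    Finset.sum_sub_distrib, ← Finset.smul_sum, sum_dotProduct_cliffordMat hv]
  simp [Matrix.one_apply, Finset.mul_sum]

theorem sum_mul_transpose_swap (hD : ∀ p, toMat (D p) = ∑ m, v m p • toMat (lambda m))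
    (hv : ∑ m, cliffordMat m *ᵥ v m = 0) :
    ∑ p, ∑ a, (toMat (D a) * (toMat (D p))ᵀ) p a = 36 * ∑ m, v m ⬝ᵥ v m := by
  have h : ∑ p, ∑ a, (toMat (D a) * (toMat (D p))ᵀ) p a =
      ∑ m, ∑ n, v n ⬝ᵥ (toMat (lambda m) * (toMat (lambda n))ᵀ) *ᵥ v m := by
    rw [Finset.sum_comm (f := fun m n => v n ⬝ᵥ _), ← sum_sum_mul_mul_apply]
    simp only [hD, sum_smul_mul_transpose_apply]
    refine Finset.sum_congr rfl fun p _ => Finset.sum_congr rfl fun a _ => ?_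
    rw [Finset.sum_comm]
    simp only [mul_comm (v _ a)]
  simp only [h, lambda_mul_lambda, add_mulVec, smul_mulVec, dotProduct_add, dotProduct_smul,
    Finset.sum_add_distrib, ← Finset.smul_sum]
  rw [Finset.sum_comm (f := fun m n => v n ⬝ᵥ _), sum_dotProduct_cliffordMat hv]
  simp [Matrix.one_apply, Finset.mul_sum]

theorem sum_mul_transpose_swap_eq (hD : ∀ p, IsFirstVariation (D p))
    (hbal : ∀ a, ∑ p, (toMat (D p) * (toMat cayley)ᵀ) p a = 0) :
    ∑ p, ∑ a, (toMat (D a) * (toMat (D p))ᵀ) p a =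
      3 * ∑ p, ∑ a, (toMat (D p) * (toMat (D a))ᵀ) p a := by
  choose c hc using fun p => (hD p).exists_eq_sum_lambda
  have hv := sum_cliffordMat_mulVec_eq_zero (v := fun m p => c p m) hc hbal
  rw [sum_mul_transpose hc hv, sum_mul_transpose_swap hc hv]
  ring

theorem eq_zero_of_sum_mul_transpose (hD : ∀ p, IsFirstVariation (D p))
    (hbal : ∀ a, ∑ p, (toMat (D p) * (toMat cayley)ᵀ) p a = 0)
    (hzero : ∑ p, ∑ a, (toMat (D p) * (toMat (D a))ᵀ) p a = 0) (p : Fin 8) :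
    toMat (D p) = 0 := by
  choose c hc using fun p => (hD p).exists_eq_sum_lambda
  let v : Fin 7 → Fin 8 → ℝ := fun m p => c p m
  have hv := sum_cliffordMat_mulVec_eq_zero (v := v) hc hbal
  have hsum : ∑ m, v m ⬝ᵥ v m = 0 := by
    rw [sum_mul_transpose (v := v) hc hv] at hzero
    linarith
  have hv_zero : ∀ m, v m = 0 := fun m => dotProduct_self_eq_zero.1 <|
    (Finset.sum_eq_zero_iff_of_nonneg fun m _ =>
      Finset.sum_nonneg fun p _ => mul_self_nonneg (v m p)).1 hsum m
      (Finset.mem_univ m)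
  rw [hc]
  exact Finset.sum_eq_zero fun m _ => by rw [show c p m = 0 from congrFun (hv_zero m) p, zero_smul]

end Balanced

end Model

/-! ### The components of the model form -/

/-- The value of `e_a ∧ e_b` on two basis vectors. -/
def wedgeCoeff₂ (a b i j : Fin 8) : ℤ :=
  (if a = i then 1 else 0) * (if b = j then 1 else 0) -
    (if b = i then 1 else 0) * (if a = j then 1 else 0)

/-- The value of `e_a ∧ e_b ∧ e_c` on three basis vectors. -/
def wedgeCoeff₃ (a b c i j k : Fin 8) : ℤ :=
  (if a = i then 1 else 0) * wedgeCoeff₂ b c j k - (if b = i then 1 else 0) * wedgeCoeff₂ a c j k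
    + (if c = i then 1 else 0) * wedgeCoeff₂ a b j k

/-- The value of `e_a ∧ e_b ∧ e_c ∧ e_d` on four basis vectors. -/
def wedgeCoeff₄ (a b c d i j k l : Fin 8) : ℤ :=
  (if a = i then 1 else 0) * wedgeCoeff₃ b c d j k l
    - (if b = i then 1 else 0) * wedgeCoeff₃ a c d j k l
    + (if c = i then 1 else 0) * wedgeCoeff₃ a b d j k l
    - (if d = i then 1 else 0) * wedgeCoeff₃ a b c j k l

theorem wedge4_single (a b c d i j k l : Fin 8) :
    wedge4 a b c d ![EuclideanSpace.single i 1, EuclideanSpace.single j 1,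
      EuclideanSpace.single k 1, EuclideanSpace.single l 1] = wedgeCoeff₄ a b c d i j k l := by
  have wedge4_apply : ∀ v : Fin 4 → R8,
      wedge4 a b c d v = Matrix.det (.of fun r s => v r (![a, b, c, d] s)) := fun _ => rfl
  rw [wedge4_apply, Matrix.det_succ_row_zero]
  simp only [Fin.sum_univ_succ, Matrix.det_fin_three]
  simp [Fin.succAbove, wedgeCoeff₄, wedgeCoeff₃, wedgeCoeff₂, -mul_ite, -ite_mul]
  ring

theorem cross_zero_of_lt : ∀ i j k l, i < j → j < k → k < l →
    cross 0 i j k l = -wedgeCoeff₄ 0 1 2 7 i j k l + wedgeCoeff₄ 0 2 3 6 i j k l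
      - wedgeCoeff₄ 0 3 4 7 i j k l - wedgeCoeff₄ 0 5 6 7 i j k l + wedgeCoeff₄ 0 1 4 6 i j k l
      + wedgeCoeff₄ 0 2 4 5 i j k l - wedgeCoeff₄ 0 1 3 5 i j k l - wedgeCoeff₄ 3 4 5 6 i j k l
      - wedgeCoeff₄ 1 4 5 7 i j k l - wedgeCoeff₄ 1 2 5 6 i j k l - wedgeCoeff₄ 1 2 3 4 i j k l
      - wedgeCoeff₄ 2 3 5 7 i j k l - wedgeCoeff₄ 1 3 6 7 i j k l
      + wedgeCoeff₄ 2 4 6 7 i j k l := by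
  decide +kernel

theorem modelForm_single (i j k l : Fin 8) :
    modelForm ![EuclideanSpace.single i 1, EuclideanSpace.single j 1,
      EuclideanSpace.single k 1, EuclideanSpace.single l 1] = cayley i j k l := by
  refine (alt₄_alternatingMap modelForm fun i => EuclideanSpace.single i 1).ext_of_lt alt₄_cayley
    (fun i j k l hij hjk hkl => ?_) i j k l
  rw [cayley, cross_zero_of_lt i j k l hij hjk hkl]
  simp only [modelForm, AlternatingMap.add_apply, AlternatingMap.sub_apply,
    AlternatingMap.neg_apply, wedge4_single]
  push_cast
  ring

section AlternatingMap

variable {𝕜 V W ι : Type*} [CommSemiring 𝕜] [AddCommMonoid V] [Module 𝕜 V] [AddCommMonoid W]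
  [Module 𝕜 W] [Fintype ι]

theorem alternatingMap_vecCons_sum {n : ℕ} (f : V [⋀^Fin (n + 1)]→ₗ[𝕜] W) (c : ι → 𝕜) (e : ι → V)
    (v : Fin n → V) :
    f (Matrix.vecCons (∑ i, c i • e i) v) = ∑ i, c i • f (Matrix.vecCons (e i) v) := by
  have update_zero : ∀ x y, Function.update (Matrix.vecCons x v) 0 y = Matrix.vecCons y v :=
    fun x y => Fin.update_cons_zero (α := fun _ => V) x v y
  have h_sum := f.map_update_sum Finset.univ 0 (fun i => c i • e i) (Matrix.vecCons 0 v)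
  have h_smul := fun i => f.map_update_smul (Matrix.vecCons 0 v) 0 (c i) (e i)
  simp only [update_zero] at h_sum h_smul
  simp only [h_sum, h_smul]

theorem alternatingMap_sum_four (f : V [⋀^Fin 4]→ₗ[𝕜] W) (x y z w : ι → 𝕜) (e : ι → V) :
    f ![∑ i, x i • e i, ∑ i, y i • e i, ∑ i, z i • e i, ∑ i, w i • e i] =
      ∑ i, x i • ∑ j, y j • ∑ k, z k • ∑ l, w l • f ![e i, e j, e k, e l] := by
  rw [alternatingMap_vecCons_sum f]
  refine Finset.sum_congr rfl fun i _ => congrArg (x i • ·) ?_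
  refine (alternatingMap_vecCons_sum (f.curryLeft (e i)) y e _).trans
    (Finset.sum_congr rfl fun j _ => congrArg (y j • ·) ?_)
  refine (alternatingMap_vecCons_sum ((f.curryLeft (e i)).curryLeft (e j)) z e _).trans
    (Finset.sum_congr rfl fun k _ => congrArg (z k • ·) ?_)
  exact alternatingMap_vecCons_sum (((f.curryLeft (e i)).curryLeft (e j)).curryLeft (e k)) w e _

end AlternatingMap

theorem sum_smul_single (v : R8) : ∑ i, v i • EuclideanSpace.single i (1 : ℝ) = v := by
  ext j; simp [Finset.sum_apply, Pi.single_apply]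

theorem toMat_modelForm (v : Fin 8 → R8) :
    toMat (fun i j k l => modelForm ![v i, v j, v k, v l]) =
      (.of fun i a => v i a : Matrix (Fin 8) (Fin 8) ℝ) * toMat cayley *
        cube (.of fun a i => v i a) := by
  ext i ⟨j, k, l⟩
  have h := alternatingMap_sum_four modelForm (v i) (v j) (v k) (v l)
    fun a => EuclideanSpace.single a 1
  simp only [sum_smul_single, modelForm_single, smul_eq_mul] at h
  rw [toMat_apply, h, Matrix.mul_assoc]
  simp only [Matrix.mul_apply, Fintype.sum_prod_type, Matrix.of_apply, toMat_apply, cube_apply,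
    Finset.mul_sum]
  refine Finset.sum_congr rfl fun a _ => Finset.sum_congr rfl fun b _ =>
    Finset.sum_congr rfl fun c _ => Finset.sum_congr rfl fun d _ => ?_
  ring

/-! ### Local description of a `Spin(7)`-structure -/

/-- The matrix of the components of a metric at the point with coordinates `u`. -/
def metricMat (g : Comp2) (u : R8) : Matrix (Fin 8) (Fin 8) ℝ := .of fun i j => g i j u

/-- The components of a 4-form at the point with coordinates `u`, as a matrix. -/
def formMat (φ : Comp4) (u : R8) : Matrix (Fin 8) (Fin 8 × Fin 8 × Fin 8) ℝ :=
  toMat fun i j k l => φ i j k l u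

/-- The components `g`, `φ` of a metric and a 4-form on an open set `U` of `ℝ⁸` define a smooth
`Spin(7)`-structure. The rows of the matrix `P` are the components of the coordinate vectors in an
adapted frame. -/
structure LocalSpin7 (U : Set R8) (g : Comp2) (φ : Comp4) : Prop where
  isOpen : IsOpen U
  metric_smooth : ∀ i j, ContDiffOn ℝ ∞ (g i j) U
  form_smooth : ∀ i j k l, ContDiffOn ℝ ∞ (φ i j k l) U
  frame : ∀ u ∈ U, ∃ P : Matrix (Fin 8) (Fin 8) ℝ, IsUnit P ∧
    metricMat g u = P * Pᵀ ∧ formMat φ u = P * toMat cayley * cube Pᵀ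

section Manifold

variable {M : Type*} [TopologicalSpace M] [ChartedSpace R8 M] [IsManifold 𝓘(ℝ, R8) ∞ M]
  {e : OpenPartialHomeomorph M R8}

theorem contMDiffOn_coordVec (he : e ∈ atlas R8 M) (i : Fin 8) :
    ContMDiffOn 𝓘(ℝ, R8) 𝓘(ℝ, R8).tangent ∞
      (fun u => (⟨e.symm u, coordVec e i u⟩ : TangentBundle 𝓘(ℝ, R8) M)) e.target := by
  have h_symm : ContMDiffOn 𝓘(ℝ, R8) 𝓘(ℝ, R8) ∞ e.symm e.target :=
    contMDiffOn_symm_of_mem_maximalAtlas (IsManifold.subset_maximalAtlas he)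
  have h_tangent := h_symm.contMDiffOn_tangentMapWithin (m := ∞) le_rfl
    e.open_target.uniqueMDiffOn
  have h_single : ContMDiffOn 𝓘(ℝ, R8) 𝓘(ℝ, R8).tangent ∞
      (fun u : R8 => (⟨u, (EuclideanSpace.single i 1 : R8)⟩ : TangentBundle 𝓘(ℝ, R8) R8))
      e.target :=
    contMDiffOn_vectorSpace_iff_contDiffOn.2 contDiffOn_const
  refine (h_tangent.comp h_single fun u hu => hu).congr fun u hu => ?_
  simp only [Function.comp, tangentMapWithin, coordVec]
  rw [mfderivWithin_of_isOpen e.open_target hu]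

theorem mfderiv_symm_injective (he : e ∈ atlas R8 M) {u : R8} (hu : u ∈ e.target) :
    Function.Injective
      (mfderiv 𝓘(ℝ, R8) 𝓘(ℝ, R8) e.symm u : R8 → TangentSpace 𝓘(ℝ, R8) (e.symm u)) :=
  ((mdifferentiable_of_mem_atlas (I := 𝓘(ℝ, R8)) he).symm.mfderiv (x := u) hu).injective

omit [IsManifold 𝓘(ℝ, R8) ∞ M] in
theorem mfderiv_symm_toLp (x : Fin 8 → ℝ) (u : R8) :
    mfderiv 𝓘(ℝ, R8) 𝓘(ℝ, R8) e.symm u (WithLp.toLp 2 x : R8) = ∑ i, x i • coordVec e i u := by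
  conv_lhs => rw [← sum_smul_single (WithLp.toLp 2 x)]
  exact (map_sum (mfderiv 𝓘(ℝ, R8) 𝓘(ℝ, R8) e.symm u) _ _).trans
    (Finset.sum_congr rfl fun i _ => map_smul _ _ _)

theorem isUnit_coordVec (he : e ∈ atlas R8 M) {u : R8} (hu : u ∈ e.target)
    (f : R8 ≃ₗ[ℝ] TangentSpace 𝓘(ℝ, R8) (e.symm u)) :
    IsUnit (.of fun i a => f.symm (coordVec e i u) a : Matrix (Fin 8) (Fin 8) ℝ) := by
  rw [← Matrix.vecMul_injective_iff_isUnit]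
  have vecMul_eq : ∀ x a, Matrix.vecMul x (.of fun i a => f.symm (coordVec e i u) a) a =
      f.symm (mfderiv 𝓘(ℝ, R8) 𝓘(ℝ, R8) e.symm u (WithLp.toLp 2 x : R8)) a := by
    intro x a
    rw [mfderiv_symm_toLp, map_sum]
    simp [Matrix.vecMul, dotProduct]
  intro x y hxy
  refine WithLp.toLp_injective 2 (mfderiv_symm_injective he hu (f.symm.injective ?_))
  ext a
  rw [← vecMul_eq, ← vecMul_eq]
  exact congrFun hxy a

theorem Spin7Structure.contDiffOn_gComp (S : Spin7Structure M) (he : e ∈ atlas R8 M)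
    (i j : Fin 8) : ContDiffOn ℝ ∞ (S.gComp e i j) e.target := by
  rw [← contMDiffOn_iff_contDiffOn]
  have h_symm : ContMDiffOn 𝓘(ℝ, R8) 𝓘(ℝ, R8) ∞ e.symm e.target :=
    contMDiffOn_symm_of_mem_maximalAtlas (IsManifold.subset_maximalAtlas he)
  intro u hu
  have h : ContMDiffWithinAt 𝓘(ℝ, R8) (𝓘(ℝ, R8).prod 𝓘(ℝ, ℝ)) ∞
      (fun u => Bundle.TotalSpace.mk' ℝ (E := Bundle.Trivial M ℝ) (e.symm u)
        (S.metric.inner (e.symm u) (coordVec e i u) (coordVec e j u))) e.target u := by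
    apply ContMDiffWithinAt.clm_bundle_apply₂ (F₁ := R8) (F₂ := R8)
    · exact ContMDiffAt.comp_contMDiffWithinAt u S.metric.contMDiff.contMDiffAt (h_symm u hu)
    · exact contMDiffOn_coordVec he i u hu
    · exact contMDiffOn_coordVec he j u hu
  rw [Bundle.contMDiffWithinAt_totalSpace] at h
  exact h.2

theorem Spin7Structure.localSpin7 (S : Spin7Structure M) (he : e ∈ atlas R8 M) :
    LocalSpin7 e.target (S.gComp e) (S.ΦComp e) where
  isOpen := e.open_target
  metric_smooth := S.contDiffOn_gComp he
  form_smooth := S.form_smooth e he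
  frame u hu := by
    obtain ⟨f, hf, hΦ⟩ := S.adapted (e.symm u)
    set v : Fin 8 → R8 := fun i => f.symm (coordVec e i u)
    have hfv : ∀ i, f (v i) = coordVec e i u := fun i => f.apply_symm_apply _
    have form_eq : ∀ i j k l, S.ΦComp e i j k l u = modelForm ![v i, v j, v k, v l] := by
      intro i j k l
      rw [← hΦ]
      simp only [Spin7Structure.ΦComp, formComp, ← hfv]
      congr 1
      ext r; fin_cases r <;> rfl
    refine ⟨.of fun i a => v i a, isUnit_coordVec he hu f, ?_, ?_⟩
    · ext i j
      simp only [metricMat, Matrix.of_apply, Spin7Structure.gComp, ← hfv, hf]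
      simp [Matrix.mul_apply, PiLp.inner_apply, mul_comm]
    · simp only [formMat, form_eq]
      exact toMat_modelForm v

end Manifold

/-! ### Calculus with matrices of functions -/

section Pd

variable {U : Set R8} {u : R8}

theorem differentiableAt_of_contDiffOn {f : R8 → ℝ} (hU : IsOpen U) (hf : ContDiffOn ℝ ∞ f U)
    (hu : u ∈ U) : DifferentiableAt ℝ f u :=
  (hf.contDiffAt (hU.mem_nhds hu)).differentiableAt (by simp)

theorem contDiffOn_pd {f : R8 → ℝ} (hU : IsOpen U) (hf : ContDiffOn ℝ ∞ f U) (p : Fin 8) :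
    ContDiffOn ℝ ∞ (pd p f) U :=
  (hf.fderiv_of_isOpen hU le_rfl).clm_apply contDiffOn_const

theorem pd_congr {f f' : R8 → ℝ} (hU : IsOpen U) (h : ∀ v ∈ U, f v = f' v) (hu : u ∈ U)
    (p : Fin 8) : pd p f u = pd p f' u := by
  have h_ev : f =ᶠ[nhds u] f' := by
    filter_upwards [hU.mem_nhds hu] with v hv using h v hv
  rw [pd, pd, h_ev.fderiv_eq]

theorem pd_const (p : Fin 8) (c : ℝ) : pd p (fun _ => c) u = 0 := by
  simp [pd]

theorem pd_eq_zero {f : R8 → ℝ} (hU : IsOpen U) (h : ∀ v ∈ U, f v = 0) (hu : u ∈ U)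
    (p : Fin 8) : pd p f u = 0 := by
  rw [pd_congr hU h hu, pd_const]

theorem pd_add {f f' : R8 → ℝ} (hf : DifferentiableAt ℝ f u) (hf' : DifferentiableAt ℝ f' u)
    (p : Fin 8) : pd p (fun v => f v + f' v) u = pd p f u + pd p f' u := by
  simp [pd, fderiv_fun_add hf hf']

theorem pd_sub {f f' : R8 → ℝ} (hf : DifferentiableAt ℝ f u) (hf' : DifferentiableAt ℝ f' u)
    (p : Fin 8) : pd p (fun v => f v - f' v) u = pd p f u - pd p f' u := by
  simp [pd, fderiv_fun_sub hf hf']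

theorem pd_neg {f : R8 → ℝ} (p : Fin 8) : pd p (fun v => -f v) u = -pd p f u := by
  simp [pd, fderiv_fun_neg]

theorem pd_mul {f f' : R8 → ℝ} (hf : DifferentiableAt ℝ f u) (hf' : DifferentiableAt ℝ f' u)
    (p : Fin 8) : pd p (fun v => f v * f' v) u = pd p f u * f' u + f u * pd p f' u := by
  simp [pd, fderiv_fun_mul hf hf']
  ring

theorem pd_sum {ι : Type*} [Fintype ι] {f : ι → R8 → ℝ} (hf : ∀ i, DifferentiableAt ℝ (f i) u)
    (p : Fin 8) : pd p (fun v => ∑ i, f i v) u = ∑ i, pd p (f i) u := by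
  simp [pd, fderiv_fun_sum fun i _ => hf i]

theorem pd_comm {f : R8 → ℝ} (hU : IsOpen U) (hf : ContDiffOn ℝ ∞ f U) (hu : u ∈ U)
    (p q : Fin 8) : pd p (pd q f) u = pd q (pd p f) u := by
  have hf' := hf.contDiffAt (hU.mem_nhds hu)
  have h_diff : DifferentiableAt ℝ (fderiv ℝ f) u :=
    (hf'.fderiv_right (m := ∞) le_rfl).differentiableAt (by simp)
  have h_second : ∀ p q : Fin 8, pd p (pd q f) u =
      fderiv ℝ (fderiv ℝ f) u (EuclideanSpace.single p 1) (EuclideanSpace.single q 1) := by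
    intro p q
    change fderiv ℝ (fun v => fderiv ℝ f v (EuclideanSpace.single q 1)) u _ = _
    rw [fderiv_clm_apply h_diff (differentiableAt_const _)]
    simp
  rw [h_second, h_second]
  exact hf'.isSymmSndFDerivAt (by simpa using ENat.LEInfty.out) _ _

end Pd

section PdMat

variable {l m n m' n' : Type*}

/-- The entries of a matrix of functions are smooth on `U`. -/
def MatSmooth (U : Set R8) (A : R8 → Matrix m n ℝ) : Prop :=
  ∀ i j, ContDiffOn ℝ ∞ (fun u => A u i j) U

/-- The partial derivative of a matrix of functions. -/
def pdMat (p : Fin 8) (A : R8 → Matrix m n ℝ) (u : R8) : Matrix m n ℝ :=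
  Matrix.of fun i j => pd p (fun v => A v i j) u

@[simp] theorem pdMat_apply (p : Fin 8) (A : R8 → Matrix m n ℝ) (u : R8) (i : m) (j : n) :
    pdMat p A u i j = pd p (fun v => A v i j) u := rfl

variable {U : Set R8} {u : R8} {A B : R8 → Matrix m n ℝ}

theorem MatSmooth.differentiableAt (hA : MatSmooth U A) (hU : IsOpen U) (hu : u ∈ U) (i : m)
    (j : n) : DifferentiableAt ℝ (fun u => A u i j) u :=
  differentiableAt_of_contDiffOn hU (hA i j) hu

theorem MatSmooth.transpose (hA : MatSmooth U A) : MatSmooth U fun u => (A u)ᵀ :=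
  fun i j => hA j i

theorem MatSmooth.const (A : Matrix m n ℝ) : MatSmooth U fun _ => A := fun _ _ => contDiffOn_const

theorem MatSmooth.add (hA : MatSmooth U A) (hB : MatSmooth U B) :
    MatSmooth U fun u => A u + B u := fun i j => (hA i j).add (hB i j)

theorem MatSmooth.sub (hA : MatSmooth U A) (hB : MatSmooth U B) :
    MatSmooth U fun u => A u - B u := fun i j => (hA i j).sub (hB i j)

theorem MatSmooth.mul [Fintype n] {B : R8 → Matrix n l ℝ} (hA : MatSmooth U A)
    (hB : MatSmooth U B) : MatSmooth U fun u => A u * B u := fun i j => by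
  simp only [Matrix.mul_apply]
  exact ContDiffOn.sum fun k _ => (hA i k).mul (hB k j)

theorem MatSmooth.kronecker {B : R8 → Matrix m' n' ℝ} (hA : MatSmooth U A) (hB : MatSmooth U B) :
    MatSmooth U fun u => A u ⊗ₖ B u := fun i j =>
  (hA i.1 j.1).mul (hB i.2 j.2)

theorem MatSmooth.pdMat (hU : IsOpen U) (hA : MatSmooth U A) (p : Fin 8) :
    MatSmooth U (pdMat p A) := fun i j => contDiffOn_pd hU (hA i j) p

theorem MatSmooth.det [Fintype m] [DecidableEq m] {A : R8 → Matrix m m ℝ} (hA : MatSmooth U A) :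
    ContDiffOn ℝ ∞ (fun u => (A u).det) U := by
  simp only [Matrix.det_apply']
  exact ContDiffOn.sum fun σ _ => contDiffOn_const.mul (contDiffOn_prod fun i _ => hA _ _)

theorem MatSmooth.inv [Fintype m] [DecidableEq m] {A : R8 → Matrix m m ℝ} (hA : MatSmooth U A)
    (hdet : ∀ u ∈ U, IsUnit (A u).det) : MatSmooth U fun u => (A u)⁻¹ := by
  intro i j
  simp only [Matrix.inv_def, Matrix.smul_apply, Ring.inverse_eq_inv', smul_eq_mul]
  refine (hA.det.inv fun u hu => (hdet u hu).ne_zero).mul ?_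
  simp only [Matrix.adjugate_apply]
  refine MatSmooth.det fun k l => ?_
  simp only [Matrix.updateRow_apply]
  split_ifs
  · exact contDiffOn_const
  · exact hA k l

theorem pdMat_add (hU : IsOpen U) (hu : u ∈ U) (hA : MatSmooth U A) (hB : MatSmooth U B)
    (p : Fin 8) : pdMat p (fun u => A u + B u) u = pdMat p A u + pdMat p B u := by
  ext i j
  exact pd_add (hA.differentiableAt hU hu i j) (hB.differentiableAt hU hu i j) p

theorem pdMat_sub (hU : IsOpen U) (hu : u ∈ U) (hA : MatSmooth U A) (hB : MatSmooth U B)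
    (p : Fin 8) : pdMat p (fun u => A u - B u) u = pdMat p A u - pdMat p B u := by
  ext i j
  exact pd_sub (hA.differentiableAt hU hu i j) (hB.differentiableAt hU hu i j) p

theorem pdMat_transpose (p : Fin 8) :
    pdMat p (fun u => (A u)ᵀ) u = (pdMat p A u)ᵀ := rfl

theorem pdMat_const (p : Fin 8) (A : Matrix m n ℝ) : pdMat p (fun _ => A) u = 0 := by
  ext i j; simp [pd_const]

theorem pdMat_congr (hU : IsOpen U) (hu : u ∈ U) (h : ∀ v ∈ U, A v = B v) (p : Fin 8) :
    pdMat p A u = pdMat p B u := by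
  ext i j; exact pd_congr hU (fun v hv => by rw [h v hv]) hu p

theorem pdMat_mul [Fintype n] {B : R8 → Matrix n l ℝ} (hU : IsOpen U) (hu : u ∈ U)
    (hA : MatSmooth U A) (hB : MatSmooth U B) (p : Fin 8) :
    pdMat p (fun u => A u * B u) u = pdMat p A u * B u + A u * pdMat p B u := by
  ext i j
  simp only [pdMat_apply, Matrix.mul_apply, Matrix.add_apply]
  rw [pd_sum (f := fun k v => A v i k * B v k j) fun k =>
      (hA.differentiableAt hU hu i k).mul (hB.differentiableAt hU hu k j),
    ← Finset.sum_add_distrib]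
  exact Finset.sum_congr rfl fun k _ =>
    pd_mul (hA.differentiableAt hU hu i k) (hB.differentiableAt hU hu k j) p

theorem pdMat_kronecker {B : R8 → Matrix m' n' ℝ} (hU : IsOpen U) (hu : u ∈ U)
    (hA : MatSmooth U A) (hB : MatSmooth U B) (p : Fin 8) :
    pdMat p (fun u => A u ⊗ₖ B u) u =
      pdMat p A u ⊗ₖ B u + A u ⊗ₖ pdMat p B u := by
  ext i j
  exact pd_mul (hA.differentiableAt hU hu i.1 j.1) (hB.differentiableAt hU hu i.2 j.2) p

theorem pdMat_comm (hU : IsOpen U) (hu : u ∈ U) (hA : MatSmooth U A) (p q : Fin 8) :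
    pdMat p (pdMat q A) u = pdMat q (pdMat p A) u := by
  ext i j; exact pd_comm hU (hA i j) hu p q

end PdMat

/-! ### Connections and covariant derivatives in matrix form -/

section Connection

variable {k l m n m' n' : Type*} [Fintype k] [Fintype l] [Fintype m] [Fintype n] {U : Set R8}
  {u : R8}

/-- The connection dual to a connection, both given by their matrices in the coordinate
directions. -/
def dualConn (A : Fin 8 → R8 → Matrix m m ℝ) (p : Fin 8) (u : R8) : Matrix m m ℝ :=
  -(A p u)ᵀ

/-- The connection induced on a tensor product. -/
def tensorConn [DecidableEq m] [DecidableEq n] (A : Fin 8 → R8 → Matrix m m ℝ)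
    (B : Fin 8 → R8 → Matrix n n ℝ) (p : Fin 8) (u : R8) : Matrix (m × n) (m × n) ℝ :=
  A p u ⊗ₖ 1 + 1 ⊗ₖ B p u

/-- The covariant derivative of a section of a tensor product, seen as a matrix, with respect to
connections on the two factors. -/
def covDeriv (A : Fin 8 → R8 → Matrix m m ℝ) (B : Fin 8 → R8 → Matrix n n ℝ)
    (X : R8 → Matrix m n ℝ) (p : Fin 8) (u : R8) : Matrix m n ℝ :=
  pdMat p X u - A p u * X u - X u * (B p u)ᵀ

/-- The curvature of a connection. -/
def curvMat (A : Fin 8 → R8 → Matrix m m ℝ) (p q : Fin 8) (u : R8) : Matrix m m ℝ :=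
  pdMat p (A q) u - pdMat q (A p) u - (A p u * A q u - A q u * A p u)

variable {A : Fin 8 → R8 → Matrix l l ℝ} {B : Fin 8 → R8 → Matrix m m ℝ}
  {C : Fin 8 → R8 → Matrix n n ℝ}

omit [Fintype m] in
theorem dualConn_dualConn : dualConn (dualConn B) = B := by
  funext p u
  simp only [dualConn, Matrix.transpose_neg, Matrix.transpose_transpose, neg_neg]

omit [Fintype l] [Fintype m] in
theorem dualConn_tensorConn [DecidableEq l] [DecidableEq m] :
    dualConn (tensorConn A B) = tensorConn (dualConn A) (dualConn B) := by
  funext p u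
  ext i j
  simp only [dualConn, tensorConn, Matrix.neg_apply, Matrix.transpose_apply, Matrix.add_apply,
    Matrix.kroneckerMap_apply, Matrix.one_apply, eq_comm (a := i.1), eq_comm (a := i.2)]
  ring

omit [Fintype l] [Fintype m] in
theorem MatSmooth.tensorConn [DecidableEq l] [DecidableEq m] {p : Fin 8}
    (hA : MatSmooth U (A p)) (hB : MatSmooth U (B p)) : MatSmooth U (tensorConn A B p) :=
  (hA.kronecker (.const 1)).add ((MatSmooth.const 1).kronecker hB)

theorem MatSmooth.covDeriv {X : R8 → Matrix m n ℝ} (hU : IsOpen U) (hB : ∀ p, MatSmooth U (B p))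
    (hC : ∀ p, MatSmooth U (C p)) (hX : MatSmooth U X) (p : Fin 8) :
    MatSmooth U (covDeriv B C X p) :=
  ((hX.pdMat hU p).sub ((hB p).mul hX)).sub (hX.mul (hC p).transpose)

theorem covDeriv_congr {X Y : R8 → Matrix m n ℝ} (hU : IsOpen U) (hu : u ∈ U)
    (h : ∀ v ∈ U, X v = Y v) (p : Fin 8) : covDeriv B C X p u = covDeriv B C Y p u := by
  rw [covDeriv, covDeriv, pdMat_congr hU hu h, h u hu]

theorem covDeriv_const (X : Matrix m n ℝ) (p : Fin 8) :
    covDeriv B C (fun _ => X) p u = -(B p u * X + X * (C p u)ᵀ) := by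
  rw [covDeriv, pdMat_const]; abel

theorem covDeriv_sub {X Y : R8 → Matrix m n ℝ} (hU : IsOpen U) (hu : u ∈ U) (hX : MatSmooth U X)
    (hY : MatSmooth U Y) (p : Fin 8) : covDeriv B C (fun v => X v - Y v) p u =
      covDeriv B C X p u - covDeriv B C Y p u := by
  rw [covDeriv, pdMat_sub hU hu hX hY, covDeriv, covDeriv, Matrix.mul_sub, Matrix.sub_mul]; abel

theorem covDeriv_transpose {X : R8 → Matrix m n ℝ} (p : Fin 8) :
    covDeriv C B (fun v => (X v)ᵀ) p u = (covDeriv B C X p u)ᵀ := by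
  rw [covDeriv, pdMat_transpose, covDeriv, Matrix.transpose_sub, Matrix.transpose_sub,
    Matrix.transpose_mul, Matrix.transpose_mul, Matrix.transpose_transpose]
  abel

theorem covDeriv_mul {B' : Fin 8 → R8 → Matrix m m ℝ} {X : R8 → Matrix l m ℝ}
    {Y : R8 → Matrix m n ℝ} (hB' : B' = dualConn B) (hU : IsOpen U) (hu : u ∈ U)
    (hX : MatSmooth U X) (hY : MatSmooth U Y) (p : Fin 8) :
    covDeriv A C (fun v => X v * Y v) p u =
      covDeriv A B X p u * Y u + X u * covDeriv B' C Y p u := by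
  rw [covDeriv, pdMat_mul hU hu hX hY, covDeriv, covDeriv, hB', dualConn]
  simp only [Matrix.mul_sub, Matrix.sub_mul, Matrix.neg_mul, Matrix.mul_neg, Matrix.mul_assoc]
  abel

theorem covDeriv_kronecker [DecidableEq k] [DecidableEq l] [DecidableEq m] [DecidableEq n]
    {D : Fin 8 → R8 → Matrix k k ℝ} {X : R8 → Matrix k l ℝ} {Y : R8 → Matrix m n ℝ}
    (hU : IsOpen U) (hu : u ∈ U) (hX : MatSmooth U X) (hY : MatSmooth U Y) (p : Fin 8) :
    covDeriv (tensorConn D B) (tensorConn A C) (fun v => X v ⊗ₖ Y v) p u =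
      covDeriv D A X p u ⊗ₖ Y u + X u ⊗ₖ covDeriv B C Y p u := by
  rw [covDeriv, pdMat_kronecker hU hu hX hY]
  simp only [covDeriv, tensorConn, Matrix.transpose_add, Matrix.add_mul, Matrix.mul_add,
    ← Matrix.kroneckerMap_transpose, Matrix.transpose_one, ← Matrix.mul_kronecker_mul,
    Matrix.one_mul, Matrix.mul_one]
  ext i j
  simp only [Matrix.add_apply, Matrix.sub_apply, Matrix.kroneckerMap_apply]
  ring

theorem curvMat_tensorConn [DecidableEq m] [DecidableEq n] (hU : IsOpen U) (hu : u ∈ U)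
    (hB : ∀ p, MatSmooth U (B p)) (hC : ∀ p, MatSmooth U (C p)) (p q : Fin 8) :
    curvMat (tensorConn B C) p q u = curvMat B p q u ⊗ₖ 1 + 1 ⊗ₖ curvMat C p q u := by
  have h_left := fun p => (hB p).kronecker (MatSmooth.const (U := U) (1 : Matrix n n ℝ))
  have h_right := fun p => (MatSmooth.const (U := U) (1 : Matrix m m ℝ)).kronecker (hC p)
  have pdMat_tensorConn : ∀ p q, pdMat p (tensorConn B C q) u =
      pdMat p (B q) u ⊗ₖ 1 + 1 ⊗ₖ pdMat p (C q) u := fun p q => by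
    refine (pdMat_add hU hu (h_left q) (h_right q) p).trans ?_
    rw [pdMat_kronecker hU hu (hB q) (.const _), pdMat_kronecker hU hu (.const _) (hC q),
      pdMat_const, pdMat_const]
    simp only [Matrix.kronecker_zero, Matrix.zero_kronecker, add_zero, zero_add]
  simp only [curvMat, pdMat_tensorConn]
  simp only [tensorConn, add_mul, mul_add, ← Matrix.mul_kronecker_mul, one_mul, mul_one]
  ext i j
  simp only [Matrix.add_apply, Matrix.sub_apply, Matrix.kroneckerMap_apply]
  ring

theorem covDeriv_covDeriv_sub {X : R8 → Matrix m n ℝ} (hU : IsOpen U) (hu : u ∈ U)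
    (hB : ∀ p, MatSmooth U (B p)) (hC : ∀ p, MatSmooth U (C p)) (hX : MatSmooth U X)
    (p q : Fin 8) : covDeriv B C (covDeriv B C X q) p u - covDeriv B C (covDeriv B C X p) q u =
      -(curvMat B p q u * X u + X u * (curvMat C p q u)ᵀ) := by
  have covDeriv_covDeriv : ∀ p q, covDeriv B C (covDeriv B C X q) p u =
      pdMat p (covDeriv B C X q) u - B p u * covDeriv B C X q u -
        covDeriv B C X q u * (C p u)ᵀ := fun _ _ => rfl
  have pdMat_covDeriv : ∀ p q, pdMat p (covDeriv B C X q) u = pdMat p (pdMat q X) u -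
      (pdMat p (B q) u * X u + B q u * pdMat p X u) -
      (pdMat p X u * (C q u)ᵀ + X u * (pdMat p (C q) u)ᵀ) := by
    intro p q
    have h_left := (hB q).mul hX
    have h_right := hX.mul (hC q).transpose
    refine (pdMat_sub hU hu ((hX.pdMat hU q).sub h_left) h_right p).trans ?_
    rw [pdMat_sub hU hu (hX.pdMat hU q) h_left, pdMat_mul hU hu (hB q) hX,
      pdMat_mul hU hu hX (hC q).transpose, pdMat_transpose]
  rw [covDeriv_covDeriv, covDeriv_covDeriv, pdMat_covDeriv, pdMat_covDeriv,
    pdMat_comm hU hu hX p q]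
  simp only [covDeriv, curvMat, Matrix.mul_sub, Matrix.sub_mul, Matrix.transpose_sub,
    Matrix.transpose_mul, Matrix.mul_assoc]
  abel

end Connection

section Weitzenboeck

variable {n : Type*} [Fintype n] {U : Set R8} {u : R8} {A : Fin 8 → R8 → Matrix (Fin 8) (Fin 8) ℝ}
  {C : Fin 8 → R8 → Matrix n n ℝ} {H : R8 → Matrix (Fin 8) (Fin 8) ℝ} {L : R8 → Matrix n n ℝ}

theorem sum_pdMat_eq_zero {Z : Fin 8 → R8 → Matrix (Fin 8) (Fin 8) ℝ} (hU : IsOpen U) (hu : u ∈ U)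
    (hZ : ∀ a, MatSmooth U (Z a)) (hdiv : ∀ v ∈ U, ∀ p, ∑ a, Z a v p a = 0) :
    ∑ p, ∑ a, pdMat p (Z a) u p a = 0 := Finset.sum_eq_zero fun p _ => by
  simp only [pdMat_apply]
  rw [← pd_sum fun a => (hZ a).differentiableAt hU hu p a]
  exact pd_eq_zero hU (fun v hv => hdiv v hv p) hu p

theorem sum_covDeriv_apply_comm {Z : Fin 8 → R8 → Matrix (Fin 8) (Fin 8) ℝ} (hU : IsOpen U)
    (hu : u ∈ U) (hsymm : ∀ p i j, A p u i j = A i u p j) (hZ : ∀ a, MatSmooth U (Z a))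
    (hrow : ∀ v ∈ U, ∀ p, ∑ a, Z a v p a = 0) (hcol : ∀ v ∈ U, ∀ p, ∑ a, Z a v a p = 0) :
    ∑ p, ∑ a, covDeriv (dualConn A) (dualConn A) (Z a) p u p a =
      ∑ p, ∑ a, covDeriv (dualConn A) (dualConn A) (Z a) p u a p := by
  have h_left_row : ∑ p, ∑ a, ((A p u)ᵀ * Z a u) p a = 0 :=
    Finset.sum_eq_zero fun p _ => by
      simp only [Matrix.mul_apply]
      rw [Finset.sum_comm]
      exact Finset.sum_eq_zero fun s _ => by rw [← Finset.mul_sum, hrow u hu s, mul_zero]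
  have h_right_col : ∑ p, ∑ a, (Z a u * A p u) a p = 0 := Finset.sum_eq_zero fun p _ => by
    simp only [Matrix.mul_apply]
    rw [Finset.sum_comm]
    exact Finset.sum_eq_zero fun s _ => by rw [← Finset.sum_mul, hcol u hu s, zero_mul]
  have h_right_row : ∑ p, ∑ a, (Z a u * A p u) p a = ∑ p, ∑ a, ((A p u)ᵀ * Z a u) a p := by
    simp only [Matrix.mul_apply, Matrix.transpose_apply]
    rw [Finset.sum_comm, Finset.sum_comm (f := fun p a => ∑ s, A p u s a * Z a u s p)]
    refine Finset.sum_congr rfl fun a _ => ?_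
    rw [Finset.sum_comm]
    exact Finset.sum_congr rfl fun s _ => Finset.sum_congr rfl fun p _ => by rw [hsymm, mul_comm]
  have h_row := sum_pdMat_eq_zero hU hu hZ hrow
  have h_col := sum_pdMat_eq_zero hU hu (fun a => (hZ a).transpose) hcol
  simp only [pdMat_transpose, Matrix.transpose_apply] at h_col
  simp only [covDeriv, dualConn, Matrix.neg_mul, Matrix.transpose_neg, Matrix.mul_neg,
    Matrix.transpose_transpose, sub_neg_eq_add, Matrix.add_apply, Finset.sum_add_distrib, h_row,
    h_col, h_left_row, h_right_col, h_right_row, zero_add, add_zero]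

theorem covDeriv_raise {X Y : R8 → Matrix (Fin 8) n ℝ} (hU : IsOpen U) (hu : u ∈ U)
    (hH : MatSmooth U H) (hL : MatSmooth U L) (hX : MatSmooth U X) (hY : MatSmooth U Y) (p : Fin 8)
    (hHA : covDeriv (dualConn A) (dualConn A) H p u = 0)
    (hLC : covDeriv (dualConn C) (dualConn C) L p u = 0) :
    covDeriv (dualConn A) (dualConn A) (fun v => H v * X v * L v * (Y v)ᵀ * H v) p u =
      H u * covDeriv A C X p u * L u * (Y u)ᵀ * H u +
        H u * X u * L u * (covDeriv A C Y p u)ᵀ * H u := by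
  have h_HX := hH.mul hX
  have h_HXL := h_HX.mul hL
  rw [covDeriv_mul (B := A) rfl hU hu (h_HXL.mul hY.transpose) hH, hHA,
    covDeriv_mul (B' := C) dualConn_dualConn.symm hU hu h_HXL hY.transpose,
    covDeriv_mul (B := C) rfl hU hu h_HX hL, hLC,
    covDeriv_mul (B' := A) dualConn_dualConn.symm hU hu hH hX, hHA, covDeriv_transpose]
  simp only [Matrix.zero_mul, Matrix.mul_zero, zero_add, add_zero, Matrix.add_mul]

theorem sum_covDeriv_mul_covDeriv_sub {X : R8 → Matrix (Fin 8) n ℝ} (hU : IsOpen U) (hu : u ∈ U)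
    (hA : ∀ p, MatSmooth U (A p)) (hC : ∀ p, MatSmooth U (C p)) (hH : MatSmooth U H)
    (hL : MatSmooth U L) (hX : MatSmooth U X) (hsymm : ∀ p i j, A p u i j = A i u p j)
    (hHA : ∀ p, covDeriv (dualConn A) (dualConn A) H p u = 0)
    (hLC : ∀ p, covDeriv (dualConn C) (dualConn C) L p u = 0)
    (hrow : ∀ v ∈ U, ∀ p, ∑ a, (H v * X v * L v * (covDeriv A C X a v)ᵀ * H v) p a = 0)
    (hcol : ∀ v ∈ U, ∀ p, ∑ a, (H v * X v * L v * (covDeriv A C X a v)ᵀ * H v) a p = 0) :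
    ∑ p, ∑ a, (H u * covDeriv A C X p u * L u * (covDeriv A C X a u)ᵀ * H u) p a -
      ∑ p, ∑ a, (H u * covDeriv A C X p u * L u * (covDeriv A C X a u)ᵀ * H u) a p =
    ∑ p, ∑ a, (H u * X u * L u *
      (curvMat A p a u * X u + X u * (curvMat C p a u)ᵀ)ᵀ * H u) p a := by
  have h_smooth := fun a => hX.covDeriv hU hA hC a
  have h_div := sum_covDeriv_apply_comm hU hu hsymm
    (fun a => (((hH.mul hX).mul hL).mul (h_smooth a).transpose).mul hH) hrow hcol
  simp only [covDeriv_raise hU hu hH hL hX (h_smooth _) _ (hHA _) (hLC _), Matrix.add_apply,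
    Finset.sum_add_distrib] at h_div
  have h_curv : ∀ p a, (H u * X u * L u * (curvMat A p a u * X u +
      X u * (curvMat C p a u)ᵀ)ᵀ * H u) p a =
      (H u * X u * L u * (covDeriv A C (covDeriv A C X p) a u)ᵀ * H u) p a -
        (H u * X u * L u * (covDeriv A C (covDeriv A C X a) p u)ᵀ * H u) p a := by
    intro p a
    rw [← Matrix.sub_apply, ← Matrix.sub_mul, ← Matrix.mul_sub, ← Matrix.transpose_sub,
      ← neg_sub (covDeriv A C (covDeriv A C X a) p u), covDeriv_covDeriv_sub hU hu hA hC hX,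
      neg_neg]
  simp only [h_curv, Finset.sum_sub_distrib]
  rw [Finset.sum_comm (f := fun p a => (H u * X u * L u *
    (covDeriv A C (covDeriv A C X p) a u)ᵀ * H u) p a)]
  linarith

end Weitzenboeck

/-! ### Change of frame -/

section ChangeFrame

variable {ι κ : Type*} [Fintype κ]

/-- The components of a covariant 4-tensor in another frame: every index is contracted with the
matrix `P`. -/
def changeFrame (P : Matrix ι κ ℝ) (T : κ → κ → κ → κ → ℝ) (i j k l : ι) : ℝ :=
  ∑ a, ∑ b, ∑ c, ∑ d, P i a * P j b * P k c * P l d * T a b c d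

variable {T : κ → κ → κ → κ → ℝ}

theorem toMat_changeFrame (P : Matrix ι κ ℝ) :
    toMat (changeFrame P T) = P * toMat T * cube Pᵀ := by
  ext i ⟨j, k, l⟩
  rw [toMat_apply, changeFrame, Matrix.mul_assoc]
  simp only [Matrix.mul_apply, Fintype.sum_prod_type, toMat_apply, cube_apply,
    Matrix.transpose_apply, Finset.mul_sum]
  refine Finset.sum_congr rfl fun a _ => Finset.sum_congr rfl fun b _ =>
    Finset.sum_congr rfl fun c _ => Finset.sum_congr rfl fun d _ => ?_
  ring

theorem toMat₂_changeFrame (P : Matrix ι κ ℝ) :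
    toMat₂ (changeFrame P T) = (P ⊗ₖ P) * toMat₂ T * (P ⊗ₖ P)ᵀ := by
  ext ⟨i, j⟩ ⟨k, l⟩
  rw [toMat₂_apply, changeFrame, Matrix.mul_assoc]
  simp only [Matrix.mul_apply, Fintype.sum_prod_type, toMat₂_apply, Matrix.kroneckerMap_apply,
    Matrix.transpose_apply, Finset.mul_sum]
  refine Finset.sum_congr rfl fun a _ => Finset.sum_congr rfl fun b _ =>
    Finset.sum_congr rfl fun c _ => Finset.sum_congr rfl fun d _ => ?_
  ring

theorem Alt₄.changeFrame (hT : Alt₄ T) (P : Matrix ι κ ℝ) : Alt₄ (changeFrame P T) where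
  swap₁₂ i j k l := by
    simp only [Spin7.changeFrame, ← Finset.sum_neg_distrib]
    rw [Finset.sum_comm]
    refine Finset.sum_congr rfl fun a _ => Finset.sum_congr rfl fun b _ =>
      Finset.sum_congr rfl fun c _ => Finset.sum_congr rfl fun d _ => ?_
    rw [hT.swap₁₂]; ring
  swap₂₃ i j k l := by
    simp only [Spin7.changeFrame, ← Finset.sum_neg_distrib]
    refine Finset.sum_congr rfl fun a _ => ?_
    rw [Finset.sum_comm]
    refine Finset.sum_congr rfl fun b _ => Finset.sum_congr rfl fun c _ =>
      Finset.sum_congr rfl fun d _ => ?_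
    rw [hT.swap₂₃]; ring
  swap₃₄ i j k l := by
    simp only [Spin7.changeFrame, ← Finset.sum_neg_distrib]
    refine Finset.sum_congr rfl fun a _ => Finset.sum_congr rfl fun b _ => ?_
    rw [Finset.sum_comm]
    refine Finset.sum_congr rfl fun c _ => Finset.sum_congr rfl fun d _ => ?_
    rw [hT.swap₃₄]; ring

end ChangeFrame

theorem toMat_injective {ι : Type*} :
    Function.Injective (toMat : (ι → ι → ι → ι → ℝ) → Matrix ι (ι × ι × ι) ℝ) := fun _ _ h => by
  funext i j k l; exact congrFun (congrFun h i) (j, k, l)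

/-! ### The Levi-Civita connection of a local `Spin(7)`-structure -/

/-- The inverse of the matrix of a metric. -/
def invMetricMat (g : Comp2) (u : R8) : Matrix (Fin 8) (Fin 8) ℝ := (metricMat g u)⁻¹

/-- The connection induced on covectors by a linear connection, in matrix form. -/
def connMat (A : Comp3) (p : Fin 8) (u : R8) : Matrix (Fin 8) (Fin 8) ℝ :=
  .of fun b s => A s p b u

/-- The action of an endomorphism on the third tensor power, by the Leibniz rule. -/
def derivCube {m : Type*} [DecidableEq m] (F : Matrix m m ℝ) :
    Matrix (m × m × m) (m × m × m) ℝ := F ⊗ₖ 1 + 1 ⊗ₖ (F ⊗ₖ 1 + 1 ⊗ₖ F)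

/-- The third tensor power of a connection. -/
def cubeConn {m : Type*} [DecidableEq m] (A : Fin 8 → R8 → Matrix m m ℝ) (p : Fin 8) (u : R8) :
    Matrix (m × m × m) (m × m × m) ℝ := derivCube (A p u)

/-- The Levi-Civita connection on covectors, in matrix form. -/
def leviCivita (g : Comp2) : Fin 8 → R8 → Matrix (Fin 8) (Fin 8) ℝ := connMat (christoffel g)

/-- The Levi-Civita covariant derivative of a 4-form, as a matrix. -/
def nablaMat (g : Comp2) (φ : Comp4) (p : Fin 8) (u : R8) :
    Matrix (Fin 8) (Fin 8 × Fin 8 × Fin 8) ℝ := toMat fun i j k l => nablaForm g φ p i j k l u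

theorem curvMat_connMat (A : Comp3) (p a b s : Fin 8) (u : R8) :
    curvMat (connMat A) p a u b s = curvature A s p a b u := by
  simp only [curvMat, curvature, connMat, Matrix.sub_apply, pdMat_apply, Matrix.of_apply,
    Matrix.mul_apply, Finset.sum_sub_distrib]
  ring

section Cube

variable {m n : Type*} {U : Set R8} {u : R8}

theorem MatSmooth.cube {X : R8 → Matrix m n ℝ} (hX : MatSmooth U X) :
    MatSmooth U fun v => cube (X v) := hX.kronecker (hX.kronecker hX)

theorem MatSmooth.cubeConn [DecidableEq m] {A : Fin 8 → R8 → Matrix m m ℝ} {p : Fin 8}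
    (hA : MatSmooth U (A p)) : MatSmooth U (cubeConn A p) := hA.tensorConn (hA.tensorConn hA)

variable [Fintype m] [Fintype n] [DecidableEq m] [DecidableEq n]
  {A : Fin 8 → R8 → Matrix m m ℝ} {B : Fin 8 → R8 → Matrix n n ℝ} {X : R8 → Matrix m n ℝ}

omit [DecidableEq m] in
theorem covDeriv_const_eq_zero {R : Matrix m m ℝ} {p : Fin 8} (h : Commute R (A p u)) :
    covDeriv A (dualConn A) (fun _ => R) p u = 0 := by
  rw [covDeriv_const, dualConn, Matrix.transpose_neg, Matrix.transpose_transpose, Matrix.mul_neg,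
    ← h.eq, add_neg_cancel, neg_zero]

omit [Fintype m] in
theorem derivCube_apply (F : Matrix m m ℝ) (i j k a b c : m) :
    derivCube F (i, j, k) (a, b, c) =
      F i a * (1 : Matrix m m ℝ) j b * (1 : Matrix m m ℝ) k c +
        (1 : Matrix m m ℝ) i a * F j b * (1 : Matrix m m ℝ) k c +
        (1 : Matrix m m ℝ) i a * (1 : Matrix m m ℝ) j b * F k c := by
  simp only [derivCube, ← Matrix.one_kronecker_one, Matrix.add_apply, Matrix.kroneckerMap_apply]
  ring

omit [Fintype m] in
theorem cubeConn_eq_tensorConn : cubeConn A = tensorConn A (tensorConn A A) := rfl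

omit [Fintype m] in
theorem dualConn_cubeConn : dualConn (cubeConn A) = cubeConn (dualConn A) := by
  simp only [cubeConn_eq_tensorConn, dualConn_tensorConn]

theorem covDeriv_cube_eq_zero (hU : IsOpen U) (hu : u ∈ U) (hX : MatSmooth U X) (p : Fin 8)
    (h : covDeriv A B X p u = 0) :
    covDeriv (cubeConn A) (cubeConn B) (fun v => cube (X v)) p u = 0 := by
  simp only [cube, cubeConn_eq_tensorConn]
  rw [covDeriv_kronecker hU hu hX (hX.kronecker hX), covDeriv_kronecker hU hu hX hX, h]
  simp only [Matrix.zero_kronecker, Matrix.kronecker_zero, add_zero]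

theorem cyclicSum_commute_cubeConn (p : Fin 8) : Commute (cyclicSum m) (cubeConn A p u) :=
  cyclicSum_commute fun i j k a b c => by simp only [cubeConn, derivCube_apply]; ring

theorem covDeriv_cyclicSum_mul_mul_cyclicSum {X : R8 → Matrix (m × m × m) (n × n × n) ℝ}
    (hU : IsOpen U) (hu : u ∈ U) (hX : MatSmooth U X) (p : Fin 8) :
    covDeriv (cubeConn A) (cubeConn B) (fun v => cyclicSum m * X v * cyclicSum n) p u =
      cyclicSum m * covDeriv (cubeConn A) (cubeConn B) X p u * cyclicSum n := by
  have h_left := covDeriv_const_eq_zero (cyclicSum_commute_cubeConn (A := A) (u := u) p)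
  have h_right : covDeriv (dualConn (cubeConn B)) (cubeConn B) (fun _ => cyclicSum n) p u = 0 := by
    have h := covDeriv_const_eq_zero (cyclicSum_commute_cubeConn (A := dualConn B) (u := u) p)
    rwa [← dualConn_cubeConn, dualConn_dualConn] at h
  rw [covDeriv_mul (B := cubeConn B) rfl hU hu ((MatSmooth.const _).mul hX) (.const _), h_right,
    covDeriv_mul (B := dualConn (cubeConn A)) dualConn_dualConn.symm hU hu (.const _) hX, h_left,
    Matrix.zero_mul, Matrix.mul_zero, zero_add, add_zero]

theorem antisymmetrizer_commute_cubeConn (p : Fin 8) :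
    Commute (antisymmetrizer m) (cubeConn A p u) :=
  antisymmetrizer_commute (fun i j k a b c => by simp only [cubeConn, derivCube_apply]; ring)
    fun i j k a b c => by simp only [cubeConn, derivCube_apply]; ring

end Cube

theorem nablaMat_eq_covDeriv (g : Comp2) (φ : Comp4) :
    nablaMat g φ = covDeriv (leviCivita g) (cubeConn (leviCivita g)) (formMat φ) := by
  funext p u
  ext i ⟨j, k, l⟩
  simp only [nablaMat, toMat_apply, nablaForm, covDeriv, Matrix.sub_apply, pdMat_apply, formMat,
    Matrix.mul_apply, leviCivita, connMat, Matrix.transpose_apply, cubeConn, derivCube_apply,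
    Matrix.of_apply, Fintype.sum_prod_type, Matrix.one_apply, mul_add, Finset.sum_add_distrib,
    mul_ite, ite_mul, mul_one, mul_zero, one_mul, zero_mul, Finset.sum_ite_eq, Finset.mem_univ,
    if_true, Finset.sum_const_zero, Finset.sum_ite_irrel]
  simp only [mul_comm (φ _ _ _ _ _)]
  ring

theorem toMat₂_nablaForm (g : Comp2) (φ : Comp4) (p : Fin 8) (u : R8) :
    toMat₂ (fun i j k l => nablaForm g φ p i j k l u) =
      covDeriv (tensorConn (leviCivita g) (leviCivita g)) (tensorConn (leviCivita g) (leviCivita g))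
        (fun v => toMat₂ fun i j k l => φ i j k l v) p u := by
  ext ⟨i, j⟩ ⟨k, l⟩
  simp only [toMat₂_apply, nablaForm, covDeriv, Matrix.sub_apply, pdMat_apply, Matrix.mul_apply,
    leviCivita, connMat, tensorConn, Matrix.transpose_apply, Matrix.of_apply, Matrix.add_apply,
    Matrix.kroneckerMap_apply, Fintype.sum_prod_type, Matrix.one_apply, add_mul, mul_add,
    Finset.sum_add_distrib, mul_ite, ite_mul, mul_one, mul_zero, one_mul, zero_mul,
    Finset.sum_ite_eq, Finset.mem_univ, if_true, Finset.sum_const_zero, Finset.sum_ite_irrel]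
  simp only [mul_comm (φ _ _ _ _ _)]
  ring

theorem codiff_eq (g : Comp2) (φ : Comp4) (k l m : Fin 8) (u : R8) :
    codiff g φ k l m u = -∑ p, (invMetricMat g u * nablaMat g φ p u) p (k, l, m) := by
  simp only [codiff, Matrix.mul_apply]; rfl

namespace LocalSpin7

variable {U : Set R8} {g : Comp2} {φ : Comp4} {u : R8}

theorem exists_frame (h : LocalSpin7 U g φ) (hu : u ∈ U) : ∃ P E : Matrix (Fin 8) (Fin 8) ℝ,
    P * E = 1 ∧ E * P = 1 ∧ metricMat g u = P * Pᵀ ∧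
    invMetricMat g u = Eᵀ * E ∧
    (fun i j k l => φ i j k l u) = changeFrame P cayley := by
  obtain ⟨P, hP, hg, hφ⟩ := h.frame u hu
  have hPE := Matrix.mul_nonsing_inv P ((Matrix.isUnit_iff_isUnit_det P).1 hP)
  have hEP := Matrix.nonsing_inv_mul P ((Matrix.isUnit_iff_isUnit_det P).1 hP)
  refine ⟨P, P⁻¹, hPE, hEP, hg, ?_, toMat_injective ?_⟩
  · rw [invMetricMat, hg, Matrix.mul_inv_rev, Matrix.transpose_nonsing_inv]
  · rw [toMat_changeFrame]; exact hφ

theorem alt₄_form (h : LocalSpin7 U g φ) (hu : u ∈ U) : Alt₄ fun i j k l => φ i j k l u := by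
  obtain ⟨P, -, -, -, -, -, hφ⟩ := h.exists_frame hu
  rw [hφ]
  exact alt₄_cayley.changeFrame P

theorem metricMat_transpose (h : LocalSpin7 U g φ) (hu : u ∈ U) :
    (metricMat g u)ᵀ = metricMat g u := by
  obtain ⟨P, -, hg, -⟩ := h.frame u hu
  rw [hg, Matrix.transpose_mul, Matrix.transpose_transpose]

theorem invMetricMat_transpose (h : LocalSpin7 U g φ) (hu : u ∈ U) :
    (invMetricMat g u)ᵀ = invMetricMat g u := by
  rw [invMetricMat, Matrix.transpose_nonsing_inv, h.metricMat_transpose hu]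

theorem metricMat_mul_invMetricMat (h : LocalSpin7 U g φ) (hu : u ∈ U) :
    metricMat g u * invMetricMat g u = 1 := by
  obtain ⟨P, hP, hg, -⟩ := h.frame u hu
  refine Matrix.mul_nonsing_inv _ ((Matrix.isUnit_iff_isUnit_det _).1 ?_)
  rw [hg]
  exact hP.mul (Matrix.isUnit_transpose P |>.2 hP)

theorem invMetricMat_mul_metricMat (h : LocalSpin7 U g φ) (hu : u ∈ U) :
    invMetricMat g u * metricMat g u = 1 := mul_eq_one_comm.1 (h.metricMat_mul_invMetricMat hu)

theorem smooth_metricMat (h : LocalSpin7 U g φ) : MatSmooth U (metricMat g) := h.metric_smooth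

theorem smooth_invMetricMat (h : LocalSpin7 U g φ) : MatSmooth U (invMetricMat g) :=
  h.smooth_metricMat.inv fun _ hu => (Matrix.isUnit_iff_isUnit_det _).1
    (IsUnit.of_mul_eq_one _ (h.metricMat_mul_invMetricMat hu))

theorem smooth_formMat (h : LocalSpin7 U g φ) : MatSmooth U (formMat φ) :=
  fun _ _ => h.form_smooth _ _ _ _

theorem smooth_leviCivita (h : LocalSpin7 U g φ) (p : Fin 8) : MatSmooth U (leviCivita g p) :=
  fun i j => by
    have h_pd := fun p i j => contDiffOn_pd h.isOpen (h.metric_smooth i j) p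
    exact contDiffOn_const.mul (ContDiffOn.sum fun l _ => (h.smooth_invMetricMat j l).mul
      (((h_pd p i l).add (h_pd i p l)).sub (h_pd l p i)))

theorem smooth_nablaMat (h : LocalSpin7 U g φ) (p : Fin 8) : MatSmooth U (nablaMat g φ p) := by
  rw [nablaMat_eq_covDeriv]
  exact h.smooth_formMat.covDeriv h.isOpen h.smooth_leviCivita
    (fun p => (h.smooth_leviCivita p).cubeConn) p

theorem pd_metric_symm (h : LocalSpin7 U g φ) (hu : u ∈ U) (p i j : Fin 8) :
    pd p (g i j) u = pd p (g j i) u :=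
  pd_congr h.isOpen (fun _ hv => (congrFun (congrFun (h.metricMat_transpose hv) i) j).symm) hu p

theorem christoffel_symm (h : LocalSpin7 U g φ) (hu : u ∈ U) (k i j : Fin 8) :
    christoffel g k i j u = christoffel g k j i u := by
  refine congrArg (1 / 2 * ·) (Finset.sum_congr rfl fun l _ => ?_)
  rw [h.pd_metric_symm hu l i j]
  ring

theorem covDeriv_metricMat (h : LocalSpin7 U g φ) (hu : u ∈ U) (p : Fin 8) :
    covDeriv (leviCivita g) (leviCivita g) (metricMat g) p u = 0 := by
  have leviCivita_eq : leviCivita g p u = (Matrix.of fun i l => (1 / 2 : ℝ) *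
      (pd p (g i l) u + pd i (g p l) u - pd l (g p i) u)) * invMetricMat g u := by
    ext i k
    simp only [leviCivita, connMat, christoffel, Matrix.of_apply, Matrix.mul_apply, Finset.mul_sum]
    refine Finset.sum_congr rfl fun l _ => ?_
    have h_symm : invMetric g k l u = invMetricMat g u l k := by
      rw [← Matrix.transpose_apply (invMetricMat g u), h.invMetricMat_transpose hu]; rfl
    rw [h_symm]; ring
  have h_transpose : metricMat g u * (leviCivita g p u)ᵀ =
      (leviCivita g p u * metricMat g u)ᵀ := by
    rw [Matrix.transpose_mul, h.metricMat_transpose hu]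
  rw [covDeriv, h_transpose, leviCivita_eq, Matrix.mul_assoc, h.invMetricMat_mul_metricMat hu,
    Matrix.mul_one]
  ext i j
  simp only [pdMat_apply, metricMat, Matrix.of_apply, Matrix.sub_apply, Matrix.transpose_apply,
    Matrix.zero_apply, h.pd_metric_symm hu p j i]
  ring

theorem covDeriv_invMetricMat (h : LocalSpin7 U g φ) (hu : u ∈ U) (p : Fin 8) :
    covDeriv (dualConn (leviCivita g)) (dualConn (leviCivita g)) (invMetricMat g) p u = 0 := by
  have h_one : covDeriv (dualConn (leviCivita g)) (leviCivita g)
      (fun v => invMetricMat g v * metricMat g v) p u = 0 := by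
    rw [covDeriv_congr h.isOpen hu (Y := fun _ => 1) fun v hv => h.invMetricMat_mul_metricMat hv]
    conv_lhs => rw [← dualConn_dualConn (B := leviCivita g), dualConn_dualConn]
    exact covDeriv_const_eq_zero (Commute.one_left _)
  rw [covDeriv_mul dualConn_dualConn.symm h.isOpen hu h.smooth_invMetricMat h.smooth_metricMat,
    h.covDeriv_metricMat hu, Matrix.mul_zero, add_zero] at h_one
  have h_cancel := congrArg (· * invMetricMat g u) h_one
  simpa only [Matrix.mul_assoc, h.metricMat_mul_invMetricMat hu, Matrix.mul_one,
    Matrix.zero_mul] using h_cancel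

theorem covDeriv_cube_invMetricMat (h : LocalSpin7 U g φ) (hu : u ∈ U) (p : Fin 8) :
    covDeriv (dualConn (cubeConn (leviCivita g))) (dualConn (cubeConn (leviCivita g)))
      (fun v => cube (invMetricMat g v)) p u = 0 := by
  rw [dualConn_cubeConn]
  exact covDeriv_cube_eq_zero h.isOpen hu h.smooth_invMetricMat p (h.covDeriv_invMetricMat hu p)

theorem alt₄_nablaForm (h : LocalSpin7 U g φ) (hu : u ∈ U) (p : Fin 8) :
    Alt₄ fun i j k l => nablaForm g φ p i j k l u := by
  have hφ := fun v hv => h.alt₄_form (u := v) hv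
  refine ⟨fun i j k l => ?_, fun i j k l => ?_, fun i j k l => ?_⟩
  · have h_pd := pd_congr h.isOpen (fun v hv => (hφ v hv).swap₁₂ i j k l) hu p
    simp only [nablaForm, h_pd, pd_neg, Finset.sum_add_distrib]
    simp only [(hφ u hu).swap₁₂ j i, (hφ u hu).swap₁₂ j _, (hφ u hu).swap₁₂ _ i,
      mul_neg, Finset.sum_neg_distrib]
    ring
  · have h_pd := pd_congr h.isOpen (fun v hv => (hφ v hv).swap₂₃ i j k l) hu p
    simp only [nablaForm, h_pd, pd_neg, Finset.sum_add_distrib]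
    simp only [(hφ u hu).swap₂₃ _ k j, (hφ u hu).swap₂₃ _ k _, (hφ u hu).swap₂₃ _ _ j,
      mul_neg, Finset.sum_neg_distrib]
    ring
  · have h_pd := pd_congr h.isOpen (fun v hv => (hφ v hv).swap₃₄ i j k l) hu p
    simp only [nablaForm, h_pd, pd_neg, Finset.sum_add_distrib]
    simp only [(hφ u hu).swap₃₄ _ _ l k, (hφ u hu).swap₃₄ _ _ l _, (hφ u hu).swap₃₄ _ _ _ k,
      mul_neg, Finset.sum_neg_distrib]
    ring

end LocalSpin7

theorem cube_mul_kronecker_toMat₂_mul {ι κ : Type*} [Fintype κ] (P : Matrix ι κ ℝ)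
    (Q : Matrix κ κ ℝ) (T : κ → κ → κ → κ → ℝ) :
    cube P * (Q ⊗ₖ toMat₂ T) * cube Pᵀ =
      (P * Q * Pᵀ) ⊗ₖ toMat₂ (changeFrame P T) := by
  rw [cube, cube, ← Matrix.mul_kronecker_mul, ← Matrix.mul_kronecker_mul, toMat₂_changeFrame,
    ← Matrix.kroneckerMap_transpose]

theorem cube_mul_cyclicSum_mul {ι : Type*} [Fintype ι] [DecidableEq ι] (P : Matrix ι ι ℝ)
    (X : Matrix (ι × ι × ι) (ι × ι × ι) ℝ) :
    cube P * (cyclicSum ι * X * cyclicSum ι) * cube Pᵀ =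
      cyclicSum ι * (cube P * X * cube Pᵀ) * cyclicSum ι := by
  simp only [Matrix.mul_assoc, (cyclicSum_commute_cube Pᵀ).eq]
  rw [← Matrix.mul_assoc (cube P), ← (cyclicSum_commute_cube P).eq, Matrix.mul_assoc]

namespace LocalSpin7

variable {U : Set R8} {g : Comp2} {φ : Comp4} {u : R8}

theorem formMat_mul_transpose (h : LocalSpin7 U g φ) (hu : u ∈ U) :
    formMat φ u * cube (invMetricMat g u) * (formMat φ u)ᵀ =
      (42 : ℝ) • metricMat g u := by
  obtain ⟨P, E, -, hEP, hg, hH, hφ⟩ := h.exists_frame hu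
  rw [formMat, hφ, toMat_changeFrame, hH, hg]
  calc P * toMat cayley * cube Pᵀ * cube (Eᵀ * E) *
        (P * toMat cayley * cube Pᵀ)ᵀ
      = P * toMat cayley * (cube ((E * P)ᵀ * (E * P))) * (toMat cayley)ᵀ *
          Pᵀ := by
        simp only [Matrix.transpose_mul, cube_transpose, Matrix.transpose_transpose, cube_mul,
          Matrix.mul_assoc]
    _ = (42 : ℝ) • (P * Pᵀ) := by
        rw [hEP, Matrix.transpose_one, Matrix.mul_one, cube_one, Matrix.mul_one, Matrix.mul_assoc P,
          toMat_cayley_mul_transpose, Matrix.mul_smul, Matrix.mul_one, Matrix.smul_mul]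

theorem transpose_mul_formMat (h : LocalSpin7 U g φ) (hu : u ∈ U) :
    (formMat φ u)ᵀ * invMetricMat g u * formMat φ u =
      antisymmetrizer (Fin 8) * cube (metricMat g u) -
        cyclicSum (Fin 8) * (metricMat g u ⊗ₖ toMat₂ fun i j k l => φ i j k l u) *
          cyclicSum (Fin 8) := by
  obtain ⟨P, E, -, hEP, hg, hH, hφ⟩ := h.exists_frame hu
  rw [formMat, hφ, toMat_changeFrame, hH, hg]
  calc (P * toMat cayley * cube Pᵀ)ᵀ * (Eᵀ * E) *
        (P * toMat cayley * cube Pᵀ)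
      = cube P * ((toMat cayley)ᵀ * ((E * P)ᵀ * (E * P)) * toMat cayley) *
          cube Pᵀ := by
        simp only [Matrix.transpose_mul, cube_transpose, Matrix.transpose_transpose,
          Matrix.mul_assoc]
    _ = cube P * antisymmetrizer (Fin 8) * cube Pᵀ -
          cube P * (cyclicSum (Fin 8) * ((1 : Matrix (Fin 8) (Fin 8) ℝ) ⊗ₖ toMat₂ cayley) *
            cyclicSum (Fin 8)) * cube Pᵀ := by
        rw [hEP, Matrix.transpose_one, Matrix.mul_one, Matrix.mul_one, transpose_mul_toMat_cayley,
          Matrix.mul_sub, Matrix.sub_mul]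
    _ = _ := by
        rw [cube_mul_cyclicSum_mul, cube_mul_kronecker_toMat₂_mul, Matrix.mul_one,
          ← (antisymmetrizer_commute_cube P).eq, Matrix.mul_assoc, ← cube_mul]

theorem nablaMat_mul_transpose_skew (h : LocalSpin7 U g φ) (hu : u ∈ U) (p : Fin 8) :
    nablaMat g φ p u * cube (invMetricMat g u) * (formMat φ u)ᵀ =
      -(formMat φ u * cube (invMetricMat g u) * (nablaMat g φ p u)ᵀ) := by
  have hL := h.smooth_invMetricMat.cube
  have h_left : covDeriv (leviCivita g) (leviCivita g)
      (fun v => formMat φ v * cube (invMetricMat g v) * (formMat φ v)ᵀ) p u = 0 := by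
    have h_smul := fun v hv => (h.formMat_mul_transpose (u := v) hv).trans
      (smul_one_mul (42 : ℝ) (metricMat g v)).symm
    rw [covDeriv_congr h.isOpen hu h_smul, covDeriv_mul dualConn_dualConn.symm h.isOpen hu
        (.const _) h.smooth_metricMat, h.covDeriv_metricMat hu,
      covDeriv_const_eq_zero ((Commute.one_left _).smul_left _), Matrix.zero_mul, Matrix.mul_zero,
      add_zero]
  rw [covDeriv_mul (B' := cubeConn (leviCivita g)) dualConn_dualConn.symm h.isOpen hu
      (h.smooth_formMat.mul hL) h.smooth_formMat.transpose,
    covDeriv_mul (B := cubeConn (leviCivita g)) rfl h.isOpen hu h.smooth_formMat hL,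
    h.covDeriv_cube_invMetricMat hu, covDeriv_transpose, ← nablaMat_eq_covDeriv, Matrix.mul_zero,
    add_zero] at h_left
  exact eq_neg_of_add_eq_zero_left h_left

theorem transpose_mul_nablaMat (h : LocalSpin7 U g φ) (hu : u ∈ U) (p : Fin 8) :
    (nablaMat g φ p u)ᵀ * invMetricMat g u * formMat φ u +
        (formMat φ u)ᵀ * invMetricMat g u * nablaMat g φ p u =
      -(cyclicSum (Fin 8) *
        (metricMat g u ⊗ₖ toMat₂ fun i j k l => nablaForm g φ p i j k l u) *
          cyclicSum (Fin 8)) := by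
  set Γ := leviCivita g
  have hH := h.smooth_invMetricMat
  have hG := h.smooth_metricMat
  have hM := h.smooth_formMat
  have hφ : MatSmooth U fun v => toMat₂ fun i j k l => φ i j k l v :=
    fun _ _ => h.form_smooth _ _ _ _
  have h_kronecker := hG.kronecker hφ
  have h_left : covDeriv (cubeConn Γ) (cubeConn Γ)
      (fun v => (formMat φ v)ᵀ * invMetricMat g v * formMat φ v) p u =
      (nablaMat g φ p u)ᵀ * invMetricMat g u * formMat φ u +
        (formMat φ u)ᵀ * invMetricMat g u * nablaMat g φ p u := by
    rw [covDeriv_mul (B' := Γ) dualConn_dualConn.symm h.isOpen hu (hM.transpose.mul hH) hM,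
      covDeriv_mul (B := Γ) rfl h.isOpen hu hM.transpose hH, h.covDeriv_invMetricMat hu,
      covDeriv_transpose, ← nablaMat_eq_covDeriv, Matrix.mul_zero, add_zero]
  have h_antisymmetrizer : covDeriv (cubeConn Γ) (cubeConn Γ)
      (fun v => antisymmetrizer (Fin 8) * cube (metricMat g v)) p u = 0 := by
    rw [covDeriv_mul dualConn_dualConn.symm h.isOpen hu (.const _) hG.cube,
      covDeriv_cube_eq_zero h.isOpen hu hG p (h.covDeriv_metricMat hu p),
      covDeriv_const_eq_zero (antisymmetrizer_commute_cubeConn p), Matrix.zero_mul, Matrix.mul_zero,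
      add_zero]
  have h_cyclicSum : covDeriv (cubeConn Γ) (cubeConn Γ) (fun v => cyclicSum (Fin 8) *
        (metricMat g v ⊗ₖ toMat₂ fun i j k l => φ i j k l v) * cyclicSum (Fin 8)) p u =
      cyclicSum (Fin 8) * (metricMat g u ⊗ₖ toMat₂ fun i j k l => nablaForm g φ p i j k l u) *
        cyclicSum (Fin 8) := by
    rw [covDeriv_cyclicSum_mul_mul_cyclicSum h.isOpen hu h_kronecker, cubeConn_eq_tensorConn,
      covDeriv_kronecker h.isOpen hu hG hφ, h.covDeriv_metricMat hu, ← toMat₂_nablaForm,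
      Matrix.zero_kronecker, zero_add]
  rw [← h_left, covDeriv_congr h.isOpen hu fun v hv => h.transpose_mul_formMat hv,
    covDeriv_sub h.isOpen hu ((MatSmooth.const _).mul hG.cube)
      (((MatSmooth.const _).mul h_kronecker).mul (.const _)), h_antisymmetrizer, h_cyclicSum,
    zero_sub]

end LocalSpin7

section FrameDeriv

/-- The components of a covariant 5-tensor in another frame: every index is contracted with the
matrix `E`. -/
def frameDeriv (E : Matrix (Fin 8) (Fin 8) ℝ) (D : Fin 8 → Fin 8 → Fin 8 → Fin 8 → Fin 8 → ℝ)
    (q i j k l : Fin 8) : ℝ := ∑ p, E q p * changeFrame E (D p) i j k l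

variable {E : Matrix (Fin 8) (Fin 8) ℝ} {D : Fin 8 → Fin 8 → Fin 8 → Fin 8 → Fin 8 → ℝ}

theorem toMat_sum_mul {ι : Type*} [Fintype ι] (c : ι → ℝ)
    (D : ι → Fin 8 → Fin 8 → Fin 8 → Fin 8 → ℝ) :
    toMat (fun i j k l => ∑ p, c p * D p i j k l) = ∑ p, c p • toMat (D p) := by
  ext i J
  simp only [toMat_apply, Matrix.sum_apply, Matrix.smul_apply, smul_eq_mul]

theorem toMat₂_sum_mul {ι : Type*} [Fintype ι] (c : ι → ℝ)
    (D : ι → Fin 8 → Fin 8 → Fin 8 → Fin 8 → ℝ) :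
    toMat₂ (fun i j k l => ∑ p, c p * D p i j k l) = ∑ p, c p • toMat₂ (D p) := by
  ext I J
  simp only [toMat₂_apply, Matrix.sum_apply, Matrix.smul_apply, smul_eq_mul]

theorem toMat_frameDeriv (q : Fin 8) : toMat (frameDeriv E D q) =
    ∑ p, E q p • (E * toMat (D p) * cube Eᵀ) := by
  simp only [← toMat_changeFrame, ← toMat_sum_mul]; rfl

theorem IsFirstVariation.sum_mul {ι : Type*} [Fintype ι]
    {D : ι → Fin 8 → Fin 8 → Fin 8 → Fin 8 → ℝ} (h : ∀ p, IsFirstVariation (D p)) (c : ι → ℝ) :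
    IsFirstVariation fun i j k l => ∑ p, c p * D p i j k l where
  alt₄ :=
    { swap₁₂ := fun i j k l => by simp only [(h _).alt₄.swap₁₂ i j, mul_neg, Finset.sum_neg_distrib]
      swap₂₃ := fun i j k l => by simp only [(h _).alt₄.swap₂₃ i j, mul_neg, Finset.sum_neg_distrib]
      swap₃₄ := fun i j k l => by simp only [(h _).alt₄.swap₃₄ i j k, mul_neg,
        Finset.sum_neg_distrib] }
  gram := by
    have kronecker_sum : (1 : Matrix (Fin 8) (Fin 8) ℝ) ⊗ₖ (∑ p, c p • toMat₂ (D p)) =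
        ∑ p, c p • ((1 : Matrix (Fin 8) (Fin 8) ℝ) ⊗ₖ toMat₂ (D p)) := by
      ext i j
      simp only [Matrix.kroneckerMap_apply, Matrix.sum_apply, Matrix.smul_apply, smul_eq_mul,
        Finset.mul_sum, mul_left_comm]
    rw [toMat_sum_mul, toMat₂_sum_mul, kronecker_sum]
    simp only [Matrix.transpose_sum, Matrix.transpose_smul, Matrix.sum_mul, Matrix.mul_sum,
      Matrix.smul_mul, Matrix.mul_smul, ← Finset.sum_add_distrib, ← smul_add, (h _).gram, smul_neg,
      Finset.sum_neg_distrib]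

theorem sum_transpose_mul_mul_apply (E : Matrix (Fin 8) (Fin 8) ℝ)
    (K : Fin 8 → Fin 8 → Matrix (Fin 8) (Fin 8) ℝ) :
    ∑ p, ∑ a, (Eᵀ * K p a * E) p a =
      ∑ q, ∑ b, (∑ p, ∑ a, (E q p * E b a) • K p a) q b := by
  simp only [Matrix.mul_apply, Matrix.sum_apply, Matrix.smul_apply, smul_eq_mul,
    Matrix.transpose_apply, Finset.sum_mul]
  calc ∑ p, ∑ a, ∑ b, ∑ q, E q p * K p a q b * E b a
      = ∑ q, ∑ b, ∑ p, ∑ a, E q p * K p a q b * E b a := by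
        rw [Finset.sum_congr rfl fun p _ => Finset.sum_congr rfl fun a _ => Finset.sum_comm,
          Finset.sum_congr rfl fun p _ => Finset.sum_comm, Finset.sum_comm]
        refine Finset.sum_congr rfl fun q _ => ?_
        rw [Finset.sum_congr rfl fun p _ => Finset.sum_comm, Finset.sum_comm]
    _ = _ := Finset.sum_congr rfl fun q _ => Finset.sum_congr rfl fun b _ =>
        Finset.sum_congr rfl fun p _ => Finset.sum_congr rfl fun a _ => by ring

theorem toMat_frameDeriv_mul_transpose (q b : Fin 8) :
    toMat (frameDeriv E D q) * (toMat (frameDeriv E D b))ᵀ =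
      ∑ p, ∑ a, (E q p * E b a) •
        (E * toMat (D p) * cube (Eᵀ * E) * (toMat (D a))ᵀ * Eᵀ) := by
  simp only [toMat_frameDeriv, Matrix.transpose_sum, Matrix.sum_mul, Matrix.mul_sum,
    Matrix.transpose_smul, Matrix.smul_mul, Matrix.mul_smul, Finset.smul_sum, smul_smul,
    Matrix.transpose_mul, cube_transpose, Matrix.transpose_transpose, cube_mul, Matrix.mul_assoc]
  refine Finset.sum_comm.trans (Finset.sum_congr rfl fun p _ => Finset.sum_congr rfl fun a _ => ?_)
  rw [mul_comm]

theorem sum_frameDeriv_mul_transpose :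
    ∑ q, ∑ b, (toMat (frameDeriv E D q) * (toMat (frameDeriv E D b))ᵀ) q b =
      ∑ p, ∑ a, (Eᵀ * E * toMat (D p) * cube (Eᵀ * E) *
        (toMat (D a))ᵀ * (Eᵀ * E)) p a := by
  simp only [toMat_frameDeriv_mul_transpose, ← sum_transpose_mul_mul_apply, Matrix.mul_assoc]

theorem sum_frameDeriv_mul_transpose_swap :
    ∑ q, ∑ b, (toMat (frameDeriv E D b) * (toMat (frameDeriv E D q))ᵀ) q b =
      ∑ p, ∑ a, (Eᵀ * E * toMat (D p) * cube (Eᵀ * E) *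
        (toMat (D a))ᵀ * (Eᵀ * E)) a p := by
  have h_transpose : ∀ q b, toMat (frameDeriv E D b) * (toMat (frameDeriv E D q))ᵀ =
      ∑ p, ∑ a, (E q p * E b a) • (E * toMat (D p) * cube (Eᵀ * E) *
        (toMat (D a))ᵀ * Eᵀ)ᵀ := fun q b => by
    rw [← Matrix.transpose_transpose (toMat (frameDeriv E D b)), ← Matrix.transpose_mul,
      toMat_frameDeriv_mul_transpose]
    simp only [Matrix.transpose_sum, Matrix.transpose_smul]
  simp only [h_transpose, ← sum_transpose_mul_mul_apply]
  refine Finset.sum_congr rfl fun p _ => Finset.sum_congr rfl fun a _ => ?_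
  rw [← Matrix.transpose_apply (_ * _) p a]
  simp only [Matrix.transpose_mul, Matrix.transpose_transpose, Matrix.mul_assoc]

theorem sum_frameDeriv_mul_transpose_changeFrame (T : Fin 8 → Fin 8 → Fin 8 → Fin 8 → ℝ)
    (a : Fin 8) :
    ∑ q, (toMat (frameDeriv E D q) * (toMat (changeFrame E T))ᵀ) q a =
      ∑ b, (∑ p, (Eᵀ * E * toMat (D p) * cube (Eᵀ * E) *
        (toMat T)ᵀ) p b) * E a b := by
  calc ∑ q, (toMat (frameDeriv E D q) * (toMat (changeFrame E T))ᵀ) q a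
      = ∑ q, ∑ p, E q p * (E * toMat (D p) * cube (Eᵀ * E) * (toMat T)ᵀ *
          Eᵀ) q a := by
        simp only [toMat_frameDeriv, toMat_changeFrame, Matrix.sum_mul, Matrix.smul_mul,
          Matrix.transpose_mul, cube_transpose, Matrix.transpose_transpose, cube_mul,
          Matrix.mul_assoc, Matrix.sum_apply, Matrix.smul_apply, smul_eq_mul]
    _ = ∑ p, (Eᵀ * (E * toMat (D p) * cube (Eᵀ * E) * (toMat T)ᵀ *
          Eᵀ)) p a := by
        rw [Finset.sum_comm]
        exact Finset.sum_congr rfl fun p _ => (Matrix.mul_apply (M := Eᵀ)).symm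
    _ = _ := by
        simp only [← Matrix.mul_assoc, Finset.sum_mul]
        exact (Finset.sum_congr rfl fun p _ => Matrix.mul_apply ..).trans Finset.sum_comm

theorem toMat_eq_zero_of_frameDeriv {P : Matrix (Fin 8) (Fin 8) ℝ} (hPE : P * E = 1)
    (h : ∀ q, toMat (frameDeriv E D q) = 0) (p : Fin 8) : toMat (D p) = 0 := by
  have hsum : ∑ q, P p q • toMat (frameDeriv E D q) = E * toMat (D p) * cube Eᵀ := by
    simp only [toMat_frameDeriv, Finset.smul_sum, smul_smul]
    rw [Finset.sum_comm]
    simp only [← Finset.sum_smul, ← Matrix.mul_apply, hPE, Matrix.one_apply, ite_smul, one_smul,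
      zero_smul, Finset.sum_ite_eq, Finset.mem_univ, if_true]
  calc toMat (D p) = P * (E * toMat (D p) * cube Eᵀ) * cube Pᵀ := by
        rw [← Matrix.mul_assoc, ← Matrix.mul_assoc, hPE, Matrix.one_mul, Matrix.mul_assoc,
          ← cube_mul, ← Matrix.transpose_mul, hPE, Matrix.transpose_one, cube_one, Matrix.mul_one]
    _ = 0 := by simp only [← hsum, h, smul_zero, Finset.sum_const_zero, Matrix.mul_zero,
        Matrix.zero_mul]

end FrameDeriv

/-- The components of the codifferential of a 4-form, as a vector. -/
def codiffVec (g : Comp2) (φ : Comp4) (u : R8) (J : Fin 8 × Fin 8 × Fin 8) : ℝ :=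
  codiff g φ J.1 J.2.1 J.2.2 u

/-- The squared norm `|δφ|²` of the codifferential, summed over all ordered triples of indices. -/
def codiffSq (g : Comp2) (φ : Comp4) (u : R8) : ℝ :=
  codiffVec g φ u ᵥ* cube (invMetricMat g u) ⬝ᵥ codiffVec g φ u

theorem codiffVec_vecMul {n : Type*} (g : Comp2) (φ : Comp4) (u : R8)
    (X : Matrix (Fin 8 × Fin 8 × Fin 8) n ℝ) (b : n) :
    (codiffVec g φ u ᵥ* X) b = -∑ p, (invMetricMat g u * nablaMat g φ p u * X) p b := by
  simp only [Matrix.vecMul, dotProduct, codiffVec, codiff_eq, neg_mul, Finset.sum_mul,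
    Finset.sum_neg_distrib]
  rw [Finset.sum_comm]
  exact congrArg Neg.neg (Finset.sum_congr rfl fun p _ => (Matrix.mul_apply (N := X)).symm)

namespace LocalSpin7

variable {U : Set R8} {g : Comp2} {φ : Comp4} {u : R8}

theorem sum_nablaMat_mul_nablaMat (h : LocalSpin7 U g φ) (hu : u ∈ U)
    (X : Matrix (Fin 8 × Fin 8 × Fin 8) (Fin 8 × Fin 8 × Fin 8) ℝ) :
    ∑ p, ∑ a, (invMetricMat g u * nablaMat g φ p u * X * (nablaMat g φ a u)ᵀ * invMetricMat g u)
      p a = codiffVec g φ u ᵥ* X ⬝ᵥ codiffVec g φ u := by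
  have h_apply : ∀ p a, (invMetricMat g u * nablaMat g φ p u * X * (nablaMat g φ a u)ᵀ *
      invMetricMat g u) p a = ∑ J, (invMetricMat g u * nablaMat g φ p u * X) p J *
        (invMetricMat g u * nablaMat g φ a u) a J := fun p a => by
    rw [Matrix.mul_assoc _ (nablaMat g φ a u)ᵀ, ← h.invMetricMat_transpose hu,
      ← Matrix.transpose_mul, h.invMetricMat_transpose hu]
    rfl
  simp only [h_apply, dotProduct, codiffVec_vecMul]
  rw [Finset.sum_congr rfl fun p _ => Finset.sum_comm, Finset.sum_comm]
  refine Finset.sum_congr rfl fun J _ => ?_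
  rw [codiffVec, codiff_eq, neg_mul_neg, Finset.sum_mul_sum]

theorem lee_eq (h : LocalSpin7 U g φ) (hu : u ∈ U) (a : Fin 8) :
    lee g φ a u = (1 / 42) * ∑ p, (invMetricMat g u * nablaMat g φ p u *
      (cube (invMetricMat g u) * (formMat φ u)ᵀ)) p a := by
  have form_rotate : ∀ i j k, φ i j k a u = -φ a i j k u := fun i j k => by
    rw [(h.alt₄_form hu).swap₁₂ a i j k, ((h.alt₄_form hu).alt₃ i).rotate a j k, neg_neg]
  rw [← neg_neg (∑ p, _), ← codiffVec_vecMul]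
  simp only [lee, form_rotate, mul_neg, Finset.sum_neg_distrib]
  simp only [Matrix.vecMul, dotProduct, Matrix.mul_apply, Fintype.sum_prod_type, cube_apply,
    Finset.mul_sum, Matrix.transpose_apply, codiffVec, formMat, toMat_apply]
  refine congrArg Neg.neg ?_
  iterate 6 refine Finset.sum_congr rfl fun _ _ => ?_
  rw [mul_comm (codiff ..), ← mul_assoc (invMetricMat ..)]
  simp only [invMetric, invMetricMat, metricMat]
  ring

theorem exists_frameDeriv (h : LocalSpin7 U g φ) (hu : u ∈ U) : ∃ P E : Matrix (Fin 8) (Fin 8) ℝ,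
    P * E = 1 ∧ invMetricMat g u = Eᵀ * E ∧ changeFrame E (fun i j k l => φ i j k l u) = cayley ∧
    ∀ q, IsFirstVariation (frameDeriv E (fun p i j k l => nablaForm g φ p i j k l u) q) := by
  obtain ⟨P, E, hPE, hEP, hg, hH, hφ⟩ := h.exists_frame hu
  have h_form : toMat cayley = E * formMat φ u * cube Eᵀ := by
    rw [formMat, hφ, toMat_changeFrame, Matrix.mul_assoc, Matrix.mul_assoc, ← cube_mul,
      ← Matrix.transpose_mul, hEP, Matrix.transpose_one, cube_one, Matrix.mul_one,
      ← Matrix.mul_assoc, hEP, Matrix.one_mul]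
  refine ⟨P, E, hPE, hH, ?_, fun q => IsFirstVariation.sum_mul (fun p => ⟨?_, ?_⟩) _⟩
  · exact toMat_injective (by rw [toMat_changeFrame, h_form]; rfl)
  · exact (h.alt₄_nablaForm hu p).changeFrame E
  · have h_nabla := congrArg (fun X => cube E * X * cube Eᵀ) (h.transpose_mul_nablaMat hu p)
    have h_metric : E * metricMat g u * Eᵀ = 1 := by
      rw [hg, ← Matrix.mul_assoc, hEP, Matrix.one_mul, ← Matrix.transpose_mul, hEP,
        Matrix.transpose_one]
    simp only [Matrix.mul_neg, Matrix.neg_mul, cube_mul_cyclicSum_mul,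
      cube_mul_kronecker_toMat₂_mul, h_metric] at h_nabla
    rw [← h_nabla, toMat_changeFrame, h_form, hH]
    simp only [Matrix.transpose_mul, cube_transpose, Matrix.transpose_transpose, Matrix.mul_add,
      Matrix.add_mul, Matrix.mul_assoc]
    rfl

theorem sum_nablaMat_mul_transpose_eq_zero (h : LocalSpin7 U g φ) (hu : u ∈ U)
    (hθ : ∀ a, lee g φ a u = 0) (a : Fin 8) :
    ∑ p, (invMetricMat g u * nablaMat g φ p u * (cube (invMetricMat g u) * (formMat φ u)ᵀ)) p a =
      0 := by
  have h_lee := hθ a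
  rw [h.lee_eq hu] at h_lee
  linarith

theorem exists_balanced_frameDeriv (h : LocalSpin7 U g φ) (hu : u ∈ U)
    (hθ : ∀ a, lee g φ a u = 0) : ∃ P E : Matrix (Fin 8) (Fin 8) ℝ,
    P * E = 1 ∧ invMetricMat g u = Eᵀ * E ∧
    (∀ a, ∑ q, (toMat (frameDeriv E (fun p i j k l => nablaForm g φ p i j k l u) q) *
      (toMat cayley)ᵀ) q a = 0) ∧
    ∀ q, IsFirstVariation (frameDeriv E (fun p i j k l => nablaForm g φ p i j k l u) q) := by
  obtain ⟨P, E, hPE, hH, hφ, hD⟩ := h.exists_frameDeriv hu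
  refine ⟨P, E, hPE, hH, fun a => ?_, hD⟩
  rw [← hφ, sum_frameDeriv_mul_transpose_changeFrame, ← hH]
  simp only [Matrix.mul_assoc _ (cube _)]
  exact Finset.sum_eq_zero fun b _ =>
    mul_eq_zero_of_left (h.sum_nablaMat_mul_transpose_eq_zero hu hθ b) _

theorem sum_nablaMat_swap (h : LocalSpin7 U g φ) (hu : u ∈ U) (hθ : ∀ a, lee g φ a u = 0) :
    ∑ p, ∑ a, (invMetricMat g u * nablaMat g φ p u * cube (invMetricMat g u) *
      (nablaMat g φ a u)ᵀ * invMetricMat g u) a p = 3 * codiffSq g φ u := by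
  obtain ⟨_, E, -, hH, hbal, hD⟩ := h.exists_balanced_frameDeriv hu hθ
  have h_swap := sum_mul_transpose_swap_eq hD hbal
  rw [sum_frameDeriv_mul_transpose, sum_frameDeriv_mul_transpose_swap, ← hH] at h_swap
  rw [codiffSq, ← h.sum_nablaMat_mul_nablaMat hu]
  exact h_swap

theorem nablaMat_eq_zero (h : LocalSpin7 U g φ) (hu : u ∈ U) (hθ : ∀ a, lee g φ a u = 0)
    (hzero : codiffSq g φ u = 0) (p : Fin 8) : nablaMat g φ p u = 0 := by
  obtain ⟨P, E, hPE, hH, hbal, hD⟩ := h.exists_balanced_frameDeriv hu hθ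
  refine toMat_eq_zero_of_frameDeriv hPE (eq_zero_of_sum_mul_transpose hD hbal ?_) p
  rw [codiffSq, ← h.sum_nablaMat_mul_nablaMat hu] at hzero
  rw [sum_frameDeriv_mul_transpose, ← hH]
  exact hzero

end LocalSpin7

/-! ### The scalar curvature of the Levi-Civita connection -/

section CurvatureContraction

variable {F : Fin 8 → Fin 8 → Matrix (Fin 8) (Fin 8) ℝ}

theorem derivCube_add {m : Type*} [DecidableEq m] (F G : Matrix m m ℝ) :
    derivCube (F + G) = derivCube F + derivCube G := by
  simp only [derivCube, Matrix.add_kronecker, Matrix.kronecker_add]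
  abel

theorem derivCube_smul {m : Type*} [DecidableEq m] (c : ℝ) (F : Matrix m m ℝ) :
    derivCube (c • F) = c • derivCube F := by
  simp only [derivCube, Matrix.smul_kronecker, Matrix.kronecker_smul, ← smul_add]

theorem cube_mul_derivCube_mul {m : Type*} [Fintype m] [DecidableEq m] {E P : Matrix m m ℝ}
    (hEP : E * P = 1) (F : Matrix m m ℝ) :
    cube E * derivCube F * cube P = derivCube (E * F * P) := by
  simp only [cube, derivCube, Matrix.mul_add, Matrix.add_mul, Matrix.kronecker_add,
    ← Matrix.mul_kronecker_mul, Matrix.mul_one, hEP, Matrix.one_kronecker_one]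

theorem cayley_mul_derivCube_mul_transpose (F : Matrix (Fin 8) (Fin 8) ℝ) (p a : Fin 8) :
    (toMat cayley * derivCube F * (toMat cayley)ᵀ) p a =
      3 * ∑ i, ∑ s, F i s * ∑ j, ∑ k, cayley p i j k * cayley a s j k := by
  have h₂ : ∑ i, ∑ j, ∑ k, ∑ s, cayley p i j k * F j s * cayley a i s k =
      ∑ i, ∑ j, ∑ k, ∑ s, cayley p i j k * F i s * cayley a s j k := by
    rw [Finset.sum_comm]
    refine Finset.sum_congr rfl fun i _ => Finset.sum_congr rfl fun j _ =>
      Finset.sum_congr rfl fun k _ => Finset.sum_congr rfl fun s _ => ?_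
    rw [alt₄_cayley.swap₂₃ p j i k, alt₄_cayley.swap₂₃ a j s k]
    ring
  have h₃ : ∑ i, ∑ j, ∑ k, ∑ s, cayley p i j k * F k s * cayley a i j s =
      ∑ i, ∑ j, ∑ k, ∑ s, cayley p i j k * F j s * cayley a i s k := by
    refine Finset.sum_congr rfl fun i _ => Finset.sum_comm.trans ?_
    refine Finset.sum_congr rfl fun j _ => Finset.sum_congr rfl fun k _ =>
      Finset.sum_congr rfl fun s _ => ?_
    rw [alt₄_cayley.swap₃₄ p i k j, alt₄_cayley.swap₃₄ a i k s]
    ring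
  have h_reorder : ∑ i, ∑ j, ∑ k, ∑ s, cayley p i j k * F i s * cayley a s j k =
      ∑ i, ∑ s, F i s * ∑ j, ∑ k, cayley p i j k * cayley a s j k := by
    refine Finset.sum_congr rfl fun i _ => ?_
    simp only [Finset.mul_sum]
    calc _ = ∑ j, ∑ s, ∑ k, cayley p i j k * F i s * cayley a s j k :=
          Finset.sum_congr rfl fun j _ => Finset.sum_comm
      _ = _ := Finset.sum_comm.trans <| Finset.sum_congr rfl fun s _ =>
          Finset.sum_congr rfl fun j _ => Finset.sum_congr rfl fun k _ => by ring
  have h_expand : (toMat cayley * (derivCube F * (toMat cayley)ᵀ)) p a =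
      ∑ i, ∑ j, ∑ k, ∑ s, cayley p i j k * F i s * cayley a s j k +
        ∑ i, ∑ j, ∑ k, ∑ s, cayley p i j k * F j s * cayley a i s k +
        ∑ i, ∑ j, ∑ k, ∑ s, cayley p i j k * F k s * cayley a i j s := by
    simp only [Matrix.mul_apply, Matrix.transpose_apply, toMat_apply, derivCube_apply,
      Fintype.sum_prod_type, Matrix.one_apply, add_mul, mul_add, Finset.sum_add_distrib, mul_ite,
      ite_mul, mul_one, one_mul, mul_zero, zero_mul, Finset.sum_ite_eq, Finset.mem_univ, if_true,
      Finset.sum_const_zero, Finset.sum_ite_irrel, Finset.mul_sum, ← mul_assoc]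
  rw [Matrix.mul_assoc, h_expand, h₃, h₂, h_reorder]
  ring

/-- The contraction with two copies of the model form, one of which an endomorphism acts on. -/
def curvContraction : Matrix (Fin 8) (Fin 8) ℝ →ₗ[ℝ] Matrix (Fin 8) (Fin 8) ℝ where
  toFun F := toMat cayley * (F * toMat cayley + toMat cayley * (derivCube F)ᵀ)ᵀ
  map_add' F G := by
    simp only [derivCube_add, Matrix.transpose_add, Matrix.add_mul, Matrix.mul_add]
    abel
  map_smul' c F := by
    simp only [derivCube_smul, Matrix.transpose_smul, Matrix.transpose_add, Matrix.smul_mul,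
      Matrix.mul_smul, ← smul_add, RingHom.id_apply]

theorem curvContraction_eq (F : Matrix (Fin 8) (Fin 8) ℝ) : curvContraction F =
    toMat cayley * (F * toMat cayley + toMat cayley * (derivCube F)ᵀ)ᵀ := rfl

theorem curvContraction_apply (F : Matrix (Fin 8) (Fin 8) ℝ) (p a : Fin 8) :
    curvContraction F p a = 24 * F a p + 18 * F.trace * (1 : Matrix (Fin 8) (Fin 8) ℝ) p a -
      12 * ∑ i, ∑ s, F i s * cayley p i a s := by
  rw [curvContraction_eq, Matrix.transpose_add, Matrix.transpose_mul, Matrix.transpose_mul,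
    Matrix.transpose_transpose, Matrix.mul_add, ← Matrix.mul_assoc, ← Matrix.mul_assoc,
    Matrix.add_apply, cayley_mul_derivCube_mul_transpose, toMat_cayley_mul_transpose]
  simp only [sum_sum_cayley_mul, Matrix.trace, Matrix.diag_apply, Matrix.smul_apply,
    Matrix.smul_mul, Matrix.one_apply, Matrix.transpose_apply, smul_eq_mul, mul_sub,
    Finset.sum_sub_distrib, mul_ite, mul_one, one_mul, mul_zero, Finset.sum_ite_eq,
    Finset.sum_ite_eq', Finset.sum_ite_irrel, Finset.sum_const_zero, Finset.mem_univ, if_true]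
  simp only [mul_left_comm _ (4 : ℝ), ← Finset.mul_sum, ← Finset.sum_mul]
  split_ifs <;> ring

theorem sum_sum_sum_rotate {ι : Type*} [Fintype ι] (f : ι → ι → ι → ℝ) :
    ∑ p, ∑ a, ∑ i, f p a i = ∑ p, ∑ a, ∑ i, f i p a :=
  Finset.sum_comm_cycle.trans Finset.sum_comm_cycle

theorem sum_mul_eq_zero_of_bianchi {T : Fin 8 → Fin 8 → Fin 8 → Fin 8 → ℝ} (hT : Alt₄ T)
    (hbianchi : ∀ p a i s, F p a i s + F a i p s + F i p a s = 0) :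
    ∑ p, ∑ a, ∑ i, ∑ s, F p a i s * T p i a s = 0 := by
  have h_cyc : ∑ p, ∑ a, ∑ i, ∑ s, F i p a s * T p i a s =
      ∑ p, ∑ a, ∑ i, ∑ s, F p a i s * T p i a s := by
    rw [sum_sum_sum_rotate fun p a i => ∑ s, F p a i s * T p i a s]
    simp only [fun p a i s => (hT.alt₃' s).rotate p i a]
  have h_cyc' : ∑ p, ∑ a, ∑ i, ∑ s, F a i p s * T p i a s =
      ∑ p, ∑ a, ∑ i, ∑ s, F i p a s * T p i a s := by
    rw [sum_sum_sum_rotate fun p a i => ∑ s, F i p a s * T p i a s]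
    simp only [fun p a i s => (hT.alt₃' s).rotate p i a]
  have h_zero : ∑ p, ∑ a, ∑ i, ∑ s, (F p a i s + F a i p s + F i p a s) * T p i a s = 0 := by
    simp only [hbianchi, zero_mul, Finset.sum_const_zero]
  simp only [add_mul, Finset.sum_add_distrib] at h_zero
  linarith

theorem sum_curvContraction (hanti : ∀ p a, F p a = -F a p)
    (hbianchi : ∀ p a i s, F p a i s + F a i p s + F i p a s = 0) :
    ∑ p, ∑ a, curvContraction (F p a) p a = 24 * ∑ p, ∑ a, F p a a p := by
  have h_diag : ∀ p, F p p = 0 := fun p => by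
    ext i j
    exact self_eq_neg.1 (congrFun₂ (hanti p p) i j)
  have h_trace : ∀ p, ∑ a, 18 * (F p a).trace * (1 : Matrix (Fin 8) (Fin 8) ℝ) p a = 0 := by
    intro p
    simp only [Matrix.one_apply, mul_ite, mul_one, mul_zero, Finset.sum_ite_eq, Finset.mem_univ,
      if_true, h_diag, Matrix.trace_zero]
  simp only [curvContraction_apply, Finset.sum_sub_distrib, Finset.sum_add_distrib, h_trace,
    ← Finset.mul_sum, sum_mul_eq_zero_of_bianchi alt₄_cayley hbianchi,
    mul_zero, add_zero, sub_zero]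

end CurvatureContraction

section Curvature

theorem curvMat_cubeConn {m : Type*} [Fintype m] [DecidableEq m] {U : Set R8} {u : R8}
    {A : Fin 8 → R8 → Matrix m m ℝ} (hU : IsOpen U) (hu : u ∈ U) (hA : ∀ p, MatSmooth U (A p))
    (p a : Fin 8) : curvMat (cubeConn A) p a u = derivCube (curvMat A p a u) := by
  rw [cubeConn_eq_tensorConn, curvMat_tensorConn hU hu hA fun p => (hA p).tensorConn (hA p),
    curvMat_tensorConn hU hu hA hA, derivCube]

theorem curvature_swap (A : Comp3) (s p a i : Fin 8) (u : R8) :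
    curvature A s p a i u = -curvature A s a p i u := by
  simp only [curvature, Finset.sum_sub_distrib]
  ring

theorem curvature_cyclic {A : Comp3} {U : Set R8} {u : R8} (hU : IsOpen U) (hu : u ∈ U)
    (hsymm : ∀ v ∈ U, ∀ k i j, A k i j v = A k j i v) (s p a i : Fin 8) :
    curvature A s p a i u + curvature A s a i p u + curvature A s i p a u = 0 := by
  have h_pd : ∀ q i j, pd q (A s i j) u = pd q (A s j i) u := fun q i j =>
    pd_congr hU (fun v hv => hsymm v hv s i j) hu q
  simp only [curvature, Finset.sum_sub_distrib, h_pd a i p, h_pd i p a, h_pd p a i,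
    hsymm u hu _ a i, hsymm u hu _ i p, hsymm u hu _ p a]
  ring

theorem mul_cube_mul_transpose_eq_curvContraction {E P : Matrix (Fin 8) (Fin 8) ℝ}
    (hEP : E * P = 1) {M : Matrix (Fin 8) (Fin 8 × Fin 8 × Fin 8) ℝ}
    (hM : M = P * toMat cayley * cube Pᵀ) (F : Matrix (Fin 8) (Fin 8) ℝ) :
    E * M * cube (Eᵀ * E) * (F * M + M * (derivCube F)ᵀ)ᵀ * Eᵀ = curvContraction (E * F * P) := by
  have h_cube : cube Pᵀ * cube Eᵀ = 1 := by
    rw [← cube_mul, ← Matrix.transpose_mul, hEP, Matrix.transpose_one, cube_one]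
  have h_left : E * M * cube (Eᵀ * E) = toMat cayley * cube E := by
    rw [hM, cube_mul, ← Matrix.mul_assoc, ← Matrix.mul_assoc, ← Matrix.mul_assoc, hEP,
      Matrix.one_mul, Matrix.mul_assoc (toMat cayley), h_cube, Matrix.mul_one]
  have h_right : E * (F * M + M * (derivCube F)ᵀ) * cube Eᵀ =
      E * F * P * toMat cayley + toMat cayley * (derivCube (E * F * P))ᵀ := by
    rw [← cube_mul_derivCube_mul hEP, hM, Matrix.transpose_mul, Matrix.transpose_mul,
      cube_transpose, cube_transpose]
    simp only [Matrix.mul_add, Matrix.add_mul, Matrix.mul_assoc, h_cube, Matrix.mul_one]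
    rw [← Matrix.mul_assoc E P, hEP, Matrix.one_mul]
  rw [h_left, curvContraction_eq, ← h_right]
  simp only [Matrix.transpose_mul, cube_transpose, Matrix.transpose_transpose, Matrix.mul_assoc]

/-- A 2-form with values in endomorphisms of covectors in another frame: `E` is the change of
frame and `P` its inverse. -/
def curvFrame (E P : Matrix (Fin 8) (Fin 8) ℝ) (F : Fin 8 → Fin 8 → Matrix (Fin 8) (Fin 8) ℝ)
    (q b : Fin 8) : Matrix (Fin 8) (Fin 8) ℝ := ∑ p, ∑ a, (E q p * E b a) • (E * F p a * P)

variable {E P : Matrix (Fin 8) (Fin 8) ℝ} {F : Fin 8 → Fin 8 → Matrix (Fin 8) (Fin 8) ℝ}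

theorem curvFrame_swap (hanti : ∀ p a, F p a = -F a p) (q b : Fin 8) :
    curvFrame E P F q b = -curvFrame E P F b q := by
  simp only [curvFrame, ← Finset.sum_neg_distrib]
  rw [Finset.sum_comm]
  refine Finset.sum_congr rfl fun a _ => Finset.sum_congr rfl fun p _ => ?_
  rw [hanti p a, mul_comm (E q p), Matrix.mul_neg, Matrix.neg_mul, smul_neg]

theorem curvFrame_cyclic (hbianchi : ∀ p a i s, F p a i s + F a i p s + F i p a s = 0)
    (q b i s : Fin 8) :
    curvFrame E P F q b i s + curvFrame E P F b i q s + curvFrame E P F i q b s = 0 := by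
  have h_apply : ∀ q b i, curvFrame E P F q b i s =
      ∑ p, ∑ a, ∑ x, E q p * E b a * E i x * (F p a * P) x s := fun q b i => by
    simp only [curvFrame, Matrix.mul_assoc E, Matrix.sum_apply, Matrix.smul_apply, smul_eq_mul,
      Matrix.mul_apply (M := E), Finset.mul_sum, mul_assoc]
  have h_rotate : curvFrame E P F i q b s =
      ∑ p, ∑ a, ∑ x, E q p * E b a * E i x * (F x p * P) a s := by
    rw [h_apply, sum_sum_sum_rotate]
    simp only [mul_left_comm, mul_comm]
  have h_rotate' : curvFrame E P F b i q s =
      ∑ p, ∑ a, ∑ x, E q p * E b a * E i x * (F a x * P) p s := by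
    rw [h_apply, sum_sum_sum_rotate fun p a x => E q p * E b a * E i x * (F a x * P) p s]
    simp only [mul_left_comm, mul_comm]
  have h_cyc : ∀ p a x, (F p a * P) x s + (F a x * P) p s + (F x p * P) a s = 0 := by
    intro p a x
    simp only [Matrix.mul_apply, ← Finset.sum_add_distrib, ← add_mul, hbianchi, zero_mul,
      Finset.sum_const_zero]
  simp only [h_apply q, h_rotate, h_rotate', ← Finset.sum_add_distrib, ← mul_add, h_cyc, mul_zero,
    Finset.sum_const_zero]

theorem sum_mul_cube_mul_transpose_of_bianchi (hPE : P * E = 1) (hEP : E * P = 1)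
    {M : Matrix (Fin 8) (Fin 8 × Fin 8 × Fin 8) ℝ} (hM : M = P * toMat cayley * cube Pᵀ)
    (hanti : ∀ p a, F p a = -F a p)
    (hbianchi : ∀ p a i s, F p a i s + F a i p s + F i p a s = 0) :
    ∑ p, ∑ a, (Eᵀ * E * M * cube (Eᵀ * E) * (F p a * M + M * (derivCube (F p a))ᵀ)ᵀ * (Eᵀ * E)) p a
      = 24 * ∑ p, ∑ a, ((F p a)ᵀ * (Eᵀ * E)) p a := by
  have h_conj : ∀ p a, Eᵀ * E * M * cube (Eᵀ * E) * (F p a * M + M * (derivCube (F p a))ᵀ)ᵀ *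
      (Eᵀ * E) = Eᵀ * curvContraction (E * F p a * P) * E := fun p a => by
    rw [← mul_cube_mul_transpose_eq_curvContraction hEP hM]
    simp only [Matrix.mul_assoc]
  have h_transpose : ∀ q b, curvFrame E P F q b b q =
      (∑ p, ∑ a, (E q p * E b a) • (E * F p a * P)ᵀ) q b := fun q b => by
    simp only [curvFrame, ← Matrix.transpose_smul, ← Matrix.transpose_sum, Matrix.transpose_apply]
  have h_ricci : ∑ q, ∑ b, curvFrame E P F q b b q = ∑ p, ∑ a, ((F p a)ᵀ * (Eᵀ * E)) p a := by
    simp only [h_transpose, ← sum_transpose_mul_mul_apply]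
    simp only [Matrix.transpose_mul, ← Matrix.mul_assoc]
    simp only [← Matrix.transpose_mul, hPE, Matrix.transpose_one, Matrix.one_mul]
  rw [← h_ricci, ← sum_curvContraction (curvFrame_swap hanti) (curvFrame_cyclic hbianchi)]
  simp only [curvFrame, h_conj, map_sum, map_smul, ← sum_transpose_mul_mul_apply]

end Curvature

theorem scal_eq_sum (g : Comp2) (A : Comp3) (u : R8)
    (hH : (invMetricMat g u)ᵀ = invMetricMat g u) :
    scal g A u = ∑ p, ∑ a, ((curvMat (connMat A) p a u)ᵀ * invMetricMat g u) p a := by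
  have h_symm : ∀ j k, invMetricMat g u k j = invMetric g j k u := fun j k => congrFun₂ hH j k
  simp only [scal, ricci, Finset.mul_sum, Matrix.mul_apply, Matrix.transpose_apply,
    curvMat_connMat, h_symm]
  rw [sum_sum_sum_rotate fun p a s => curvature A p p a s u * invMetric g a s u]
  simp only [mul_comm]

namespace LocalSpin7

variable {U : Set R8} {g : Comp2} {φ : Comp4} {u : R8}

theorem sum_nablaMat_mul_apply_eq_zero (h : LocalSpin7 U g φ) (hu : u ∈ U)
    (hθ : ∀ a, lee g φ a u = 0) (p : Fin 8) :
    ∑ a, (invMetricMat g u * nablaMat g φ a u * cube (invMetricMat g u) * (formMat φ u)ᵀ *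
      invMetricMat g u) a p = 0 := by
  simp only [Matrix.mul_apply (N := invMetricMat g u), Matrix.mul_assoc _ (cube _)]
  rw [Finset.sum_comm]
  refine Finset.sum_eq_zero fun s _ => ?_
  rw [← Finset.sum_mul, h.sum_nablaMat_mul_transpose_eq_zero hu hθ, zero_mul]

theorem sum_mul_transpose_nablaMat_row_eq_zero (h : LocalSpin7 U g φ) (hu : u ∈ U)
    (hθ : ∀ a, lee g φ a u = 0) (p : Fin 8) :
    ∑ a, (invMetricMat g u * formMat φ u * cube (invMetricMat g u) * (nablaMat g φ a u)ᵀ *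
      invMetricMat g u) p a = 0 := by
  rw [← h.sum_nablaMat_mul_apply_eq_zero hu hθ p]
  refine Finset.sum_congr rfl fun a _ => ?_
  rw [← Matrix.transpose_apply (_ * _)]
  simp only [Matrix.transpose_mul, Matrix.transpose_transpose, cube_transpose,
    h.invMetricMat_transpose hu, Matrix.mul_assoc]

theorem sum_mul_transpose_nablaMat_col_eq_zero (h : LocalSpin7 U g φ) (hu : u ∈ U)
    (hθ : ∀ a, lee g φ a u = 0) (p : Fin 8) :
    ∑ a, (invMetricMat g u * formMat φ u * cube (invMetricMat g u) * (nablaMat g φ a u)ᵀ *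
      invMetricMat g u) a p = 0 := by
  rw [← neg_eq_zero, ← h.sum_nablaMat_mul_apply_eq_zero hu hθ p, ← Finset.sum_neg_distrib]
  refine Finset.sum_congr rfl fun a _ => ?_
  rw [Matrix.mul_assoc _ (formMat φ u), Matrix.mul_assoc _ (_ * _),
    ← neg_eq_iff_eq_neg.2 (h.nablaMat_mul_transpose_skew hu a)]
  simp only [Matrix.mul_neg, Matrix.neg_mul, Matrix.neg_apply, neg_neg, Matrix.mul_assoc]

theorem twelve_mul_scal_christoffel (h : LocalSpin7 U g φ) (hu : u ∈ U)
    (hθ : ∀ v ∈ U, ∀ a, lee g φ a v = 0) :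
    12 * scal g (christoffel g) u = -codiffSq g φ u := by
  obtain ⟨P, E, hPE, hEP, -, hH, hφ⟩ := h.exists_frame hu
  have h_form : formMat φ u = P * toMat cayley * cube Pᵀ := by
    rw [formMat, hφ, toMat_changeFrame]
  have h_anti : ∀ p a, curvMat (leviCivita g) p a u = -curvMat (leviCivita g) a p u := by
    intro p a
    ext i s
    rw [Matrix.neg_apply, leviCivita, curvMat_connMat, curvMat_connMat, curvature_swap]
  have h_bianchi : ∀ p a i s, curvMat (leviCivita g) p a u i s + curvMat (leviCivita g) a i u p s +
      curvMat (leviCivita g) i p u a s = 0 := by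
    simp only [leviCivita, curvMat_connMat]
    exact fun p a i s =>
      curvature_cyclic h.isOpen hu (fun v hv k i j => h.christoffel_symm hv k i j) s p a i
  have h_weitzenboeck := sum_covDeriv_mul_covDeriv_sub h.isOpen hu h.smooth_leviCivita
    (fun p => (h.smooth_leviCivita p).cubeConn) h.smooth_invMetricMat h.smooth_invMetricMat.cube
    h.smooth_formMat (fun p i j => h.christoffel_symm hu j p i) (h.covDeriv_invMetricMat hu)
    (h.covDeriv_cube_invMetricMat hu)
    (by
      rw [← nablaMat_eq_covDeriv]
      exact fun v hv => h.sum_mul_transpose_nablaMat_row_eq_zero hv (hθ v hv))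
    (by
      rw [← nablaMat_eq_covDeriv]
      exact fun v hv => h.sum_mul_transpose_nablaMat_col_eq_zero hv (hθ v hv))
  simp only [← nablaMat_eq_covDeriv, h.sum_nablaMat_mul_nablaMat hu,
    h.sum_nablaMat_swap hu (hθ u hu), curvMat_cubeConn h.isOpen hu h.smooth_leviCivita]
    at h_weitzenboeck
  rw [← codiffSq, hH, sum_mul_cube_mul_transpose_of_bianchi hPE hEP h_form h_anti h_bianchi, ← hH,
    leviCivita, ← scal_eq_sum g _ u (h.invMetricMat_transpose hu)] at h_weitzenboeck
  linarith

end LocalSpin7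

/-! ### The torsion of a balanced structure -/

theorem sum_mul_eq_zero_of_antisymm {ι : Type*} [Fintype ι] {X Y : ι → ι → ℝ}
    (hX : ∀ i j, X i j = X j i) (hY : ∀ i j, Y i j = -Y j i) : ∑ i, ∑ j, X i j * Y i j = 0 := by
  refine self_eq_neg.1 (Finset.sum_comm.trans ?_)
  simp only [← Finset.sum_neg_distrib]
  exact Finset.sum_congr rfl fun i _ => Finset.sum_congr rfl fun j _ => by
    rw [hX j i, hY j i, mul_neg]

theorem ricci_add {U : Set R8} {A S : Comp3} {u : R8} (hU : IsOpen U) (hu : u ∈ U)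
    (hA : ∀ k i j, DifferentiableAt ℝ (A k i j) u) (hS : ∀ k i j, DifferentiableAt ℝ (S k i j) u)
    (htrace : ∀ v ∈ U, ∀ k, ∑ i, S i i k v = 0) (j k : Fin 8) :
    ricci (fun k i j v => A k i j v + S k i j v) j k u = ricci A j k u +
      (∑ i, pd i (S i j k) u + ∑ m, S m j k u * ∑ i, A i i m u -
        ∑ i, ∑ m, (S m i k u * A i j m u + A m i k u * S i j m u)) -
      ∑ i, ∑ m, S m i k u * S i j m u := by
  have h_pd_trace : ∑ i, pd j (S i i k) u = 0 := by
    rw [← pd_sum fun i => hS i i k]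
    exact pd_eq_zero hU (fun v hv => htrace v hv k) hu j
  have h_trace : ∑ i, ∑ m, (A m j k u + S m j k u) * S i i m u = 0 := by
    rw [Finset.sum_comm]
    simp only [← Finset.mul_sum, htrace u hu, mul_zero, Finset.sum_const_zero]
  have h_comm : ∑ m, S m j k u * ∑ i, A i i m u = ∑ i, ∑ m, S m j k u * A i i m u := by
    simp only [Finset.mul_sum]
    exact Finset.sum_comm
  rw [h_comm]
  simp only [ricci, curvature, pd_add (hA ..) (hS ..), Finset.sum_add_distrib,
    Finset.sum_sub_distrib, add_mul, mul_add] at h_trace ⊢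
  linarith

theorem scal_add {U : Set R8} {g : Comp2} {A S : Comp3} {u : R8} (hU : IsOpen U) (hu : u ∈ U)
    (hH : (invMetricMat g u)ᵀ = invMetricMat g u)
    (hA : ∀ k i j, DifferentiableAt ℝ (A k i j) u) (hS : ∀ k i j, DifferentiableAt ℝ (S k i j) u)
    (hsymm : ∀ k i j, A k i j u = A k j i u) (hanti : ∀ v ∈ U, ∀ k i j, S k i j v = -S k j i v)
    (htrace : ∀ v ∈ U, ∀ k, ∑ i, S i i k v = 0) :
    scal g (fun k i j v => A k i j v + S k i j v) u = scal g A u -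
      ∑ j, ∑ k, invMetric g j k u * ∑ i, ∑ m, S m i k u * S i j m u := by
  have h_pd : ∀ p k i j, pd p (S k i j) u = -pd p (S k j i) u := fun p k i j => by
    rw [pd_congr hU (fun v hv => hanti v hv k i j) hu, pd_neg]
  have h_cross : ∀ j k, ∑ i, ∑ m, A m i k u * S i j m u = -∑ i, ∑ m, S m i j u * A i k m u := by
    intro j k
    rw [Finset.sum_comm]
    simp only [← Finset.sum_neg_distrib]
    refine Finset.sum_congr rfl fun i _ => Finset.sum_congr rfl fun m _ => ?_
    rw [hanti u hu m j i, hsymm i m k, mul_neg, mul_comm]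
  have h_linear := sum_mul_eq_zero_of_antisymm (X := fun j k => invMetric g j k u)
    (Y := fun j k => ∑ i, pd i (S i j k) u + ∑ m, S m j k u * ∑ i, A i i m u -
        ∑ i, ∑ m, (S m i k u * A i j m u + A m i k u * S i j m u))
    (fun j k => congrFun₂ hH k j) fun j k => by
      simp only [Finset.sum_add_distrib, h_cross, h_pd _ _ j k, hanti u hu _ j k, neg_mul,
        Finset.sum_neg_distrib]
      ring
  simp only [scal, ricci_add hU hu hA hS htrace]
  simp only [mul_sub, mul_add, Finset.sum_add_distrib, Finset.sum_sub_distrib] at h_linear ⊢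
  linarith

theorem torsion_eq_codiff {g : Comp2} {φ : Comp4} {u : R8} (hθ : ∀ a, lee g φ a u = 0)
    (i j k : Fin 8) : torsion g φ i j k u = codiff g φ i j k u := by
  simp only [torsion, hθ, mul_zero, zero_mul, Finset.sum_const_zero, add_zero]

namespace LocalSpin7

variable {U : Set R8} {g : Comp2} {φ : Comp4} {u : R8}

theorem alt₃_codiff (h : LocalSpin7 U g φ) (hu : u ∈ U) :
    Alt₃ fun i j k => codiff g φ i j k u where
  swap₁₂ i j k := by
    simp only [codiff, (h.alt₄_nablaForm hu _).swap₂₃ _ i j k, mul_neg, Finset.sum_neg_distrib]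
  swap₂₃ i j k := by
    simp only [codiff, (h.alt₄_nablaForm hu _).swap₃₄ _ i j k, mul_neg, Finset.sum_neg_distrib]

theorem smooth_codiff (h : LocalSpin7 U g φ) (i j k : Fin 8) :
    ContDiffOn ℝ ∞ (codiff g φ i j k) U :=
  (ContDiffOn.sum fun p _ => ContDiffOn.sum fun q _ =>
    (h.smooth_invMetricMat p q).mul (h.smooth_nablaMat p q (i, j, k))).neg

theorem codiffSq_eq (h : LocalSpin7 U g φ) (hu : u ∈ U) : codiffSq g φ u =
    ∑ j, ∑ k, invMetric g j k u * ∑ i, ∑ m, (∑ l, invMetric g m l u * codiff g φ i k l u) *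
      ∑ l, invMetric g i l u * codiff g φ j m l u := by
  have h_symm : ∀ i j, invMetric g i j u = invMetricMat g u j i := fun i j =>
    congrFun₂ (h.invMetricMat_transpose hu) j i
  have h_reindex : ∀ f : Fin 8 → Fin 8 → Fin 8 → Fin 8 → Fin 8 → Fin 8 → ℝ,
      ∑ a, ∑ j, ∑ m, ∑ i, ∑ k, ∑ b, f a j m i k b =
        ∑ j, ∑ k, ∑ i, ∑ m, ∑ b, ∑ a, f a j m i k b := by
    intro f
    let e : (Fin 8 × Fin 8 × Fin 8) × Fin 8 × Fin 8 × Fin 8 ≃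
        (Fin 8 × Fin 8 × Fin 8) × Fin 8 × Fin 8 × Fin 8 :=
      { toFun := fun x => ((x.2.2.2, x.1.1, x.2.1), x.1.2.2, x.1.2.1, x.2.2.1)
        invFun := fun x => ((x.1.2.1, x.2.2.1, x.2.1), x.1.2.2, x.2.2.2, x.1.1)
        left_inv := fun _ => rfl
        right_inv := fun _ => rfl }
    simpa only [Fintype.sum_prod_type, e, Equiv.coe_fn_mk] using
      (e.sum_comp fun x => f x.1.1 x.1.2.1 x.1.2.2 x.2.1 x.2.2.1 x.2.2.2).symm
  simp only [Finset.sum_mul_sum]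
  simp only [codiffSq, Matrix.vecMul, dotProduct, codiffVec, Fintype.sum_prod_type, cube_apply,
    Finset.mul_sum, Finset.sum_mul]
  rw [h_reindex]
  refine Finset.sum_congr rfl fun j _ => Finset.sum_congr rfl fun k _ =>
    Finset.sum_congr rfl fun i _ => Finset.sum_congr rfl fun m _ =>
    Finset.sum_congr rfl fun b _ => Finset.sum_congr rfl fun a _ => ?_
  have h_apply : invMetricMat g u i a = invMetric g i a u := rfl
  rw [(h.alt₃_codiff hu).rotate a j m, h_symm j, h_symm m, h_apply]
  ring

theorem sum_invMetric_mul_codiff_eq_zero (h : LocalSpin7 U g φ) (hu : u ∈ U) (k : Fin 8) :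
    ∑ i, ∑ l, invMetric g i l u * codiff g φ i k l u = 0 :=
  sum_mul_eq_zero_of_antisymm (fun i l => congrFun₂ (h.invMetricMat_transpose hu) l i)
    fun i l => (h.alt₃_codiff hu).swap₁₃ i k l

theorem scal_torsionConn (h : LocalSpin7 U g φ) (hu : u ∈ U)
    (hθ : ∀ v ∈ U, ∀ a, lee g φ a v = 0) :
    scal g (torsionConn g φ) u = scal g (christoffel g) u - 1 / 4 * codiffSq g φ u := by
  have h_torsion : ∀ v ∈ U, ∀ i j k, torsion g φ i j k v = codiff g φ i j k v := fun v hv =>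
    torsion_eq_codiff (hθ v hv)
  have h_smooth : ∀ k i j, ContDiffOn ℝ ∞
      (fun v => 1 / 2 * ∑ l, invMetric g k l v * torsion g φ i j l v) U := fun k i j =>
    contDiffOn_const.mul <| ContDiffOn.sum fun l _ => (h.smooth_invMetricMat k l).mul <|
      (h.smooth_codiff i j l).congr fun v hv => h_torsion v hv i j l
  have h_scal := scal_add (g := g) (A := christoffel g) h.isOpen hu (h.invMetricMat_transpose hu)
    (fun k i j => (h.smooth_leviCivita i).differentiableAt h.isOpen hu j k)
    (fun k i j => differentiableAt_of_contDiffOn h.isOpen (h_smooth k i j) hu)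
    (h.christoffel_symm hu)
    (fun v hv k i j => by
      simp only [h_torsion v hv, (h.alt₃_codiff hv).swap₁₂ i j, mul_neg, Finset.sum_neg_distrib])
    (fun v hv k => by
      simp only [h_torsion v hv, ← Finset.mul_sum, h.sum_invMetric_mul_codiff_eq_zero hv, mul_zero])
  simp only [h_torsion u hu] at h_scal
  refine h_scal.trans ?_
  rw [h.codiffSq_eq hu]
  simp only [mul_mul_mul_comm (1 / 2 : ℝ), ← Finset.mul_sum]
  simp only [mul_left_comm _ (1 / 2 * (1 / 2) : ℝ), ← Finset.mul_sum]
  norm_num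

end LocalSpin7

theorem Alt₄.sum_mul_alternation {ι : Type*} [Fintype ι] {R : ι → ι → ι → ι → ℝ} (hR : Alt₄ R)
    (D : ι → ι → ι → ι → ℝ) :
    ∑ a, ∑ i, ∑ j, ∑ k, R a i j k * (D a i j k - D i a j k + D j a i k - D k a i j) =
      4 * ∑ a, ∑ i, ∑ j, ∑ k, R a i j k * D a i j k := by
  have h₂ : ∑ a, ∑ i, ∑ j, ∑ k, R a i j k * D i a j k =
      -∑ a, ∑ i, ∑ j, ∑ k, R a i j k * D a i j k := by
    rw [Finset.sum_comm]
    simp only [← Finset.sum_neg_distrib, ← neg_mul, ← hR.swap₁₂]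
  have h₃ : ∑ a, ∑ i, ∑ j, ∑ k, R a i j k * D j a i k =
      -∑ a, ∑ i, ∑ j, ∑ k, R a i j k * D i a j k := by
    rw [Finset.sum_congr rfl fun a _ => Finset.sum_comm]
    simp only [← Finset.sum_neg_distrib, ← neg_mul, ← hR.swap₂₃]
  have h₄ : ∑ a, ∑ i, ∑ j, ∑ k, R a i j k * D k a i j =
      -∑ a, ∑ i, ∑ j, ∑ k, R a i j k * D j a i k := by
    rw [Finset.sum_congr rfl fun a _ => Finset.sum_congr rfl fun i _ => Finset.sum_comm]
    simp only [← Finset.sum_neg_distrib, ← neg_mul, ← hR.swap₃₄]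
  simp only [mul_sub, mul_add, Finset.sum_add_distrib, Finset.sum_sub_distrib, h₄, h₃, h₂]
  ring

theorem sum_mul_derivCube_apply_eq_zero {ι : Type*} [Fintype ι] [DecidableEq ι]
    {R : ι → ι → ι → ι → ℝ} (hR : Alt₄ R) {F : ι → Matrix ι ι ℝ}
    (hF : ∀ p i j, F p i j = F i p j) (I : ι × ι × ι) :
    ∑ a, (toMat R * derivCube (F a)) a I = 0 := by
  obtain ⟨i, j, k⟩ := I
  have h_apply : ∀ a, (toMat R * derivCube (F a)) a (i, j, k) =
      ∑ s, (F a s i * R a s j k + F a s j * R a i s k + F a s k * R a i j s) := by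
    intro a
    simp only [toMat_apply, Matrix.mul_apply, derivCube_apply, Fintype.sum_prod_type,
      Matrix.one_apply, mul_add, Finset.sum_add_distrib, mul_ite, ite_mul, mul_one, mul_zero,
      one_mul, zero_mul, Finset.sum_ite_eq', Finset.mem_univ, if_true, Finset.sum_const_zero,
      Finset.sum_ite_irrel]
    simp only [mul_comm (R ..)]
  simp only [h_apply, Finset.sum_add_distrib]
  rw [sum_mul_eq_zero_of_antisymm (hF · · i) fun a s => hR.swap₁₂ a s j k,
    sum_mul_eq_zero_of_antisymm (hF · · j) fun a s => (hR.alt₃' k).swap₁₃ a i s,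
    sum_mul_eq_zero_of_antisymm (hF · · k) fun a s => hR.swap₁₄ a i j s, add_zero, add_zero]

/-- The components `φ^{ijkl}` of a 4-form with all indices raised, as a matrix. -/
def raisedForm (g : Comp2) (φ : Comp4) (u : R8) : Matrix (Fin 8) (Fin 8 × Fin 8 × Fin 8) ℝ :=
  invMetricMat g u * formMat φ u * cube (invMetricMat g u)

namespace LocalSpin7

variable {U : Set R8} {g : Comp2} {φ : Comp4} {u : R8}

theorem exists_alt₄_raisedForm (h : LocalSpin7 U g φ) (hu : u ∈ U) :
    ∃ R, Alt₄ R ∧ raisedForm g φ u = toMat R := by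
  refine ⟨_, (h.alt₄_form hu).changeFrame (invMetricMat g u), ?_⟩
  rw [toMat_changeFrame, h.invMetricMat_transpose hu, raisedForm, formMat]

theorem smooth_raisedForm (h : LocalSpin7 U g φ) : MatSmooth U (raisedForm g φ) :=
  (h.smooth_invMetricMat.mul h.smooth_formMat).mul h.smooth_invMetricMat.cube

theorem raisedForm_mulVec_codiffVec (h : LocalSpin7 U g φ) (hu : u ∈ U)
    (hθ : ∀ a, lee g φ a u = 0) : raisedForm g φ u *ᵥ codiffVec g φ u = 0 := by
  have h_codiff : codiffVec g φ u ᵥ* (cube (invMetricMat g u) * (formMat φ u)ᵀ) = 0 := by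
    funext a
    rw [codiffVec_vecMul, h.sum_nablaMat_mul_transpose_eq_zero hu hθ, neg_zero, Pi.zero_apply]
  rw [← Matrix.vecMul_transpose, raisedForm, Matrix.transpose_mul, Matrix.transpose_mul,
    cube_transpose, h.invMetricMat_transpose hu, ← Matrix.mul_assoc, ← Matrix.vecMul_vecMul,
    h_codiff, Matrix.zero_vecMul]

theorem pdMat_raisedForm (h : LocalSpin7 U g φ) (hu : u ∈ U) (p : Fin 8) :
    pdMat p (raisedForm g φ) u =
      invMetricMat g u * nablaMat g φ p u * cube (invMetricMat g u) -
        (leviCivita g p u)ᵀ * raisedForm g φ u -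
        raisedForm g φ u * cubeConn (leviCivita g) p u := by
  have h_cov : covDeriv (dualConn (leviCivita g)) (dualConn (cubeConn (leviCivita g)))
      (raisedForm g φ) p u = invMetricMat g u * nablaMat g φ p u * cube (invMetricMat g u) := by
    refine (covDeriv_mul (B := cubeConn (leviCivita g)) rfl h.isOpen hu
      (h.smooth_invMetricMat.mul h.smooth_formMat) h.smooth_invMetricMat.cube p).trans ?_
    rw [h.covDeriv_cube_invMetricMat hu, covDeriv_mul (B' := leviCivita g)
      dualConn_dualConn.symm h.isOpen hu h.smooth_invMetricMat h.smooth_formMat,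
      h.covDeriv_invMetricMat hu, nablaMat_eq_covDeriv,
      Matrix.zero_mul, zero_add, Matrix.mul_zero, add_zero]
  rw [← h_cov]
  simp only [covDeriv, dualConn, Matrix.transpose_neg, Matrix.transpose_transpose, Matrix.neg_mul,
    Matrix.mul_neg]
  abel

theorem sum_pdMat_raisedForm_apply (h : LocalSpin7 U g φ) (hu : u ∈ U)
    (I : Fin 8 × Fin 8 × Fin 8) : ∑ a, pdMat a (raisedForm g φ) u a I =
      -(codiffVec g φ u ᵥ* cube (invMetricMat g u)) I -
        ∑ a, ((leviCivita g a u)ᵀ * raisedForm g φ u) a I := by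
  obtain ⟨R, hR, h_raised⟩ := h.exists_alt₄_raisedForm hu
  have h_conn : ∑ a, (raisedForm g φ u * cubeConn (leviCivita g) a u) a I = 0 := by
    rw [h_raised]
    exact sum_mul_derivCube_apply_eq_zero hR (F := fun p => leviCivita g p u)
      (fun p i j => h.christoffel_symm hu j p i) I
  simp only [h.pdMat_raisedForm hu, Matrix.sub_apply, Finset.sum_sub_distrib, h_conn, sub_zero,
    codiffVec_vecMul, neg_neg]

theorem extDeriv3_codiff (h : LocalSpin7 U g φ) (hu : u ∈ U)
    (hθ : ∀ v ∈ U, ∀ a, lee g φ a v = 0) (i j k l : Fin 8) :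
    extDeriv3 (codiff g φ) i j k l u = extDeriv3 (torsion g φ) i j k l u := by
  have h_pd : ∀ p i j k, pd p (torsion g φ i j k) u = pd p (codiff g φ i j k) u := fun p i j k =>
    pd_congr h.isOpen (fun v hv => torsion_eq_codiff (hθ v hv) i j k) hu p
  simp only [extDeriv3, h_pd]

theorem sum_raisedForm_mul_pd_codiff (h : LocalSpin7 U g φ) (hu : u ∈ U)
    (hclosed : ∀ i j k l, extDeriv3 (codiff g φ) i j k l u = 0) :
    ∑ a, ∑ I : Fin 8 × Fin 8 × Fin 8,
      raisedForm g φ u a I * pd a (fun v => codiffVec g φ v I) u = 0 := by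
  obtain ⟨R, hR, h_raised⟩ := h.exists_alt₄_raisedForm hu
  have h_alt := hR.sum_mul_alternation fun a i j k => pd a (codiff g φ i j k) u
  simp only [extDeriv3] at hclosed
  simp only [hclosed, mul_zero, Finset.sum_const_zero, zero_eq_mul, OfNat.ofNat_ne_zero,
    false_or] at h_alt
  simpa only [h_raised, Fintype.sum_prod_type, toMat_apply, codiffVec] using h_alt

theorem sum_pdMat_raisedForm_mul_codiffVec (h : LocalSpin7 U g φ) (hu : u ∈ U)
    (hθ : ∀ v ∈ U, ∀ a, lee g φ a v = 0)
    (hclosed : ∀ i j k l, extDeriv3 (codiff g φ) i j k l u = 0) :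
    ∑ a, ∑ I, pdMat a (raisedForm g φ) u a I * codiffVec g φ u I = 0 := by
  have h_diff : ∀ I, DifferentiableAt ℝ (fun v => codiffVec g φ v I) u := fun I =>
    differentiableAt_of_contDiffOn h.isOpen (h.smooth_codiff I.1 I.2.1 I.2.2) hu
  have h_raised := fun a I => h.smooth_raisedForm.differentiableAt h.isOpen hu a I
  have h_pd : ∀ a, ∑ I, pdMat a (raisedForm g φ) u a I * codiffVec g φ u I +
      ∑ I, raisedForm g φ u a I * pd a (fun v => codiffVec g φ v I) u = 0 := by
    intro a
    rw [← Finset.sum_add_distrib, ← pd_eq_zero h.isOpen (fun v hv =>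
      congrFun (h.raisedForm_mulVec_codiffVec hv (hθ v hv)) a) hu a]
    simp only [pdMat_apply, ← pd_mul (h_raised a _) (h_diff _)]
    exact (pd_sum (fun I => (h_raised a I).mul (h_diff I)) a).symm
  have h_sum := Finset.sum_eq_zero (s := Finset.univ) fun a _ => h_pd a
  rwa [Finset.sum_add_distrib, h.sum_raisedForm_mul_pd_codiff hu hclosed, add_zero] at h_sum

theorem codiffSq_eq_zero_of_closed (h : LocalSpin7 U g φ) (hu : u ∈ U)
    (hθ : ∀ v ∈ U, ∀ a, lee g φ a v = 0)
    (hclosed : ∀ i j k l, extDeriv3 (torsion g φ) i j k l u = 0) : codiffSq g φ u = 0 := by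
  have h_pd := h.sum_pdMat_raisedForm_mul_codiffVec hu hθ fun i j k l =>
    (h.extDeriv3_codiff hu hθ i j k l).trans (hclosed i j k l)
  have h_conn : ∑ I, (∑ a, ((leviCivita g a u)ᵀ * raisedForm g φ u) a I) * codiffVec g φ u I =
      0 := by
    simp only [Finset.sum_mul]
    rw [Finset.sum_comm]
    refine Finset.sum_eq_zero fun a _ => ?_
    change (((leviCivita g a u)ᵀ * raisedForm g φ u) *ᵥ codiffVec g φ u) a = 0
    rw [← Matrix.mulVec_mulVec, h.raisedForm_mulVec_codiffVec hu (hθ u hu), Matrix.mulVec_zero,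
      Pi.zero_apply]
  rw [Finset.sum_comm] at h_pd
  simp only [← Finset.sum_mul, h.sum_pdMat_raisedForm_apply hu, sub_mul, Finset.sum_sub_distrib,
    h_conn, neg_mul, Finset.sum_neg_distrib, sub_zero, neg_eq_zero] at h_pd
  exact h_pd

end LocalSpin7

end Spin7

end

theorem mainTheorem11 {M : Type*} [TopologicalSpace M] [ChartedSpace Spin7.R8 M]
    [IsManifold 𝓘(ℝ, Spin7.R8) ∞ M] (S : Spin7.Spin7Structure M) (hθ : S.IsBalanced) :
    (S.RiemannianScalarFlat ∨ S.TorsionScalarFlat → S.IsParallel) ∧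
      (S.HasClosedTorsion → S.IsParallel) := by
  have isParallel_of_codiffSq_eq_zero (h₀ : ∀ e ∈ atlas Spin7.R8 M, ∀ u ∈ e.target,
      Spin7.codiffSq (S.gComp e) (S.ΦComp e) u = 0) : S.IsParallel := by
    intro e he u hu p i j k l
    have h_nabla := (S.localSpin7 he).nablaMat_eq_zero hu (hθ e he u hu) (h₀ e he u hu) p
    exact congrFun₂ h_nabla i (j, k, l)
  refine ⟨fun h_flat => isParallel_of_codiffSq_eq_zero fun e he u hu => ?_, fun h_closed =>
    isParallel_of_codiffSq_eq_zero fun e he u hu =>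
      (S.localSpin7 he).codiffSq_eq_zero_of_closed hu (hθ e he) (h_closed e he u hu)⟩
  have h_scal := (S.localSpin7 he).twelve_mul_scal_christoffel hu (hθ e he)
  have h_scal_torsion := (S.localSpin7 he).scal_torsionConn hu (hθ e he)
  rcases h_flat with h_flat | h_flat
  · linarith [h_flat e he u hu]
  · linarith [h_flat e he u hu]
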